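/- Let $\xi$ be a non-negative integer-valued random variable with $\mathbb{E}\,\xi=1$ and $0<\operatorname{Var}\xi<\infty$. Let $h:=\gcd\{i\ge 1:\mathbb{P}(\xi=i)>0\}$ be its span. Let $\mathcal{T}$ be the (unconditional) Galton--Watson tree with offspring distribution $\xi$: the random rooted ordered tree obtained by starting from a root and independently giving each node a random number of children distributed as $\xi$. For $n$ with $\mathbb{P}(|\mathcal{T}|=n)>0$ let $\mathcal{T}_n$ be $\mathcal{T}$ conditioned on having exactly $n$ nodes. All limits $n\to\infty$ are taken along the integers $n$ with $n-1\equiv 0\pmod h$ (for which $\mathcal{T}_n$ is defined once $n$ is large). For a finite rooted ordered unlabelled tree (plane tree) $T$ and a node $v$ of $T$, let $T_v$ be the fringe subtree of $T$ at $v$, i.e. the plane tree consisting of $v$ and all its descendants. For a set $\mathcal{S}$ of plane trees let $\pi(\mathcal{S}):=\mathbb{P}(\mathcal{T}\in\mathcal{S})$ and let $N_{\mathcal{S}}(\mathcal{T}_n)$ be the number of nodes $v$ of $\mathcal{T}_n$ whose fringe subtree belongs to $\mathcal{S}$. Let $\mathcal{S}_k$ be the set of all plane trees with $k$ nodes, let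 $\mathrm{Po}(\lambda)$ be the Poisson distribution with mean $\lambda$, and let $d_{TV}(X,Y)=\sup_A|\mathbb{P}(X\in A)-\mathbb{P}(Y\in A)|$ be the total variation distance. **Theorem.** Let $k_n\to\infty$ with $k_n=o(n)$. Then $$\lim_{n\to\infty}\ \sup_{\mathcal{S}\subseteq\mathcal{S}_{k_n}} d_{TV}\bigl(N_{\mathcal{S}}(\mathcal{T}_n),\mathrm{Po}(n\pi(\mathcal{S}))\bigr)=0 .$$ Moreover, for every sequence of sets of trees $\mathcal{A}_n\subseteq\mathcal{S}_{k_n}$, as $n\to\infty$: (i) if $n\pi(\mathcal{A}_n)\to 0$, then $\mathbb{P}\bigl(N_{\mathcal{A}_n}(\mathcal{T}_n)=0\bigr)\to 1$; (ii) if $n\pi(\mathcal{A}_n)\to\mu\in(0,\infty)$, then $N_{\mathcal{A}_n}(\mathcal{T}_n)$ converges in distribution to $\mathrm{Po}(\mu)$; (iii) if $n\pi(\mathcal{A}_n)\to\infty$, then $\dfrac{N_{\mathcal{A}_n}(\mathcal{T}_n)-n\pi(\mathcal{A}_n)}{\sqrt{n\pi(\mathcal{A}_n)}}$ converges in distribution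 to the standard normal distribution $N(0,1)$. -/

import Mathlib

open MeasureTheory ProbabilityTheory Filter Topology
open scoped NNReal ENNReal

/-- Finite rooted ordered unlabelled trees (plane trees): a root together with a finite sequence
of `d ≥ 0` subtrees, listed from left to right. -/
inductive PlaneTree : Type
  | node (d : ℕ) (child : Fin d → PlaneTree) : PlaneTree

namespace PlaneTree

/-- The number of nodes of a plane tree. -/
def size : PlaneTree → ℕ
  | node _ child => 1 + ∑ i, (child i).size

/-- The list of all fringe subtrees `T_v`, one entry for each node `v` of `T`, where the nodes `v`
run through `T` in depth-first (preorder) order. -/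
def fringe : PlaneTree → List PlaneTree
  | node d child => node d child :: (List.ofFn fun i => (child i).fringe).flatten

open Classical in
/-- `N_S(T)`: the number of nodes `v` of `T` such that the fringe subtree `T_v` belongs to `S`. -/
noncomputable def fringeCount (S : Set PlaneTree) (T : PlaneTree) : ℕ :=
  T.fringe.countP (fun T' => decide (T' ∈ S))

/-- The set of all plane trees with `k` nodes. -/
def ofSize (k : ℕ) : Set PlaneTree := {T | T.size = k}

/-- Potential nodes are words over `ℕ`: the root is `[]`, and `u ++ [i]` is the `i`-th child of `u`
(counting from `0`). Given a number of children `c u` for every potential node `u`, start from the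
root and give each node `u` that is reached `c u` children. `T.IsGrownFrom c` says that the tree
so obtained is the (finite) plane tree `T`. -/
def IsGrownFrom : PlaneTree → (List ℕ → ℕ) → Prop
  | node d child => fun c => c [] = d ∧ ∀ i : Fin d, (child i).IsGrownFrom fun u => c (i.val :: u)

/-- All sets of plane trees are measurable (there are countably many plane trees). -/
instance : MeasurableSpace PlaneTree := ⊤

end PlaneTree

section GaltonWatson

variable (ν : Measure ℕ) [IsProbabilityMeasure ν]

/-- The law, on finite plane trees, of the unconditional Galton-Watson tree `𝒯` with offspring
law `ν`: the numbers of children `c u` of the potential nodes `u` are independent with law `ν`, and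
`T` has mass `P(𝒯 = T)`. (The probability that `𝒯` is infinite is the missing mass.) -/
noncomputable def gwLaw : Measure PlaneTree :=
  Measure.sum fun T : PlaneTree =>
    Measure.infinitePi (fun _ : List ℕ => ν) {c | T.IsGrownFrom c} • Measure.dirac T

/-- `π(S) = P(𝒯 ∈ S)`. -/
noncomputable def gwProb (S : Set PlaneTree) : ℝ≥0 := (gwLaw ν S).toNNReal

/-- The law of the conditional Galton-Watson tree `𝒯_n`, i.e. of `𝒯` given `|𝒯| = n`.
(It is the zero measure if `P(|𝒯| = n) = 0`, in which case `𝒯_n` is undefined.) -/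
noncomputable def condGWLaw (n : ℕ) : Measure PlaneTree :=
  ProbabilityTheory.cond (gwLaw ν) (PlaneTree.ofSize n)

instance (n : ℕ) : IsZeroOrProbabilityMeasure (condGWLaw ν n) :=
  inferInstanceAs (IsZeroOrProbabilityMeasure (ProbabilityTheory.cond _ _))

/-- The law of the fringe subtree count `N_S(𝒯_n)`. -/
noncomputable def fringeCountLaw (n : ℕ) (S : Set PlaneTree) : FiniteMeasure ℕ :=
  ⟨(condGWLaw ν n).map (PlaneTree.fringeCount S), inferInstance⟩

/-- The law of the normalized count `(N_S(𝒯_n) - n π(S)) / √(n π(S))`. -/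
noncomputable def normalizedFringeCountLaw (n : ℕ) (S : Set PlaneTree) : FiniteMeasure ℝ :=
  ⟨(condGWLaw ν n).map fun T =>
      ((T.fringeCount S : ℝ) - (n : ℝ) * gwProb ν S) / √((n : ℝ) * gwProb ν S), inferInstance⟩

end GaltonWatson

/-- The span `h = gcd {i ≥ 1 : p_i > 0}` of the offspring law: the largest natural number dividing
all those `i`. -/
noncomputable def offspringSpan (ν : Measure ℕ) : ℕ :=
  sSup {d : ℕ | ∀ i : ℕ, 1 ≤ i → 0 < ν {i} → d ∣ i}

/-- The filter for limits `n → ∞` along the integers with `n - 1 ≡ 0 (mod h)`. -/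
noncomputable def admissibleAtTop (ν : Measure ℕ) : Filter ℕ :=
  atTop ⊓ 𝓟 {n : ℕ | n ≡ 1 [MOD offspringSpan ν]}

/-- The total variation distance `sup_A |P(A) - Q(A)|` between two laws on `ℕ`. (For laws of total
mass at most one the supremum is over numbers in `[0, 1]`.) -/
noncomputable def distTV (P Q : Measure ℕ) : ℝ :=
  ⨆ A : Set ℕ, |P.real A - Q.real A|

/-! ### Words with prescribed length and sum -/

/-- The finite set of words over `ℕ` of length `n` whose letters sum to `s`. -/
noncomputable def words (n s : ℕ) : Finset (List ℕ) :=
  (Finset.Nat.antidiagonalTuple n s).image List.ofFn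

theorem mem_words {n s : ℕ} {w : List ℕ} : w ∈ words n s ↔ w.length = n ∧ w.sum = s := by
  simp only [words, Finset.mem_image, Finset.Nat.mem_antidiagonalTuple]
  constructor
  · rintro ⟨x, hx, rfl⟩
    simp [List.sum_ofFn, hx]
  · rintro ⟨rfl, rfl⟩
    exact ⟨w.get, by rw [← List.sum_ofFn, List.ofFn_get], List.ofFn_get w⟩

section Weights

variable (p : ℕ → ℝ)

/-- The weight of a word: the product of the weights of its letters. -/
noncomputable def wt (w : List ℕ) : ℝ := (w.map p).prod

@[simp] theorem wt_nil : wt p [] = 1 := rfl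

@[simp] theorem wt_cons (a : ℕ) (w : List ℕ) : wt p (a :: w) = p a * wt p w := by simp [wt]

theorem wt_append (u v : List ℕ) : wt p (u ++ v) = wt p u * wt p v := by simp [wt]

theorem wt_rotate (w : List ℕ) (i : ℕ) : wt p (w.rotate i) = wt p w :=
  ((List.rotate_perm w i).map p).prod_eq

variable {p} in
theorem wt_nonneg (hp : ∀ j, 0 ≤ p j) (w : List ℕ) : 0 ≤ wt p w := by
  induction w with
  | nil => simp
  | cons a w ih => simpa using mul_nonneg (hp a) ih

/-- The weighted sum of `F` over all words of length `n` and sum `s`. -/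
noncomputable def wsum (n s : ℕ) (F : List ℕ → ℝ) : ℝ := ∑ w ∈ words n s, wt p w * F w

/-- The total weight of all words of length `n` and sum `s`. -/
noncomputable def wtot (n s : ℕ) : ℝ := ∑ w ∈ words n s, wt p w

/-- The total weight of the words of length `n` and sum `s` in `D`. -/
noncomputable def wset (n s : ℕ) (D : Set (List ℕ)) : ℝ :=
  wsum p n s (D.indicator 1)

theorem wsum_one (n s : ℕ) : wsum p n s (fun _ => 1) = wtot p n s := by simp [wsum, wtot]

theorem wsum_const (n s : ℕ) (c : ℝ) : wsum p n s (fun _ => c) = wtot p n s * c := by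
  simp [wsum, wtot, Finset.sum_mul]

theorem wsum_add (n s : ℕ) (F G : List ℕ → ℝ) :
    wsum p n s (fun w => F w + G w) = wsum p n s F + wsum p n s G := by
  simp [wsum, mul_add, Finset.sum_add_distrib]

theorem wsum_sub (n s : ℕ) (F G : List ℕ → ℝ) :
    wsum p n s (fun w => F w - G w) = wsum p n s F - wsum p n s G := by
  simp [wsum, mul_sub, Finset.sum_sub_distrib]

theorem wsum_const_mul (n s : ℕ) (c : ℝ) (F : List ℕ → ℝ) :
    wsum p n s (fun w => c * F w) = c * wsum p n s F := by
  simp only [wsum, Finset.mul_sum]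
  exact Finset.sum_congr rfl fun _ _ => by ring

theorem wsum_sum {ι : Type*} (n s : ℕ) (I : Finset ι) (F : ι → List ℕ → ℝ) :
    wsum p n s (fun w => ∑ i ∈ I, F i w) = ∑ i ∈ I, wsum p n s (F i) := by
  simp only [wsum, Finset.mul_sum]
  rw [Finset.sum_comm]

variable {p} in
theorem wsum_congr {n s : ℕ} {F G : List ℕ → ℝ}
    (h : ∀ w : List ℕ, w.length = n → w.sum = s → F w = G w) : wsum p n s F = wsum p n s G :=
  Finset.sum_congr rfl fun w hw => by rw [h w (mem_words.1 hw).1 (mem_words.1 hw).2]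

variable {p} in
theorem wsum_mono (hp : ∀ j, 0 ≤ p j) {n s : ℕ} {F G : List ℕ → ℝ}
    (h : ∀ w : List ℕ, w.length = n → w.sum = s → F w ≤ G w) : wsum p n s F ≤ wsum p n s G :=
  Finset.sum_le_sum fun w hw =>
    mul_le_mul_of_nonneg_left (h w (mem_words.1 hw).1 (mem_words.1 hw).2) (wt_nonneg hp w)

variable {p} in
theorem wsum_nonneg (hp : ∀ j, 0 ≤ p j) {n s : ℕ} {F : List ℕ → ℝ}
    (h : ∀ w, 0 ≤ F w) : 0 ≤ wsum p n s F :=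
  Finset.sum_nonneg fun w _ => mul_nonneg (wt_nonneg hp w) (h w)

variable {p} in
theorem abs_wsum_le (hp : ∀ j, 0 ≤ p j) (n s : ℕ) (F : List ℕ → ℝ) :
    |wsum p n s F| ≤ wsum p n s (fun w => |F w|) := by
  refine (Finset.abs_sum_le_sum_abs _ _).trans_eq (Finset.sum_congr rfl fun w _ => ?_)
  rw [abs_mul, abs_of_nonneg (wt_nonneg hp w)]

variable {p} in
theorem wtot_nonneg (hp : ∀ j, 0 ≤ p j) (n s : ℕ) : 0 ≤ wtot p n s :=
  Finset.sum_nonneg fun w _ => wt_nonneg hp w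

variable {p} in
theorem wset_nonneg (hp : ∀ j, 0 ≤ p j) (n s : ℕ) (D : Set (List ℕ)) : 0 ≤ wset p n s D :=
  wsum_nonneg hp fun w => Set.indicator_nonneg (fun _ _ => zero_le_one) w

variable {p} in
theorem wset_le_wtot (hp : ∀ j, 0 ≤ p j) (n s : ℕ) (D : Set (List ℕ)) :
    wset p n s D ≤ wtot p n s := by
  rw [← wsum_one]
  exact wsum_mono hp fun w _ _ => Set.indicator_le_self' (fun _ _ => zero_le_one) w

/-- Cauchy--Schwarz for weighted sums. -/
theorem wsum_mul_sq_le {p : ℕ → ℝ} (hp : ∀ j, 0 ≤ p j) (n s : ℕ) (F G : List ℕ → ℝ) :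
    wsum p n s (fun w => F w * G w) ^ 2 ≤
      wsum p n s (fun w => F w ^ 2) * wsum p n s (fun w => G w ^ 2) := by
  have := Finset.sum_mul_sq_le_sq_mul_sq (words n s) (fun w => √(wt p w) * F w)
    (fun w => √(wt p w) * G w)
  simp only [mul_pow, Real.sq_sqrt (wt_nonneg hp _)] at this
  refine le_trans (le_of_eq ?_) this
  congr 1
  refine Finset.sum_congr rfl fun w _ => ?_
  linear_combination (-(F w * G w)) * Real.mul_self_sqrt (wt_nonneg hp w)

theorem wsum_rotate (n s i : ℕ) (F : List ℕ → ℝ) :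
    wsum p n s (fun w => F (w.rotate i)) = wsum p n s F := by
  refine Finset.sum_nbij' (fun w => w.rotate i) (fun w => w.rotate (n - i % n)) ?_ ?_ ?_ ?_ ?_
  · intro w hw
    rw [mem_words] at hw ⊢
    exact ⟨by simp [hw.1], by rw [← hw.2]; exact (List.rotate_perm w i).sum_eq⟩
  · intro w hw
    rw [mem_words] at hw ⊢
    exact ⟨by simp [hw.1], by rw [← hw.2]; exact (List.rotate_perm w _).sum_eq⟩
  · intro w hw
    have hl := (mem_words.1 hw).1
    rcases Nat.eq_zero_or_pos n with rfl | hn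
    · simp [List.length_eq_zero_iff.1 hl]
    · rw [← List.rotate_mod w i, hl, List.rotate_rotate,
        Nat.add_sub_cancel' (Nat.mod_lt i hn).le, ← hl, List.rotate_length]
  · intro w hw
    have hl := (mem_words.1 hw).1
    rcases Nat.eq_zero_or_pos n with rfl | hn
    · simp [List.length_eq_zero_iff.1 hl]
    · rw [← List.rotate_mod _ i, List.length_rotate, hl, List.rotate_rotate,
        Nat.sub_add_cancel (Nat.mod_lt i hn).le, ← hl, List.rotate_length]
  · intro w _
    rw [wt_rotate]

theorem wsum_append (m n s : ℕ) (F : List ℕ → ℝ) :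
    wsum p (m + n) s F = ∑ x ∈ Finset.HasAntidiagonal.antidiagonal s,
      wsum p m x.1 (fun u => wsum p n x.2 (fun v => F (u ++ v))) := by
  simp only [wsum, Finset.mul_sum]
  simp only [← Finset.sum_product' _ _ (fun u v => wt p u * (wt p v * F (u ++ v)))]
  rw [Finset.sum_sigma']
  refine Finset.sum_bij' (fun w _ => ⟨((w.take m).sum, (w.drop m).sum), (w.take m, w.drop m)⟩)
    (fun y _ => y.2.1 ++ y.2.2) ?_ ?_ ?_ ?_ ?_
  · intro w hw
    obtain ⟨h1, h2⟩ := mem_words.1 hw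
    simp only [Finset.mem_sigma, Finset.HasAntidiagonal.mem_antidiagonal, Finset.mem_product, mem_words]
    refine ⟨by rw [List.sum_take_add_sum_drop, h2], ⟨by simp [h1], trivial⟩, by simp [h1], trivial⟩
  · rintro ⟨⟨x, y⟩, u, v⟩ h
    simp only [Finset.mem_sigma, Finset.HasAntidiagonal.mem_antidiagonal, Finset.mem_product, mem_words] at h ⊢
    simp [h.2.1.1, h.2.1.2, h.2.2.1, h.2.2.2, h.1]
  · intro w _
    simp
  · rintro ⟨⟨x, y⟩, u, v⟩ h
    simp only [Finset.mem_sigma, Finset.HasAntidiagonal.mem_antidiagonal, Finset.mem_product, mem_words] at h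
    obtain ⟨-, ⟨h1, rfl⟩, h3, rfl⟩ := h
    simp [← h1]
  · intro w _
    conv_lhs => rw [← List.take_append_drop m w, wt_append]
    simp only [List.take_append_drop]
    ring

/-- Weighted sums over words whose prefix of length `m` lies in a set of words of sum `t`. -/
theorem wsum_prefix {m n s t : ℕ} (D : Set (List ℕ)) (hD : ∀ u ∈ D, u.sum = t)
    (F : List ℕ → ℝ) :
    wsum p (m + n) (t + s) (fun w => D.indicator 1 (w.take m) * F w) =
      wsum p m t (fun u => D.indicator 1 u * wsum p n s (fun v => F (u ++ v))) := by
  rw [wsum_append, Finset.sum_eq_single (t, s)]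
  · refine wsum_congr fun u hu _ => ?_
    rw [← wsum_const_mul]
    refine wsum_congr fun v _ _ => ?_
    rw [← hu, List.take_left]
  · rintro ⟨x, y⟩ hxy hne
    have hx : x ≠ t := by
      rintro rfl
      apply hne
      have := Finset.HasAntidiagonal.mem_antidiagonal.1 hxy
      simp only [Prod.mk.injEq, true_and] at this ⊢
      omega
    have : ∀ u : List ℕ, u.length = m → u.sum = x →
        wsum p n y (fun v => D.indicator 1 ((u ++ v).take m) * F (u ++ v)) = 0 := by
      intro u h1 h2
      have hu : u ∉ D := fun h => hx (by rw [← h2, hD u h])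
      rw [← h1]
      simp [wsum, hu]
    rw [wsum_congr this, wsum_const, mul_zero]
  · simp

end Weights

/-! ### The centred characteristic function of the offspring law -/

section CharFunction

variable (ν : Measure ℕ) [IsProbabilityMeasure ν]

/-- The characteristic function of `ξ - 1`. -/
noncomputable def cphi (t : ℝ) : ℂ := ∫ a : ℕ, Complex.exp (((((a : ℝ) - 1) * t : ℝ) : ℂ) * Complex.I) ∂ν

theorem integrable_of_norm_le_one {f : ℕ → ℂ} (hf : ∀ a, ‖f a‖ ≤ 1) : Integrable f ν :=
  Integrable.of_bound (.of_discrete) 1 (ae_of_all _ hf)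

theorem norm_cphi_le_one (t : ℝ) : ‖cphi ν t‖ ≤ 1 := by
  refine (norm_integral_le_of_norm_le_const (C := 1) (ae_of_all _ fun a => ?_)).trans (by simp)
  rw [Complex.norm_exp_ofReal_mul_I]

theorem continuous_cphi : Continuous (cphi ν) := by
  refine continuous_of_dominated (bound := fun _ => 1) (fun t => .of_discrete)
    (fun t => ae_of_all _ fun a => ?_) (integrable_const _) (ae_of_all _ fun a => by fun_prop)
  rw [Complex.norm_exp_ofReal_mul_I]

theorem norm_exp_mul_I_sub_one_sub_le (y : ℝ) :
    ‖Complex.exp (y * Complex.I) - 1 - y * Complex.I‖ ≤ 2 * y ^ 2 := by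
  have hy : ‖(y : ℂ) * Complex.I‖ = |y| := by simp
  rcases le_total |y| 1 with h | h
  · have := Complex.norm_exp_sub_one_sub_id_le (x := y * Complex.I) (by rwa [hy])
    rw [hy, sq_abs] at this
    nlinarith [sq_nonneg y]
  · refine (norm_sub_le _ _).trans ?_
    have h1 : ‖Complex.exp (y * Complex.I) - 1‖ ≤ |y| := by
      have := Real.norm_exp_I_mul_ofReal_sub_one_le (x := y)
      rwa [mul_comm] at this
    rw [hy]
    nlinarith [sq_abs y]

variable {ν}

theorem integrable_natCast (hL2 : MemLp (fun i : ℕ => (i : ℝ)) 2 ν) :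
    Integrable (fun i : ℕ => (i : ℝ)) ν := hL2.integrable (by norm_num)

theorem integrable_sub_one_sq (hL2 : MemLp (fun i : ℕ => (i : ℝ)) 2 ν) :
    Integrable (fun i : ℕ => ((i : ℝ) - 1) ^ 2) ν :=
  (hL2.sub (memLp_const 1)).integrable_sq

theorem norm_cphi_sub_one_le (hL2 : MemLp (fun i : ℕ => (i : ℝ)) 2 ν)
    (hmean : ∫ i : ℕ, (i : ℝ) ∂ν = 1) (t : ℝ) :
    ‖cphi ν t - 1‖ ≤ 2 * (∫ i : ℕ, ((i : ℝ) - 1) ^ 2 ∂ν) * t ^ 2 := by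
  have hint : Integrable (fun a : ℕ => ((((a : ℝ) - 1) * t : ℝ) : ℂ) * Complex.I) ν :=
    ((((integrable_natCast hL2).sub (integrable_const 1)).mul_const t).ofReal).mul_const _
  have h0 : ∫ a : ℕ, ((((a : ℝ) - 1) * t : ℝ) : ℂ) * Complex.I ∂ν = 0 := by
    rw [integral_mul_const, integral_complex_ofReal, integral_mul_const,
      integral_sub (integrable_natCast hL2) (integrable_const 1), hmean]
    simp
  have h1 : cphi ν t - 1 = ∫ a : ℕ, (Complex.exp (((((a : ℝ) - 1) * t : ℝ) : ℂ) * Complex.I) - 1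
      - ((((a : ℝ) - 1) * t : ℝ) : ℂ) * Complex.I) ∂ν := by
    have hE : Integrable
        (fun a : ℕ => Complex.exp (((((a : ℝ) - 1) * t : ℝ) : ℂ) * Complex.I)) ν :=
      integrable_of_norm_le_one ν fun a => by rw [Complex.norm_exp_ofReal_mul_I]
    rw [integral_sub (f := fun a : ℕ => Complex.exp (((((a : ℝ) - 1) * t : ℝ) : ℂ) * Complex.I) - 1)
      (hE.sub (integrable_const 1)) hint, integral_sub hE (integrable_const 1), h0]
    simp [cphi]
  rw [h1, mul_assoc, mul_comm (∫ i : ℕ, ((i : ℝ) - 1) ^ 2 ∂ν), ← integral_const_mul,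
    ← integral_const_mul]
  refine norm_integral_le_of_norm_le (((integrable_sub_one_sq hL2).const_mul _).const_mul _)
    (ae_of_all _ fun a => (norm_exp_mul_I_sub_one_sub_le _).trans_eq ?_)
  ring

theorem measure_zero_pos (hL2 : MemLp (fun i : ℕ => (i : ℝ)) 2 ν)
    (hmean : ∫ i : ℕ, (i : ℝ) ∂ν = 1) (hvar : 0 < Var[fun i : ℕ => (i : ℝ); ν]) :
    0 < ν.real {0} := by
  by_contra hcon
  have h0 : ν {0} = 0 := by
    have : ν.real {0} = 0 := le_antisymm (not_lt.1 hcon) measureReal_nonneg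
    simpa [measureReal_def, ENNReal.toReal_eq_zero_iff] using this
  have hae : ∀ᵐ i : ℕ ∂ν, 0 ≤ (i : ℝ) - 1 := by
    rw [ae_iff]
    refine measure_mono_null (fun i hi => ?_) h0
    simp only [Set.mem_ofPred_eq, not_le, sub_neg, Nat.cast_lt_one] at hi
    simpa using hi
  have h1 : ∫ i : ℕ, ((i : ℝ) - 1) ∂ν = 0 := by
    rw [integral_sub (integrable_natCast hL2) (integrable_const 1), hmean]
    simp
  rw [integral_eq_zero_iff_of_nonneg_ae hae ((integrable_natCast hL2).sub (integrable_const 1))]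
    at h1
  have h2 : Var[fun i : ℕ => (i : ℝ); ν] = 0 := by
    rw [variance_eq_integral (by fun_prop), hmean]
    refine integral_eq_zero_of_ae ?_
    filter_upwards [h1] with i hi
    simp only [Pi.zero_apply] at hi ⊢
    rw [hi]; norm_num
  exact hvar.ne' h2

theorem exists_pos_measure_pos (hmean : ∫ i : ℕ, (i : ℝ) ∂ν = 1) :
    ∃ a : ℕ, 1 ≤ a ∧ 0 < ν.real {a} := by
  by_contra! hcon
  have hae : ∀ᵐ i : ℕ ∂ν, (i : ℝ) = 0 := by
    rw [ae_iff_of_countable]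
    intro a ha
    by_contra h
    have h1 : 1 ≤ a := Nat.one_le_iff_ne_zero.2 fun h' => h (by simp [h'])
    have := hcon a h1
    exact absurd (ENNReal.toReal_pos ha (measure_ne_top _ _)) (not_lt.2 this)
  rw [integral_eq_zero_of_ae hae] at hmean
  exact zero_ne_one hmean

/-! ### The span -/

theorem measureReal_singleton_pos_iff {a : ℕ} : 0 < ν.real {a} ↔ 0 < ν {a} := by
  rw [measureReal_def, ENNReal.toReal_pos_iff]
  exact ⟨fun h => h.1, fun h => ⟨h, measure_lt_top _ _⟩⟩

theorem offspringSpan_mem (hmean : ∫ i : ℕ, (i : ℝ) ∂ν = 1) :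
    BddAbove {d : ℕ | ∀ i : ℕ, 1 ≤ i → 0 < ν {i} → d ∣ i} ∧
      ∀ i : ℕ, 1 ≤ i → 0 < ν {i} → offspringSpan ν ∣ i := by
  obtain ⟨a, ha1, ha⟩ := exists_pos_measure_pos hmean
  have hb : BddAbove {d : ℕ | ∀ i : ℕ, 1 ≤ i → 0 < ν {i} → d ∣ i} :=
    ⟨a, fun d hd => Nat.le_of_dvd ha1 (hd a ha1 (measureReal_singleton_pos_iff.1 ha))⟩
  exact ⟨hb, Nat.sSup_mem ⟨1, by simp⟩ hb⟩

theorem offspringSpan_dvd (hmean : ∫ i : ℕ, (i : ℝ) ∂ν = 1) {a : ℕ} (ha : ν.real {a} ≠ 0) :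
    offspringSpan ν ∣ a := by
  rcases Nat.eq_zero_or_pos a with rfl | h
  · exact dvd_zero _
  · exact (offspringSpan_mem hmean).2 a h
      (measureReal_singleton_pos_iff.1 (lt_of_le_of_ne measureReal_nonneg ha.symm))

theorem dvd_offspringSpan (hmean : ∫ i : ℕ, (i : ℝ) ∂ν = 1) {d : ℕ}
    (hd : ∀ i : ℕ, 1 ≤ i → 0 < ν {i} → d ∣ i) : d ∣ offspringSpan ν := by
  obtain ⟨hb, hm⟩ := offspringSpan_mem hmean
  have h1 : d.lcm (offspringSpan ν) ≤ offspringSpan ν :=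
    le_csSup hb fun i h1 h2 => Nat.lcm_dvd (hd i h1 h2) (hm i h1 h2)
  have hpos : 0 < offspringSpan ν := by
    refine Nat.lt_of_lt_of_le Nat.zero_lt_one (le_csSup hb fun i _ _ => one_dvd i)
  have h2 := Nat.le_antisymm h1 (Nat.le_of_dvd (Nat.lcm_pos
    (Nat.pos_of_ne_zero fun h => by
      obtain ⟨a, ha1, ha⟩ := exists_pos_measure_pos hmean
      have := hd a ha1 (measureReal_singleton_pos_iff.1 ha)
      rw [h, zero_dvd_iff] at this
      omega) hpos) (Nat.dvd_lcm_right _ _))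
  rw [← h2]
  exact Nat.dvd_lcm_left _ _

theorem offspringSpan_pos (hmean : ∫ i : ℕ, (i : ℝ) ∂ν = 1) : 0 < offspringSpan ν :=
  Nat.lt_of_lt_of_le Nat.zero_lt_one
    (le_csSup (offspringSpan_mem hmean).1 fun i _ _ => one_dvd i)

/-- If all `a t` with `a` in the support are multiples of `2π`, then so is `h t`. -/
theorem exists_int_offspringSpan (hmean : ∫ i : ℕ, (i : ℝ) ∂ν = 1) {t : ℝ}
    (ht : ∀ a : ℕ, 0 < ν.real {a} → ∃ z : ℤ, (a : ℝ) * t = z * (2 * Real.pi)) :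
    ∃ z : ℤ, (offspringSpan ν : ℝ) * t = z * (2 * Real.pi) := by
  let H : AddSubgroup ℤ :=
    { carrier := {d | ∃ z : ℤ, (d : ℝ) * t = z * (2 * Real.pi)}
      add_mem' := by
        rintro a b ⟨x, hx⟩ ⟨y, hy⟩
        exact ⟨x + y, by push_cast; linear_combination hx + hy⟩
      zero_mem' := ⟨0, by simp⟩
      neg_mem' := by
        rintro a ⟨x, hx⟩
        exact ⟨-x, by push_cast; linear_combination -hx⟩ }
  obtain ⟨g, hg⟩ := Int.subgroup_cyclic H
  have hdvd : g.natAbs ∣ offspringSpan ν := by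
    refine dvd_offspringSpan hmean fun i _ h2 => ?_
    have : (i : ℤ) ∈ H := by
      obtain ⟨z, hz⟩ := ht i (measureReal_singleton_pos_iff.2 h2)
      exact ⟨z, by simpa using hz⟩
    rw [hg, AddSubgroup.mem_closure_singleton] at this
    obtain ⟨m, hm⟩ := this
    rw [← Int.natCast_dvd_natCast, Int.natAbs_dvd]
    exact ⟨m, by rw [← hm, smul_eq_mul, mul_comm]⟩
  have : (offspringSpan ν : ℤ) ∈ H := by
    rw [hg, AddSubgroup.mem_closure_singleton]
    rw [← Int.natCast_dvd_natCast, Int.natAbs_dvd] at hdvd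
    obtain ⟨m, hm⟩ := hdvd
    exact ⟨m, by rw [hm, smul_eq_mul, mul_comm]⟩
  obtain ⟨z, hz⟩ := this
  exact ⟨z, by simpa using hz⟩

end CharFunction

section Decay

variable {ν : Measure ℕ} [IsProbabilityMeasure ν]

theorem norm_add_mul_exp_le {x y : ℝ} (hx : 0 ≤ x) (hy : 0 ≤ y) (hxy : x + y ≤ 1) (θ : ℝ) :
    ‖(x : ℂ) + y * Complex.exp (θ * Complex.I)‖ ≤ x + y - x * y * (1 - Real.cos θ) := by
  have hc := Real.cos_le_one θ
  have hc' := Real.neg_one_le_cos θ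
  have h1 : ‖(x : ℂ) + y * Complex.exp (θ * Complex.I)‖ ^ 2
      = (x + y) ^ 2 - 2 * x * y * (1 - Real.cos θ) := by
    rw [Complex.sq_norm, Complex.normSq_apply]
    simp only [Complex.add_re, Complex.ofReal_re, Complex.mul_re, Complex.exp_ofReal_mul_I_re,
      Complex.ofReal_im, Complex.exp_ofReal_mul_I_im, Complex.add_im, Complex.mul_im]
    linear_combination y ^ 2 * Real.sin_sq_add_cos_sq θ
  have hxy2 : x * y ≤ (x + y) / 4 := by nlinarith [sq_nonneg (x - y)]
  have h0 : 0 ≤ x + y - x * y * (1 - Real.cos θ) := by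
    have : x * y * (1 - Real.cos θ) ≤ x * y * 2 :=
      mul_le_mul_of_nonneg_left (by linarith) (mul_nonneg hx hy)
    linarith
  refine abs_le_of_sq_le_sq' ?_ h0 |>.2
  rw [h1]
  have h2 : 0 ≤ x * y * (1 - Real.cos θ) := mul_nonneg (mul_nonneg hx hy) (by linarith)
  nlinarith [sq_nonneg (x * y * (1 - Real.cos θ))]

theorem norm_cphi_le (t : ℝ) {a : ℕ} (ha : 1 ≤ a) :
    ‖cphi ν t‖ ≤ 1 - ν.real {0} * ν.real {a} * (1 - Real.cos (a * t)) := by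
  set f : ℕ → ℂ := fun j => Complex.exp (((((j : ℝ) - 1) * t : ℝ) : ℂ) * Complex.I) with hf
  have hint : Integrable f ν := integrable_of_norm_le_one ν fun a => by
    rw [hf, Complex.norm_exp_ofReal_mul_I]
  set s : Finset ℕ := {0, a} with hs
  have h0a : (0 : ℕ) ≠ a := by omega
  have hsum : ∫ j in (s : Set ℕ), f j ∂ν = ν.real {0} * f 0 + ν.real {a} * f a := by
    rw [setIntegral_finset (hf := hint.integrableOn), hs, Finset.sum_pair h0a]
    simp
  have hmeas : ν.real (s : Set ℕ) = ν.real {0} + ν.real {a} := by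
    rw [← sum_measureReal_singleton, hs, Finset.sum_pair h0a]
  have hcompl : ‖∫ j in (s : Set ℕ)ᶜ, f j ∂ν‖ ≤ 1 - (ν.real {0} + ν.real {a}) := by
    refine (norm_setIntegral_le_of_norm_le_const (C := 1) (measure_lt_top _ _)
      (fun j _ => by rw [hf, Complex.norm_exp_ofReal_mul_I])).trans ?_
    rw [one_mul, probReal_compl_eq_one_sub s.measurableSet, hmeas]
  have hle : ν.real {0} + ν.real {a} ≤ 1 := by
    rw [← hmeas]; exact measureReal_le_one
  have hpair : ‖(ν.real {0} : ℂ) * f 0 + ν.real {a} * f a‖ ≤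
      ν.real {0} + ν.real {a} - ν.real {0} * ν.real {a} * (1 - Real.cos (a * t)) := by
    refine le_trans (le_of_eq ?_) (norm_add_mul_exp_le measureReal_nonneg measureReal_nonneg hle _)
    have h1 : (ν.real {0} : ℂ) * f 0 + ν.real {a} * f a =
        ((ν.real {0} : ℂ) + ν.real {a} * Complex.exp ((a * t : ℝ) * Complex.I))
          * Complex.exp ((-t : ℝ) * Complex.I) := by
      rw [add_mul, mul_assoc, ← Complex.exp_add]
      simp only [hf]
      congr 3
      · push_cast; ring_nf
      · push_cast; ring_nf
    rw [h1, norm_mul, Complex.norm_exp_ofReal_mul_I, mul_one]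
  calc ‖cphi ν t‖ = ‖∫ j in (s : Set ℕ), f j ∂ν + ∫ j in (s : Set ℕ)ᶜ, f j ∂ν‖ := by
        rw [integral_add_compl s.measurableSet hint, cphi]
    _ ≤ _ := (norm_add_le _ _).trans (by rw [hsum]; linarith)

theorem exists_norm_cphi_le_exp (hL2 : MemLp (fun i : ℕ => (i : ℝ)) 2 ν)
    (hmean : ∫ i : ℕ, (i : ℝ) ∂ν = 1) (hvar : 0 < Var[fun i : ℕ => (i : ℝ); ν]) :
    ∃ c > 0, ∀ t : ℝ, |t| ≤ Real.pi / offspringSpan ν → ‖cphi ν t‖ ≤ Real.exp (-c * t ^ 2) := by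
  have hpi := Real.pi_pos
  have h0 := measure_zero_pos hL2 hmean hvar
  obtain ⟨a, ha1, ha⟩ := exists_pos_measure_pos hmean
  have hh : (0 : ℝ) < offspringSpan ν := by exact_mod_cast offspringSpan_pos hmean
  have ha0 : (0 : ℝ) < a := by exact_mod_cast ha1
  set R := Real.pi / offspringSpan ν
  have hR : 0 < R := div_pos hpi hh
  set K : Set ℝ := {t | Real.pi / a ≤ |t| ∧ |t| ≤ R}
  have hK : IsCompact K := by
    refine Metric.isCompact_of_isClosed_isBounded ?_ ?_
    · exact (isClosed_le continuous_const continuous_abs).inter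
        (isClosed_le continuous_abs continuous_const)
    · refine (Metric.isBounded_closedBall (x := (0 : ℝ)) (r := R)).subset fun t ht => ?_
      simpa using ht.2
  have hlt : ∀ t ∈ K, ‖cphi ν t‖ < 1 := by
    rintro t ⟨ht1, ht2⟩
    by_contra! hcon
    have hz : ∀ b : ℕ, 0 < ν.real {b} → ∃ z : ℤ, (b : ℝ) * t = z * (2 * Real.pi) := by
      intro b hb
      rcases Nat.eq_zero_or_pos b with rfl | hb1
      · exact ⟨0, by simp⟩
      have h1 := norm_cphi_le (ν := ν) t hb1
      have h2 : ν.real {0} * ν.real {b} * (1 - Real.cos (b * t)) ≤ 0 := by linarith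
      have h3 : 1 - Real.cos (b * t) ≤ 0 := by
        by_contra! h
        exact absurd h2 (not_le.2 (mul_pos (mul_pos h0 hb) h))
      obtain ⟨z, hz⟩ := (Real.cos_eq_one_iff _).1
        (le_antisymm (Real.cos_le_one (b * t)) (by linarith))
      exact ⟨z, hz.symm⟩
    obtain ⟨z, hz⟩ := exists_int_offspringSpan hmean hz
    have h4 : |(offspringSpan ν : ℝ) * t| ≤ Real.pi := by
      rw [abs_mul, abs_of_pos hh]
      calc (offspringSpan ν : ℝ) * |t| ≤ offspringSpan ν * R :=
            mul_le_mul_of_nonneg_left ht2 hh.le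
        _ = Real.pi := mul_div_cancel₀ _ hh.ne'
    rw [hz, abs_mul, abs_of_pos (by positivity : 0 < 2 * Real.pi)] at h4
    have h5 : |(z : ℝ)| < 1 := by nlinarith
    have h6 : z = 0 := by
      have : |z| < 1 := by exact_mod_cast h5
      exact Int.abs_lt_one_iff.1 this
    rw [h6] at hz
    have h7 : t = 0 := by
      have : (offspringSpan ν : ℝ) * t = 0 := by simpa using hz
      exact (mul_eq_zero.1 this).resolve_left hh.ne'
    rw [h7, abs_zero] at ht1
    exact absurd ht1 (not_le.2 (by positivity))
  obtain ⟨ε, hε, hεK⟩ : ∃ ε > 0, ∀ t ∈ K, ‖cphi ν t‖ ≤ 1 - ε := by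
    rcases K.eq_empty_or_nonempty with hE | hne
    · exact ⟨1, one_pos, by simp [hE]⟩
    · obtain ⟨t0, ht0, hmax⟩ := hK.exists_isMaxOn hne (continuous_cphi ν).norm.continuousOn
      exact ⟨1 - ‖cphi ν t0‖, by linarith [hlt t0 ht0], fun t ht => by
        have := hmax ht
        simp only [Set.mem_ofPred_eq] at this
        linarith⟩
  set c1 := ν.real {0} * ν.real {a} * (2 / Real.pi ^ 2 * a ^ 2)
  have hc1 : 0 < c1 := by positivity
  refine ⟨min c1 (ε / R ^ 2), lt_min hc1 (by positivity), fun t ht => ?_⟩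
  have key : ‖cphi ν t‖ ≤ 1 - min c1 (ε / R ^ 2) * t ^ 2 := by
    rcases le_total (Real.pi / a) |t| with h | h
    · refine (hεK t ⟨h, ht⟩).trans ?_
      have : min c1 (ε / R ^ 2) * t ^ 2 ≤ ε / R ^ 2 * R ^ 2 := by
        refine mul_le_mul (min_le_right _ _) ?_ (sq_nonneg _) (by positivity)
        rw [← sq_abs t]
        exact pow_le_pow_left₀ (abs_nonneg _) ht 2
      rw [div_mul_cancel₀ _ (by positivity)] at this
      linarith
    · refine (norm_cphi_le t ha1).trans ?_
      have hat : |(a : ℝ) * t| ≤ Real.pi := by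
        rw [abs_mul, abs_of_pos ha0]
        rwa [le_div_iff₀ ha0, mul_comm] at h
      have h1 := Real.cos_le_one_sub_mul_cos_sq hat
      have h2 : ν.real {0} * ν.real {a} * (2 / Real.pi ^ 2 * (a * t) ^ 2) ≤
          ν.real {0} * ν.real {a} * (1 - Real.cos (a * t)) :=
        mul_le_mul_of_nonneg_left (by linarith) (by positivity)
      have h3 : min c1 (ε / R ^ 2) * t ^ 2 ≤ c1 * t ^ 2 :=
        mul_le_mul_of_nonneg_right (min_le_left _ _) (sq_nonneg _)
      have h4 : c1 * t ^ 2 = ν.real {0} * ν.real {a} * (2 / Real.pi ^ 2 * (a * t) ^ 2) := by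
        simp only [c1]; ring
      linarith
  refine key.trans ?_
  have := Real.add_one_le_exp (-min c1 (ε / R ^ 2) * t ^ 2)
  linarith

end Decay

/-! ### Fourier inversion -/

section Inversion

variable {ν : Measure ℕ} [IsProbabilityMeasure ν]

theorem words_one (a : ℕ) : words 1 a = {[a]} := by
  ext w
  rw [mem_words, Finset.mem_singleton]
  constructor
  · rintro ⟨h1, h2⟩
    obtain ⟨b, rfl⟩ := List.length_eq_one_iff.1 h1
    simp at h2
    rw [h2]
  · rintro rfl
    simp

theorem wtot_zero (p : ℕ → ℝ) (s : ℕ) : wtot p 0 s = if s = 0 then 1 else 0 := by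
  split_ifs with h
  · subst h
    have : words 0 0 = {[]} := by
      ext w
      rw [mem_words, Finset.mem_singleton, List.length_eq_zero_iff]
      exact ⟨fun h => h.1, fun h => ⟨h, by simp [h]⟩⟩
    simp [wtot, this]
  · refine Finset.sum_eq_zero fun w hw => ?_
    obtain ⟨h1, h2⟩ := mem_words.1 hw
    rw [List.length_eq_zero_iff.1 h1] at h2
    exact absurd h2.symm h

theorem wtot_succ (p : ℕ → ℝ) (m s : ℕ) :
    wtot p (m + 1) s = ∑ a ∈ Finset.range (s + 1), p a * wtot p m (s - a) := by
  rw [← wsum_one, add_comm m 1, wsum_append, Finset.Nat.sum_antidiagonal_eq_sum_range_succ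
    (fun a b => wsum p 1 a (fun u => wsum p m b fun v => 1))]
  refine Finset.sum_congr rfl fun a _ => ?_
  rw [wsum_one, wsum_const, wtot, words_one]
  simp

theorem wtot_eq_zero_of_not_dvd (hmean : ∫ i : ℕ, (i : ℝ) ∂ν = 1) {m s : ℕ}
    (h : ¬ offspringSpan ν ∣ s) : wtot (fun j => ν.real {j}) m s = 0 := by
  induction m generalizing s with
  | zero =>
    rw [wtot_zero, if_neg]
    rintro rfl
    exact h (dvd_zero _)
  | succ m ih =>
    rw [wtot_succ]
    refine Finset.sum_eq_zero fun a ha => ?_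
    by_cases h0 : ν.real {a} = 0
    · rw [h0, zero_mul]
    · rw [ih fun h' => h ?_, mul_zero]
      have := dvd_add (offspringSpan_dvd hmean h0) h'
      rwa [Nat.add_sub_cancel' (by simpa [Nat.lt_succ_iff] using ha)] at this

theorem integral_exp_int_mul (h : ℕ) (hh : 0 < h) (z : ℤ) (hz : (h : ℤ) ∣ z) :
    ∫ t in (-(Real.pi / h))..(Real.pi / h), Complex.exp (((-(z * t) : ℝ) : ℂ) * Complex.I) =
      if z = 0 then (((2 * Real.pi / h : ℝ)) : ℂ) else 0 := by
  have hh' : (h : ℂ) ≠ 0 := by exact_mod_cast hh.ne'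
  split_ifs with h0
  · subst h0
    simp
    ring
  · have hc : (-(z : ℂ) * Complex.I) ≠ 0 :=
      mul_ne_zero (neg_ne_zero.2 (by exact_mod_cast h0)) Complex.I_ne_zero
    have := integral_exp_mul_complex (a := -(Real.pi / h)) (b := Real.pi / h) hc
    calc _ = ∫ t in (-(Real.pi / h))..(Real.pi / h), Complex.exp ((-(z : ℂ) * Complex.I) * t) := by
          congr 1; ext t; push_cast; ring_nf
      _ = 0 := by
          rw [this, div_eq_zero_iff]
          left
          rw [sub_eq_zero, Complex.exp_eq_exp_iff_exists_int]
          obtain ⟨m, rfl⟩ := hz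
          refine ⟨-m, ?_⟩
          push_cast
          field_simp
          ring

/-- The Fourier integral representing `P(S_m = m + x)`. -/
noncomputable def fourierInt (ν : Measure ℕ) (m : ℕ) (x : ℤ) : ℂ :=
  ∫ t in (-(Real.pi / offspringSpan ν))..(Real.pi / offspringSpan ν),
    cphi ν t ^ m * Complex.exp (((-(x * t) : ℝ) : ℂ) * Complex.I)

theorem fourierInt_succ (m : ℕ) (x : ℤ) :
    fourierInt ν (m + 1) x = ∫ a : ℕ, fourierInt ν m (x + 1 - a) ∂ν := by
  unfold fourierInt
  have hcont : ∀ a : ℕ, Continuous fun t : ℝ =>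
      cphi ν t ^ m * Complex.exp (((-((x + 1 - a : ℤ) * t) : ℝ) : ℂ) * Complex.I) := by
    intro a
    have := continuous_cphi ν
    fun_prop
  rw [← intervalIntegral_integral_swap
    (f := fun (t : ℝ) (a : ℕ) => cphi ν t ^ m *
      Complex.exp (((-((x + 1 - a : ℤ) * t) : ℝ) : ℂ) * Complex.I))]
  · refine intervalIntegral.integral_congr fun t _ => ?_
    rw [integral_const_mul, pow_succ, mul_assoc, cphi, ← integral_mul_const]
    congr 1
    refine integral_congr_ae (ae_of_all _ fun a => ?_)
    simp only
    rw [← Complex.exp_add]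
    push_cast
    ring_nf
  · have : IsFiniteMeasure (volume.restrict (Set.uIoc (-(Real.pi / offspringSpan ν))
        (Real.pi / offspringSpan ν))) := ⟨by simp [Set.uIoc]⟩
    refine Integrable.of_bound (C := 1) ?_ (ae_of_all _ fun y => ?_)
    · refine Measurable.aestronglyMeasurable ?_
      exact measurable_from_prod_countable_left fun a => (hcont a).measurable
    · simp only [Function.uncurry, norm_mul, norm_pow, Complex.norm_exp_ofReal_mul_I, mul_one]
      exact pow_le_one₀ (norm_nonneg _) (norm_cphi_le_one ν _)

theorem fourierInt_eq (hmean : ∫ i : ℕ, (i : ℝ) ∂ν = 1) (m : ℕ) (s : ℤ)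
    (hs : (offspringSpan ν : ℤ) ∣ s) :
    fourierInt ν m (s - m) = (((2 * Real.pi / offspringSpan ν : ℝ)) : ℂ) *
      ((if 0 ≤ s then wtot (fun j => ν.real {j}) m s.toNat else 0 : ℝ) : ℂ) := by
  induction m generalizing s with
  | zero =>
    unfold fourierInt
    simp only [pow_zero, one_mul, Nat.cast_zero, sub_zero]
    rw [integral_exp_int_mul _ (offspringSpan_pos hmean) s hs]
    rcases lt_trichotomy s 0 with h | h | h
    · rw [if_neg h.ne, if_neg (not_le.2 h)]; simp
    · subst h; simp [wtot_zero]
    · rw [if_neg h.ne', if_pos h.le, wtot_zero, if_neg]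
      · simp
      · have := Int.toNat_of_nonneg h.le
        omega
  | succ m ih =>
    rw [fourierInt_succ]
    have h1 : (fun a : ℕ => fourierInt ν m (s - ((m + 1 : ℕ) : ℤ) + 1 - a)) =ᵐ[ν] fun a =>
        (((2 * Real.pi / offspringSpan ν : ℝ)) : ℂ) *
        ((if 0 ≤ s - a then wtot (fun j => ν.real {j}) m (s - a).toNat else 0 : ℝ) : ℂ) := by
      rw [Filter.EventuallyEq, ae_iff_of_countable]
      intro a ha
      have h2 : offspringSpan ν ∣ a := offspringSpan_dvd hmean
        (ENNReal.toReal_pos ha (measure_ne_top _ _)).ne'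
      rw [← ih (s - a) (dvd_sub hs (Int.natCast_dvd_natCast.2 h2))]
      congr 1
      push_cast
      ring
    rw [integral_congr_ae h1, integral_const_mul, integral_complex_ofReal]
    congr 2
    have hsupp : ∀ a : ℕ, a ∉ Finset.range (s.toNat + 1) →
        (if 0 ≤ s - a then wtot (fun j => ν.real {j}) m (s - a).toNat else 0 : ℝ) = 0 := by
      intro a ha
      rw [Finset.mem_range, not_lt] at ha
      rw [if_neg]
      omega
    rw [← setIntegral_eq_integral_of_forall_compl_eq_zero
      (s := (Finset.range (s.toNat + 1) : Set ℕ)) (fun a ha => hsupp a (by simpa using ha))]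
    split_ifs with hs0
    · rw [setIntegral_finset (hf := IntegrableOn.finset), wtot_succ]
      refine Finset.sum_congr rfl fun a ha => ?_
      have : a ≤ s.toNat := by simpa [Nat.lt_succ_iff] using ha
      rw [if_pos (by omega), smul_eq_mul]
      congr 2
      omega
    · refine integral_eq_zero_of_ae (ae_of_all _ fun a => ?_)
      simp only [Pi.zero_apply]
      rw [if_neg (by omega)]

/-- Fourier inversion for `P(S_m = s)`. -/
theorem wtot_eq_fourierInt (hmean : ∫ i : ℕ, (i : ℝ) ∂ν = 1) {m s : ℕ} {x : ℤ}
    (hx : (s : ℤ) = m + x) (hs : offspringSpan ν ∣ s) :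
    (wtot (fun j => ν.real {j}) m s : ℂ) =
      (((offspringSpan ν / (2 * Real.pi) : ℝ)) : ℂ) * fourierInt ν m x := by
  have h := fourierInt_eq hmean m s (Int.natCast_dvd_natCast.2 hs)
  have h2 : (s : ℤ) - m = x := by omega
  rw [h2, if_pos (by omega), Int.toNat_natCast] at h
  have hh : (offspringSpan ν : ℂ) ≠ 0 := by exact_mod_cast (offspringSpan_pos hmean).ne'
  have hpi : (Real.pi : ℂ) ≠ 0 := by exact_mod_cast Real.pi_ne_zero
  rw [h]
  push_cast
  field_simp

end Inversion

/-! ### Local limit estimates -/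

section LocalLimit

theorem norm_integral_le_gaussian_moments {c : ℝ} (hc : 0 < c) {R : ℝ} (hR : 0 ≤ R) {m : ℕ}
    (hm : 1 ≤ m) {F : ℝ → ℂ} {α β γ : ℝ} (hα : 0 ≤ α) (hβ : 0 ≤ β) (hγ : 0 ≤ γ)
    (hF : ∀ t, |t| ≤ R → ‖F t‖ ≤ Real.exp (-c * t ^ 2) ^ m * (α + β * |t| + γ * t ^ 2)) :
    ‖∫ t in (-R)..R, F t‖ ≤ √(2 * Real.pi / c) / √m *
      (α + β * (√c)⁻¹ / √m + γ * (2 / c) / m) := by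
  have hm0 : (0 : ℝ) < m := by exact_mod_cast hm
  set b := c * m with hb
  have hb0 : 0 < b := mul_pos hc hm0
  set M := α + β * (√b)⁻¹ + γ * (2 / b) with hM
  have hpt : ∀ t, |t| ≤ R → ‖F t‖ ≤ M * Real.exp (-(b / 2) * t ^ 2) := by
    intro t ht
    refine (hF t ht).trans ?_
    set E := Real.exp (b / 2 * t ^ 2) with hE
    have hE0 : 0 < E := Real.exp_pos _
    have h1 : Real.exp (-c * t ^ 2) ^ m = Real.exp (-(b / 2) * t ^ 2) * E⁻¹ := by
      rw [← Real.exp_nat_mul, hE, ← Real.exp_neg, ← Real.exp_add]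
      congr 1; rw [hb]; ring
    have hE1 : 1 + b / 2 * t ^ 2 ≤ E := by
      have := Real.add_one_le_exp (b / 2 * t ^ 2); linarith
    have hbt : 0 ≤ b / 2 * t ^ 2 := by positivity
    have hα' : α ≤ α * E := le_mul_of_one_le_right hα (by linarith)
    have hsb : 0 < √b := Real.sqrt_pos.2 hb0
    have hβ' : |t| ≤ (√b)⁻¹ * E := by
      rw [inv_mul_eq_div, le_div_iff₀ hsb]
      have h2 : (|t| * √b) ^ 2 = b * t ^ 2 := by
        rw [mul_pow, sq_abs, Real.sq_sqrt hb0.le, mul_comm]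
      nlinarith [sq_nonneg (|t| * √b - 1)]
    have hγ' : t ^ 2 ≤ 2 / b * E := by
      rw [div_mul_eq_mul_div, le_div_iff₀ hb0]
      linarith
    rw [h1, mul_assoc, mul_comm M]
    refine mul_le_mul_of_nonneg_left ?_ (Real.exp_pos _).le
    rw [inv_mul_le_iff₀ hE0, hM]
    nlinarith [mul_le_mul_of_nonneg_left hβ' hβ, mul_le_mul_of_nonneg_left hγ' hγ]
  have hint : Integrable fun t : ℝ => M * Real.exp (-(b / 2) * t ^ 2) :=
    (integrable_exp_neg_mul_sq (half_pos hb0)).const_mul M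
  have hM0 : 0 ≤ M := by positivity
  have h2 : ‖∫ t in (-R)..R, F t‖ ≤ ∫ t in (-R)..R, M * Real.exp (-(b / 2) * t ^ 2) := by
    refine intervalIntegral.norm_integral_le_of_norm_le (by linarith)
      (ae_of_all _ fun t ht => hpt t (abs_le.2 ⟨ht.1.le, ht.2⟩)) hint.intervalIntegrable
  refine h2.trans ?_
  rw [intervalIntegral.integral_of_le (by linarith)]
  refine (setIntegral_le_integral hint (ae_of_all _ fun t => by
    simp only [Pi.zero_apply]; positivity)).trans_eq ?_
  rw [integral_const_mul, integral_gaussian, hM, hb]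
  rw [show Real.pi / (c * m / 2) = 2 * Real.pi / c / m by field_simp,
    Real.sqrt_div (by positivity), Real.sqrt_mul hc.le]
  field_simp

theorem norm_pow_sub_one_le {z : ℂ} (hz : ‖z‖ ≤ 1) (k : ℕ) : ‖z ^ k - 1‖ ≤ k * ‖z - 1‖ := by
  induction k with
  | zero => simp
  | succ k ih =>
    have : z ^ (k + 1) - 1 = z ^ k * (z - 1) + (z ^ k - 1) := by ring
    rw [this]
    refine (norm_add_le _ _).trans ?_
    rw [norm_mul, norm_pow]
    have := mul_le_of_le_one_left (norm_nonneg (z - 1)) (pow_le_one₀ (n := k) (norm_nonneg z) hz)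
    push_cast
    linarith

variable {ν : Measure ℕ} [IsProbabilityMeasure ν]

theorem norm_exp_ofReal_mul_I_sub_one_le (t : ℝ) : ‖Complex.exp (t * Complex.I) - 1‖ ≤ |t| := by
  have := Real.norm_exp_I_mul_ofReal_sub_one_le (x := t)
  rwa [mul_comm] at this

theorem continuous_cphi_pow_mul_exp (m : ℕ) (x : ℝ) :
    Continuous fun t : ℝ => cphi ν t ^ m * Complex.exp (((-(x * t) : ℝ) : ℂ) * Complex.I) := by
  have := continuous_cphi ν
  fun_prop

theorem wtot_le_div_sqrt (hL2 : MemLp (fun i : ℕ => (i : ℝ)) 2 ν)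
    (hmean : ∫ i : ℕ, (i : ℝ) ∂ν = 1) (hvar : 0 < Var[fun i : ℕ => (i : ℝ); ν]) :
    ∃ C > 0, ∀ m s : ℕ, 1 ≤ m → wtot (fun j => ν.real {j}) m s ≤ C / √m := by
  obtain ⟨c, hc, hdec⟩ := exists_norm_cphi_le_exp hL2 hmean hvar
  have hh : (0 : ℝ) < offspringSpan ν := by exact_mod_cast offspringSpan_pos hmean
  refine ⟨offspringSpan ν / (2 * Real.pi) * √(2 * Real.pi / c), by positivity,
    fun m s hm => ?_⟩
  by_cases hs : offspringSpan ν ∣ s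
  · have h1 := wtot_eq_fourierInt hmean (m := m) (s := s) (x := s - m) (by ring) hs
    have h2 := norm_integral_le_gaussian_moments hc (R := Real.pi / offspringSpan ν)
      (by positivity) hm (F := fun t => cphi ν t ^ m *
        Complex.exp (((-(((s - m : ℤ) : ℝ) * t) : ℝ) : ℂ) * Complex.I)) (α := 1) (β := 0) (γ := 0)
      zero_le_one le_rfl le_rfl (fun t ht => by
        rw [norm_mul, norm_pow, Complex.norm_exp_ofReal_mul_I]
        simp only [zero_mul, add_zero, mul_one]
        exact pow_le_pow_left₀ (norm_nonneg _) (hdec t ht) m)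
    have h3 := congrArg norm h1
    rw [Complex.norm_real, Real.norm_of_nonneg (wtot_nonneg (fun _ => measureReal_nonneg) _ _),
      norm_mul, Complex.norm_real, Real.norm_of_nonneg (by positivity)] at h3
    rw [h3, fourierInt, mul_div_assoc]
    refine mul_le_mul_of_nonneg_left ?_ (by positivity)
    simpa using h2
  · rw [wtot_eq_zero_of_not_dvd hmean hs]
    positivity

/-- First and second differences of `P(S_m = m + x)` along the window structure. -/
theorem wtot_differences (hL2 : MemLp (fun i : ℕ => (i : ℝ)) 2 ν)
    (hmean : ∫ i : ℕ, (i : ℝ) ∂ν = 1) (hvar : 0 < Var[fun i : ℕ => (i : ℝ); ν]) :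
    ∃ C > 0, ∀ m k : ℕ, 1 ≤ m → 1 ≤ k → m + 2 * k ≡ 1 [MOD offspringSpan ν] →
      k ≡ 1 [MOD offspringSpan ν] →
      |wtot (fun j => ν.real {j}) (m + 2 * k) (m + 2 * k - 1) -
        wtot (fun j => ν.real {j}) (m + k) (m + k)| ≤ C * (1 / m + k / (m * √m)) ∧
      |wtot (fun j => ν.real {j}) m (m + 1) -
        wtot (fun j => ν.real {j}) (m + k) (m + k)| ≤ C * (1 / m + k / (m * √m)) ∧
      |wtot (fun j => ν.real {j}) (m + 2 * k) (m + 2 * k - 1) +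
        wtot (fun j => ν.real {j}) m (m + 1) -
        2 * wtot (fun j => ν.real {j}) (m + k) (m + k)| ≤ C * (k / (m * √m)) := by
  obtain ⟨c, hc, hdec⟩ := exists_norm_cphi_le_exp hL2 hmean hvar
  have hh : (0 : ℝ) < offspringSpan ν := by exact_mod_cast offspringSpan_pos hmean
  set V := 2 * (∫ i : ℕ, ((i : ℝ) - 1) ^ 2 ∂ν) with hV
  have hV0 : 0 ≤ V := mul_nonneg (by norm_num) (integral_nonneg fun _ => sq_nonneg _)
  set K := offspringSpan ν / (2 * Real.pi) with hK
  have hK0 : 0 < K := by positivity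
  set A := √(2 * Real.pi / c) with hA
  have hA0 : 0 < A := by positivity
  have hsc : 0 < (√c)⁻¹ := by positivity
  refine ⟨K * A * ((√c)⁻¹ + (4 * V + 4) * (2 / c)), by positivity, fun m k hm hk hn hkh => ?_⟩
  have hm0 : (0 : ℝ) < m := by exact_mod_cast hm
  have hk1 : (1 : ℝ) ≤ k := by exact_mod_cast hk
  have d1 : offspringSpan ν ∣ m + 2 * k - 1 := (Nat.modEq_iff_dvd' (by omega)).1 hn.symm
  have d2 : offspringSpan ν ∣ k - 1 := (Nat.modEq_iff_dvd' (by omega)).1 hkh.symm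
  have d3 : offspringSpan ν ∣ m + k := by
    have := Nat.dvd_sub d1 d2
    rwa [show m + 2 * k - 1 - (k - 1) = m + k by omega] at this
  have d4 : offspringSpan ν ∣ m + 1 := by
    have := Nat.dvd_sub d3 d2
    rwa [show m + k - (k - 1) = m + 1 by omega] at this
  have ea := wtot_eq_fourierInt hmean (m := m + 2 * k) (s := m + 2 * k - 1) (x := -1)
    (by push_cast; omega) d1
  have eb := wtot_eq_fourierInt hmean (m := m + k) (s := m + k) (x := 0) (by push_cast; omega) d3
  have ec := wtot_eq_fourierInt hmean (m := m) (s := m + 1) (x := 1) (by push_cast; omega) d4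
  set wa := wtot (fun j => ν.real {j}) (m + 2 * k) (m + 2 * k - 1)
  set wb := wtot (fun j => ν.real {j}) (m + k) (m + k)
  set wc := wtot (fun j => ν.real {j}) m (m + 1)
  set R := Real.pi / offspringSpan ν with hR
  have hR0 : 0 ≤ R := by positivity
  set Fa : ℝ → ℂ := fun t => cphi ν t ^ (m + 2 * k) *
    Complex.exp (((-(((-1 : ℤ) : ℝ) * t) : ℝ) : ℂ) * Complex.I) with hFa
  set Fb : ℝ → ℂ := fun t => cphi ν t ^ (m + k) *
    Complex.exp (((-(((0 : ℤ) : ℝ) * t) : ℝ) : ℂ) * Complex.I) with hFb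
  set Fc : ℝ → ℂ := fun t => cphi ν t ^ m *
    Complex.exp (((-(((1 : ℤ) : ℝ) * t) : ℝ) : ℂ) * Complex.I) with hFc
  have ia : IntervalIntegrable Fa volume (-R) R :=
    (continuous_cphi_pow_mul_exp _ _).intervalIntegrable _ _
  have ib : IntervalIntegrable Fb volume (-R) R :=
    (continuous_cphi_pow_mul_exp _ _).intervalIntegrable _ _
  have ic : IntervalIntegrable Fc volume (-R) R :=
    (continuous_cphi_pow_mul_exp _ _).intervalIntegrable _ _
  have hφ1 : ∀ t, ‖cphi ν t‖ ≤ 1 := norm_cphi_le_one ν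
  have hφk : ∀ (j : ℕ) t, ‖cphi ν t ^ j - 1‖ ≤ j * (V * t ^ 2) := fun j t =>
    (norm_pow_sub_one_le (hφ1 t) j).trans
      (mul_le_mul_of_nonneg_left (norm_cphi_sub_one_le hL2 hmean t) (Nat.cast_nonneg _))
  have hfac : ∀ (t : ℝ) (z : ℂ) (y : ℝ), |t| ≤ R → ‖z‖ ≤ y →
      ‖cphi ν t ^ m * z‖ ≤ Real.exp (-c * t ^ 2) ^ m * y := by
    intro t z y ht hz
    rw [norm_mul, norm_pow]
    exact mul_le_mul (pow_le_pow_left₀ (norm_nonneg _) (hdec t ht) m) hz (norm_nonneg _)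
      (by positivity)
  have hexp : ∀ t : ℝ, Complex.exp (((-(((-1 : ℤ) : ℝ) * t) : ℝ) : ℂ) * Complex.I) =
      Complex.exp ((t : ℂ) * Complex.I) := fun t => by congr 2; push_cast; ring
  have hexp' : ∀ t : ℝ, Complex.exp (((-(((1 : ℤ) : ℝ) * t) : ℝ) : ℂ) * Complex.I) =
      Complex.exp (((-t : ℝ) : ℂ) * Complex.I) := fun t => by congr 2; push_cast; ring
  have hexp0 : ∀ t : ℝ, Complex.exp (((-(((0 : ℤ) : ℝ) * t) : ℝ) : ℂ) * Complex.I) = 1 :=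
    fun t => by simp
  have hsm : 0 < √(m : ℝ) := Real.sqrt_pos.2 hm0
  have hss : √(m : ℝ) * √m = m := Real.mul_self_sqrt hm0.le
  have hfin : ∀ β γ : ℝ, A / √m * (0 + β * (√c)⁻¹ / √m + γ * (2 / c) / m) =
      A * (β * (√c)⁻¹ * (1 / m) + γ * (2 / c) * (1 / (m * √m))) := by
    intro β γ
    rw [zero_add, mul_add]
    have e1 : A / √m * (β * (√c)⁻¹ / √m) = A * (β * (√c)⁻¹ * (1 / m)) := by
      rw [div_mul_div_comm, hss]; ring
    rw [e1]
    field_simp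
  have hq : (0 : ℝ) ≤ 1 / m := by positivity
  have hq' : (0 : ℝ) ≤ 1 / (m * √m) := by positivity
  have hfirst : ∀ F : ℝ → ℂ, (∀ t, |t| ≤ R → ‖F t‖ ≤ Real.exp (-c * t ^ 2) ^ m *
      (0 + 1 * |t| + (k * V) * t ^ 2)) →
      K * ‖∫ t in (-R)..R, F t‖ ≤ K * A * ((√c)⁻¹ + (4 * V + 4) * (2 / c)) *
        (1 / m + k / (m * √m)) := by
    intro F hF
    have h := norm_integral_le_gaussian_moments hc hR0 hm le_rfl zero_le_one (by positivity) hF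
    rw [hfin] at h
    have h2 : 1 * (√c)⁻¹ * (1 / m) + k * V * (2 / c) * (1 / (m * √m)) ≤
        ((√c)⁻¹ + (4 * V + 4) * (2 / c)) * (1 / m + k / (m * √m)) := by
      have e : (k : ℝ) / (m * √m) = k * (1 / (m * √m)) := by ring
      rw [e]
      have hc2 : 0 < 2 / c := by positivity
      have p1 : 0 ≤ (√c)⁻¹ * (k * (1 / (m * √m))) := by positivity
      have p2 : 0 ≤ (4 * V + 4) * (2 / c) * (1 / m) := by positivity
      have p3 : 0 ≤ (3 * V + 4) * (2 / c) * (k * (1 / (m * √m))) := by positivity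
      nlinarith
    calc K * ‖∫ t in (-R)..R, F t‖ ≤ K * (A * _) := mul_le_mul_of_nonneg_left h hK0.le
      _ ≤ K * (A * (((√c)⁻¹ + (4 * V + 4) * (2 / c)) * (1 / m + k / (m * √m)))) := by gcongr
      _ = _ := by ring
  have habs : ∀ (x : ℝ) (F : ℝ → ℂ), (x : ℂ) = (K : ℂ) * ∫ t in (-R)..R, F t →
      |x| = K * ‖∫ t in (-R)..R, F t‖ := by
    intro x F hx
    have := congrArg norm hx
    rwa [Complex.norm_real, norm_mul, Complex.norm_real, Real.norm_of_nonneg hK0.le] at this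
  refine ⟨?_, ?_, ?_⟩
  · rw [habs (wa - wb) (fun t => Fa t - Fb t)]
    · refine hfirst _ fun t ht => ?_
      have : Fa t - Fb t = cphi ν t ^ m * (cphi ν t ^ k * (cphi ν t ^ k *
          Complex.exp (t * Complex.I) - 1)) := by
        simp only [hFa, hFb, hexp, hexp0]; ring
      rw [this]
      refine hfac t _ _ ht ?_
      rw [norm_mul, norm_pow]
      refine (mul_le_of_le_one_left (norm_nonneg _)
        (pow_le_one₀ (norm_nonneg _) (hφ1 t))).trans ?_
      have e : cphi ν t ^ k * Complex.exp (t * Complex.I) - 1 =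
        (cphi ν t ^ k - 1) * Complex.exp (t * Complex.I) + (Complex.exp (t * Complex.I) - 1) := by
        ring
      rw [e]
      refine (norm_add_le _ _).trans ?_
      rw [norm_mul, Complex.norm_exp_ofReal_mul_I]
      linarith [hφk k t, norm_exp_ofReal_mul_I_sub_one_le t]
    · rw [intervalIntegral.integral_sub ia ib, mul_sub]
      push_cast
      rw [ea, eb]; rfl
  · rw [habs (wc - wb) (fun t => Fc t - Fb t)]
    · refine hfirst _ fun t ht => ?_
      have : Fc t - Fb t = cphi ν t ^ m * (Complex.exp ((-t : ℝ) * Complex.I) - cphi ν t ^ k) := by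
        simp only [hFb, hFc, hexp', hexp0]; ring
      rw [this]
      refine hfac t _ _ ht ?_
      have e : Complex.exp ((-t : ℝ) * Complex.I) - cphi ν t ^ k =
        (Complex.exp ((-t : ℝ) * Complex.I) - 1) - (cphi ν t ^ k - 1) := by ring
      rw [e]
      refine (norm_sub_le _ _).trans ?_
      have := norm_exp_ofReal_mul_I_sub_one_le (-t)
      rw [abs_neg] at this
      linarith [hφk k t]
    · rw [intervalIntegral.integral_sub ic ib, mul_sub]
      push_cast
      rw [ec, eb]; rfl
  · rw [habs (wa + wc - 2 * wb) (fun t => Fa t + Fc t - 2 * Fb t)]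
    · have h := norm_integral_le_gaussian_moments (F := fun t => Fa t + Fc t - 2 * Fb t) hc hR0 hm
        le_rfl le_rfl (γ := (4 * V + 4) * k) (by positivity) (fun t ht => by
          have : Fa t + Fc t - 2 * Fb t = cphi ν t ^ m * ((cphi ν t ^ (2 * k) - 1) *
              Complex.exp (t * Complex.I) - 2 * (cphi ν t ^ k - 1) +
              ((Complex.exp (t * Complex.I) - 1 - t * Complex.I) +
              (Complex.exp ((-t : ℝ) * Complex.I) - 1 - (-t : ℝ) * Complex.I))) := by
            simp only [hFa, hFb, hFc, hexp, hexp', hexp0]; push_cast; ring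
          rw [this]
          refine hfac t _ _ ht ?_
          refine (norm_add_le _ _).trans ((add_le_add (norm_sub_le _ _) (norm_add_le _ _)).trans ?_)
          rw [norm_mul, norm_mul, Complex.norm_exp_ofReal_mul_I, mul_one]
          have h1 := hφk (2 * k) t
          have h2 := hφk k t
          have h3 := norm_exp_mul_I_sub_one_sub_le t
          have h4 := norm_exp_mul_I_sub_one_sub_le (-t)
          rw [neg_sq] at h4
          have h5 : ‖(2 : ℂ)‖ = 2 := by simp
          rw [h5]
          push_cast at h1
          nlinarith [sq_nonneg t, mul_nonneg (sub_nonneg.2 hk1) (sq_nonneg t)])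
      rw [hfin] at h
      calc K * ‖∫ t in (-R)..R, Fa t + Fc t - 2 * Fb t‖ ≤ K * (A * _) :=
            mul_le_mul_of_nonneg_left h hK0.le
        _ = K * A * ((4 * V + 4) * (2 / c)) * (k / (m * √m)) := by ring
        _ ≤ _ := by
          refine mul_le_mul_of_nonneg_right (mul_le_mul_of_nonneg_left ?_ (by positivity))
            (by positivity)
          linarith
    · rw [intervalIntegral.integral_sub (ia.add ic) (ib.const_mul 2),
        intervalIntegral.integral_add ia ic, intervalIntegral.integral_const_mul, mul_sub, mul_add]
      push_cast
      rw [ea, eb, ec, fourierInt, fourierInt, fourierInt]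
      ring

end LocalLimit

section LowerBound

variable {ν : Measure ℕ} [IsProbabilityMeasure ν]

theorem tendsto_cphi_pow (hL2 : MemLp (fun i : ℕ => (i : ℝ)) 2 ν)
    (hmean : ∫ i : ℕ, (i : ℝ) ∂ν = 1) (hvar : 0 < Var[fun i : ℕ => (i : ℝ); ν]) (u : ℝ) :
    Tendsto (fun n : ℕ => cphi ν (u / √n) ^ n) atTop
      (𝓝 (Real.exp (-(Var[fun i : ℕ => (i : ℝ); ν] / 2) * u ^ 2) : ℝ)) := by
  set v := Var[fun i : ℕ => (i : ℝ); ν] with hv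
  have hv' : v = ∫ i : ℕ, ((i : ℝ) - 1) ^ 2 ∂ν := by
    rw [hv, variance_eq_integral (by fun_prop), hmean]
  have hσ : 0 < √v := Real.sqrt_pos.2 hvar
  have h0 : ν[fun i : ℕ => ((i : ℝ) - 1) / √v] = 0 := by
    rw [integral_div, integral_sub (integrable_natCast hL2) (integrable_const 1), hmean]
    simp
  have h1 : ν[(fun i : ℕ => ((i : ℝ) - 1) / √v) ^ 2] = 1 := by
    simp only [Pi.pow_apply, div_pow]
    rw [integral_div, ← hv', Real.sq_sqrt hvar.le, div_self hvar.ne']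
  have h := tendsto_charFun_inv_sqrt_mul_pow (P := ν) (X := fun i : ℕ => ((i : ℝ) - 1) / √v)
    (Measurable.of_discrete).aemeasurable h0 h1 (√v * u)
  have e : ∀ n : ℕ, charFun (ν.map fun i : ℕ => ((i : ℝ) - 1) / √v) ((√n)⁻¹ * (√v * u)) =
      cphi ν (u / √n) := by
    intro n
    rw [charFun_apply_real, integral_map (Measurable.of_discrete).aemeasurable
      (by fun_prop), cphi]
    refine integral_congr_ae (ae_of_all _ fun i => ?_)
    simp only
    rw [← Complex.ofReal_mul]
    congr 3
    field_simp
  simp only [e] at h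
  convert h using 2
  push_cast
  congr 1
  have : ((√v : ℝ) : ℂ) ^ 2 = v := by
    rw [← Complex.ofReal_pow, Real.sq_sqrt hvar.le]
  rw [mul_pow, this]
  ring

theorem tendsto_sqrt_mul_fourierInt (hL2 : MemLp (fun i : ℕ => (i : ℝ)) 2 ν)
    (hmean : ∫ i : ℕ, (i : ℝ) ∂ν = 1) (hvar : 0 < Var[fun i : ℕ => (i : ℝ); ν]) :
    Tendsto (fun n : ℕ => (√n : ℂ) * fourierInt ν n (-1)) atTop
      (𝓝 (∫ u : ℝ, Real.exp (-(Var[fun i : ℕ => (i : ℝ); ν] / 2) * u ^ 2) : ℝ)) := by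
  obtain ⟨c, hc, hdec⟩ := exists_norm_cphi_le_exp hL2 hmean hvar
  have hh : (0 : ℝ) < offspringSpan ν := by exact_mod_cast offspringSpan_pos hmean
  set R := Real.pi / offspringSpan ν with hR
  have hR0 : 0 < R := by positivity
  have hcφ := continuous_cphi ν
  set G : ℕ → ℝ → ℂ := fun n u => Set.indicator (Set.Ioc (-R * √n) (R * √n)) (fun u =>
    cphi ν (u / √n) ^ n * Complex.exp ((u / √n : ℝ) * Complex.I)) u with hG
  have hGint : ∀ᶠ n : ℕ in atTop, ∫ u, G n u = (√n : ℂ) * fourierInt ν n (-1) := by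
    filter_upwards [eventually_ge_atTop 1] with n hn
    have hn0 : 0 < √(n : ℝ) := Real.sqrt_pos.2 (by exact_mod_cast hn)
    rw [hG]
    simp only
    rw [integral_indicator measurableSet_Ioc, ← intervalIntegral.integral_of_le (by nlinarith),
      intervalIntegral.integral_comp_div (fun t : ℝ => cphi ν t ^ n *
        Complex.exp ((t : ℂ) * Complex.I)) hn0.ne', mul_div_cancel_right₀ _ hn0.ne',
      mul_div_cancel_right₀ _ hn0.ne', Complex.real_smul, fourierInt]
    congr 1
    refine intervalIntegral.integral_congr fun t _ => ?_
    congr 3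
    push_cast
    ring
  refine Tendsto.congr' hGint ?_
  rw [← integral_complex_ofReal]
  refine tendsto_integral_of_dominated_convergence (fun u => Real.exp (-c * u ^ 2)) ?_
    (integrable_exp_neg_mul_sq hc) ?_ ?_
  · intro n
    refine (Continuous.aestronglyMeasurable ?_).indicator measurableSet_Ioc
    fun_prop
  · intro n
    refine ae_of_all _ fun u => ?_
    rw [hG]
    simp only
    by_cases hu : u ∈ Set.Ioc (-R * √n) (R * √n)
    · rw [Set.indicator_of_mem hu, norm_mul, norm_pow, Complex.norm_exp_ofReal_mul_I, mul_one]
      have hn0 : 0 < √(n : ℝ) := by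
        by_contra h
        have h0 : √(n : ℝ) = 0 := le_antisymm (not_lt.1 h) (Real.sqrt_nonneg _)
        rw [h0] at hu
        simp at hu
      have hle : |u / √n| ≤ R := by
        rw [abs_div, abs_of_pos hn0, div_le_iff₀ hn0]
        exact abs_le.2 ⟨by linarith [hu.1], hu.2⟩
      refine (pow_le_pow_left₀ (norm_nonneg _) (hdec _ hle) n).trans_eq ?_
      rw [← Real.exp_nat_mul, div_pow, Real.sq_sqrt (Nat.cast_nonneg _)]
      congr 1
      have : (n : ℝ) ≠ 0 := (Real.sqrt_pos.1 hn0).ne'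
      field_simp
    · rw [Set.indicator_of_notMem hu, norm_zero]
      positivity
  · refine ae_of_all _ fun u => ?_
    have hsq : Tendsto (fun n : ℕ => √(n : ℝ)) atTop atTop :=
      Real.tendsto_sqrt_atTop.comp tendsto_natCast_atTop_atTop
    have h1 := tendsto_cphi_pow hL2 hmean hvar u
    have h2 : Tendsto (fun n : ℕ => Complex.exp ((u / √n : ℝ) * Complex.I)) atTop (𝓝 1) := by
      have h3 : Tendsto (fun n : ℕ => u / √(n : ℝ)) atTop (𝓝 0) := hsq.const_div_atTop u
      have h4 : Continuous fun y : ℝ => Complex.exp ((y : ℂ) * Complex.I) := by fun_prop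
      have := (h4.tendsto 0).comp h3
      simpa [Function.comp_def] using this
    have h3 := h1.mul h2
    rw [mul_one] at h3
    refine h3.congr' ?_
    have h4 : Tendsto (fun n : ℕ => R * √(n : ℝ)) atTop atTop := hsq.const_mul_atTop hR0
    filter_upwards [h4.eventually_gt_atTop |u|] with n hn
    rw [hG]
    simp only
    rw [Set.indicator_of_mem]
    have := abs_lt.1 hn
    exact ⟨by linarith [this.1], this.2.le⟩

/-- Lower bound in the local limit theorem for `P(S_n = n - 1)`. -/
theorem exists_div_sqrt_le_wtot (hL2 : MemLp (fun i : ℕ => (i : ℝ)) 2 ν)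
    (hmean : ∫ i : ℕ, (i : ℝ) ∂ν = 1) (hvar : 0 < Var[fun i : ℕ => (i : ℝ); ν]) :
    ∃ c > 0, ∃ n₀ : ℕ, ∀ n ≥ n₀, n ≡ 1 [MOD offspringSpan ν] →
      c / √n ≤ wtot (fun j => ν.real {j}) n (n - 1) := by
  have hh : (0 : ℝ) < offspringSpan ν := by exact_mod_cast offspringSpan_pos hmean
  set L := ∫ u : ℝ, Real.exp (-(Var[fun i : ℕ => (i : ℝ); ν] / 2) * u ^ 2) with hL
  have hL0 : 0 < L := by
    rw [hL, integral_gaussian]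
    positivity
  have h := (tendsto_sqrt_mul_fourierInt hL2 hmean hvar).norm
  rw [Complex.norm_real, Real.norm_of_nonneg hL0.le] at h
  obtain ⟨n₀, hn₀⟩ := eventually_atTop.1 (h.eventually (eventually_ge_nhds (half_lt_self hL0)))
  refine ⟨offspringSpan ν / (2 * Real.pi) * (L / 2), by positivity, max n₀ 1, fun n hn hmod => ?_⟩
  have hn1 : 1 ≤ n := (le_max_right _ _).trans hn
  have hs : 0 < √(n : ℝ) := Real.sqrt_pos.2 (by exact_mod_cast hn1)
  have h1 := hn₀ n ((le_max_left _ _).trans hn)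
  have e := congrArg norm (wtot_eq_fourierInt hmean (m := n) (s := n - 1) (x := -1)
    (by push_cast [hn1]; ring) ((Nat.modEq_iff_dvd' hn1).1 hmod.symm))
  rw [Complex.norm_real, Real.norm_of_nonneg (wtot_nonneg (fun _ => measureReal_nonneg) _ _),
      norm_mul, Complex.norm_real, Real.norm_of_nonneg (by positivity)] at e
  rw [norm_mul, Complex.norm_real, Real.norm_of_nonneg hs.le] at h1
  rw [e, mul_div_assoc]
  refine mul_le_mul_of_nonneg_left ?_ (by positivity)
  rw [div_le_iff₀ hs]
  linarith

/-- The local limit estimates for `P(S_m = s)` used in the sequel. -/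
structure LocalLimitBounds (p : ℕ → ℝ) (h : ℕ) (C c : ℝ) (n₀ : ℕ) : Prop where
  nonneg : ∀ j, 0 ≤ p j
  C_pos : 0 < C
  c_pos : 0 < c
  upper : ∀ m s : ℕ, 1 ≤ m → wtot p m s ≤ C / √m
  lower : ∀ n ≥ n₀, n ≡ 1 [MOD h] → c / √n ≤ wtot p n (n - 1)
  first : ∀ n k : ℕ, 1 ≤ k → 4 * k ≤ n → n ≡ 1 [MOD h] → k ≡ 1 [MOD h] →
    |wtot p n (n - 1) - wtot p (n - k) (n - k)| ≤ C * (1 / n + k / (n * √n))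
  second : ∀ n k : ℕ, 1 ≤ k → 4 * k ≤ n → n ≡ 1 [MOD h] → k ≡ 1 [MOD h] →
    wtot p (n - 2 * k) (n - 2 * k + 1) * wtot p n (n - 1) - wtot p (n - k) (n - k) ^ 2 ≤
      C * (k / n ^ 2)
  vanish : ∀ k : ℕ, 1 ≤ k → ¬ k ≡ 1 [MOD h] → wtot p k (k - 1) = 0

set_option maxHeartbeats 1000000 in
theorem exists_localLimitBounds (hL2 : MemLp (fun i : ℕ => (i : ℝ)) 2 ν)
    (hmean : ∫ i : ℕ, (i : ℝ) ∂ν = 1) (hvar : 0 < Var[fun i : ℕ => (i : ℝ); ν]) :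
    ∃ C c n₀, LocalLimitBounds (fun j => ν.real {j}) (offspringSpan ν) C c n₀ := by
  obtain ⟨C₁, hC₁, h1⟩ := wtot_le_div_sqrt hL2 hmean hvar
  obtain ⟨C₂, hC₂, h2⟩ := wtot_differences hL2 hmean hvar
  obtain ⟨c, hc, n₀, h3⟩ := exists_div_sqrt_le_wtot hL2 hmean hvar
  have hscale : ∀ n k : ℕ, 1 ≤ k → 4 * k ≤ n →
      (1 : ℝ) / (n - 2 * k : ℕ) ≤ 4 * (1 / n) ∧
      (k : ℝ) / ((n - 2 * k : ℕ) * √(n - 2 * k : ℕ)) ≤ 4 * (k / (n * √n)) := by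
    intro n k hk hkn
    have hn0 : (0 : ℝ) < n := by exact_mod_cast (by omega : 0 < n)
    have hm : (n : ℝ) / 2 ≤ (n - 2 * k : ℕ) := by
      rw [div_le_iff₀ two_pos]; exact_mod_cast (by omega : n ≤ (n - 2 * k) * 2)
    have hs : √(n : ℝ) / 2 ≤ √((n - 2 * k : ℕ) : ℝ) := by
      refine Real.le_sqrt_of_sq_le ?_
      rw [div_pow, Real.sq_sqrt hn0.le]
      linarith
    have hsn : 0 < √(n : ℝ) := Real.sqrt_pos.2 hn0
    constructor
    · calc (1 : ℝ) / (n - 2 * k : ℕ) ≤ 1 / (n / 2) := by gcongr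
        _ = 2 * (1 / n) := by field_simp
        _ ≤ 4 * (1 / n) := by gcongr; norm_num
    · calc (k : ℝ) / ((n - 2 * k : ℕ) * √(n - 2 * k : ℕ)) ≤ k / ((n / 2) * (√n / 2)) := by gcongr
        _ = 4 * (k / (n * √n)) := by field_simp; norm_num
  set E := 64 * C₂ ^ 2 + 8 * C₁ * C₂ + 4 * C₂ + C₁ with hE
  have hE1 : C₁ ≤ E := by nlinarith [mul_pos hC₁ hC₂]
  have hE2 : 4 * C₂ ≤ E := by nlinarith [mul_pos hC₁ hC₂]
  refine ⟨E, c, n₀, fun _ => measureReal_nonneg, by positivity, hc, fun m s hm => (h1 m s hm).trans ?_,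
    h3, fun n k hk hkn hn hkh => ?_, fun n k hk hkn hn hkh => ?_, fun k hk1 hk => ?_⟩
  · gcongr
  · obtain ⟨s1, s2⟩ := hscale n k hk hkn
    have := (h2 (n - 2 * k) k (by omega) hk (by rwa [Nat.sub_add_cancel (by omega)]) hkh).1
    rw [Nat.sub_add_cancel (by omega : 2 * k ≤ n), show n - 2 * k + k = n - k by omega] at this
    refine this.trans ?_
    calc C₂ * _ ≤ C₂ * (4 * (1 / n) + 4 * (k / (n * √n))) := by gcongr
      _ = 4 * C₂ * (1 / n + k / (n * √n)) := by ring
      _ ≤ _ := by gcongr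
  · obtain ⟨s1, s2⟩ := hscale n k hk hkn
    obtain ⟨a1, a2, a3⟩ :=
      h2 (n - 2 * k) k (by omega) hk (by rwa [Nat.sub_add_cancel (by omega)]) hkh
    rw [Nat.sub_add_cancel (by omega : 2 * k ≤ n), show n - 2 * k + k = n - k by omega]
      at a1 a3
    rw [show n - 2 * k + k = n - k by omega] at a2
    set wa := wtot (fun j => ν.real {j}) n (n - 1)
    set wb := wtot (fun j => ν.real {j}) (n - k) (n - k)
    set wc := wtot (fun j => ν.real {j}) (n - 2 * k) (n - 2 * k + 1)
    have hn0 : (0 : ℝ) < n := by exact_mod_cast (by omega : 0 < n)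
    have hk0 : (1 : ℝ) ≤ k := by exact_mod_cast hk
    have hkn' : (k : ℝ) ≤ n := by exact_mod_cast (by omega : k ≤ n)
    have hsn : 0 < √(n : ℝ) := Real.sqrt_pos.2 hn0
    have hss : √(n : ℝ) ^ 2 = n := Real.sq_sqrt hn0.le
    set D := C₂ * (4 * (1 / n) + 4 * (k / (n * √n))) with hD
    have b1 : |wa - wb| ≤ D := a1.trans (by rw [hD]; gcongr)
    have b2 : |wc - wb| ≤ D := a2.trans (by rw [hD]; gcongr)
    have hD0 : 0 ≤ D := by positivity
    have b12 : (wa - wb) * (wc - wb) ≤ D * D :=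
      (le_abs_self _).trans (by rw [abs_mul]; exact mul_le_mul b1 b2 (abs_nonneg _) hD0)
    have hDD : D * D ≤ 64 * C₂ ^ 2 * (k / n ^ 2) := by
      have e : D * D = 16 * C₂ ^ 2 * (1 / n + k / (n * √n)) ^ 2 := by rw [hD]; ring
      have e2 : ((1 : ℝ) / n + k / (n * √n)) ^ 2 ≤ 4 * (k / n ^ 2) := by
        have q : ((1 : ℝ) / n + k / (n * √n)) ^ 2 ≤ 2 * (1 / n) ^ 2 + 2 * (k / (n * √n)) ^ 2 := by
          nlinarith [sq_nonneg ((1 : ℝ) / n - k / (n * √n))]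
        have q1 : ((1 : ℝ) / n) ^ 2 ≤ k / n ^ 2 := by rw [div_pow, one_pow]; gcongr
        have q2 : ((k : ℝ) / (n * √n)) ^ 2 ≤ k / n ^ 2 := by
          rw [div_pow, mul_pow, hss, div_le_div_iff₀ (by positivity) (by positivity)]
          nlinarith [mul_nonneg (sub_nonneg.2 hkn') (by positivity : (0 : ℝ) ≤ k * n ^ 2)]
        linarith
      rw [e]
      linarith [mul_le_mul_of_nonneg_left e2 (by positivity : 0 ≤ 16 * C₂ ^ 2)]
    have hwb0 : 0 ≤ wb := wtot_nonneg (fun _ => measureReal_nonneg) _ _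
    have hwb : wb ≤ 2 * C₁ / √n := by
      refine (h1 _ _ (by omega)).trans ?_
      have : √(n : ℝ) / 2 ≤ √((n - k : ℕ) : ℝ) := by
        refine Real.le_sqrt_of_sq_le ?_
        rw [div_pow, hss]
        have : (n : ℝ) / 2 ≤ (n - k : ℕ) := by
          rw [div_le_iff₀ two_pos]; exact_mod_cast (by omega : n ≤ (n - k) * 2)
        linarith
      calc C₁ / √((n - k : ℕ) : ℝ) ≤ C₁ / (√n / 2) := by gcongr
        _ = 2 * C₁ / √n := by field_simp
    have b3 : wb * (wa + wc - 2 * wb) ≤ 2 * C₁ / √n * (C₂ * (4 * (k / (n * √n)))) := by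
      refine (le_abs_self _).trans ?_
      rw [abs_mul, abs_of_nonneg hwb0]
      exact mul_le_mul hwb (a3.trans (by gcongr)) (abs_nonneg _) (by positivity)
    have e3 : 2 * C₁ / √n * (C₂ * (4 * (k / (n * √n)))) = 8 * C₁ * C₂ * (k / n ^ 2) := by
      have : (n : ℝ) ^ 2 = √n * (n * √n) := by
        linear_combination (-(n : ℝ)) * hss
      rw [this]
      field_simp
      norm_num
    rw [e3] at b3
    have hkn2 : 0 ≤ (k : ℝ) / n ^ 2 := by positivity
    calc wc * wa - wb ^ 2 = (wa - wb) * (wc - wb) + wb * (wa + wc - 2 * wb) := by ring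
      _ ≤ 64 * C₂ ^ 2 * (k / n ^ 2) + 8 * C₁ * C₂ * (k / n ^ 2) := by linarith
      _ ≤ E * (k / n ^ 2) := by
        have := mul_nonneg (by positivity : 0 ≤ 4 * C₂ + C₁) hkn2
        rw [hE]
        linarith
  · refine wtot_eq_zero_of_not_dvd hmean fun hd => hk ?_
    exact ((Nat.modEq_iff_dvd' hk1).2 hd).symm

end LowerBound

/-! ### Total variation distance on `ℕ` -/

section TotalVariation

theorem summable_measureReal_singleton (P : Measure ℕ) [IsFiniteMeasure P] :
    Summable fun j => P.real {j} := by
  have := (integrable_const (μ := P) (1 : ℝ))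
  have h := hasSum_integral_measure (f := fun _ : ℕ => (1 : ℝ)) (μ := fun j => P {j} • Measure.dirac j)
    (by rwa [Measure.sum_smul_dirac])
  refine h.summable.congr fun j => ?_
  simp [measureReal_def]

theorem tsum_indicator_measureReal (P : Measure ℕ) [IsFiniteMeasure P] (A : Set ℕ) :
    ∑' j, A.indicator (fun j => P.real {j}) j = P.real A := by
  have h : Integrable (A.indicator (1 : ℕ → ℝ)) P :=
    (integrable_const (1 : ℝ)).indicator A.to_countable.measurableSet
  have := integral_countable h
  rw [integral_indicator_one A.to_countable.measurableSet] at this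
  rw [this]
  refine tsum_congr fun j => ?_
  by_cases hj : j ∈ A <;> simp [hj]

variable {P Q : Measure ℕ}

theorem bddAbove_abs_sub_measureReal (P Q : Measure ℕ) [IsFiniteMeasure P] [IsFiniteMeasure Q] :
    BddAbove (Set.range fun A : Set ℕ => |P.real A - Q.real A|) := by
  refine ⟨P.real Set.univ + Q.real Set.univ, ?_⟩
  rintro _ ⟨A, rfl⟩
  have h1 : P.real A ≤ P.real Set.univ := measureReal_mono (Set.subset_univ _)
  have h2 : Q.real A ≤ Q.real Set.univ := measureReal_mono (Set.subset_univ _)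
  have h3 : 0 ≤ P.real A := measureReal_nonneg
  have h4 : 0 ≤ Q.real A := measureReal_nonneg
  exact abs_le.2 ⟨by linarith, by linarith⟩

theorem abs_sub_le_distTV [IsFiniteMeasure P] [IsFiniteMeasure Q] (A : Set ℕ) :
    |P.real A - Q.real A| ≤ distTV P Q :=
  le_ciSup (bddAbove_abs_sub_measureReal P Q) A

theorem distTV_le {ε : ℝ} (h : ∀ A : Set ℕ, |P.real A - Q.real A| ≤ ε) : distTV P Q ≤ ε :=
  ciSup_le h

theorem distTV_nonneg (P Q : Measure ℕ) : 0 ≤ distTV P Q :=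
  Real.iSup_nonneg fun _ => abs_nonneg _

theorem distTV_triangle {R : Measure ℕ} [IsFiniteMeasure P] [IsFiniteMeasure Q]
    [IsFiniteMeasure R] : distTV P R ≤ distTV P Q + distTV Q R :=
  distTV_le fun A => (abs_sub_le _ (Q.real A) _).trans
    (add_le_add (abs_sub_le_distTV A) (abs_sub_le_distTV A))

theorem tsum_abs_sub_le_distTV [IsFiniteMeasure P] [IsFiniteMeasure Q] :
    ∑' j, |P.real {j} - Q.real {j}| ≤ 2 * distTV P Q := by
  have hP := summable_measureReal_singleton P
  have hQ := summable_measureReal_singleton Q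
  set A : Set ℕ := {j | Q.real {j} ≤ P.real {j}}
  have e : ∀ j, |P.real {j} - Q.real {j}| =
      (A.indicator (fun j => P.real {j}) j - A.indicator (fun j => Q.real {j}) j) +
      (Aᶜ.indicator (fun j => Q.real {j}) j - Aᶜ.indicator (fun j => P.real {j}) j) := by
    intro j
    by_cases hj : j ∈ A
    · have : Q.real {j} ≤ P.real {j} := hj
      simp [hj, abs_of_nonneg (sub_nonneg.2 this)]
    · have : P.real {j} ≤ Q.real {j} := le_of_not_ge hj
      simp [hj, abs_of_nonpos (sub_nonpos.2 this)]
  rw [tsum_congr e, Summable.tsum_add ((hP.indicator A).sub (hQ.indicator A))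
    ((hQ.indicator _).sub (hP.indicator _)), (hP.indicator A).tsum_sub (hQ.indicator A),
    (hQ.indicator _).tsum_sub (hP.indicator _)]
  simp only [tsum_indicator_measureReal]
  have h1 := (abs_le.1 (abs_sub_le_distTV (P := P) (Q := Q) A)).2
  have h2 := (abs_le.1 (abs_sub_le_distTV (P := P) (Q := Q) Aᶜ)).1
  linarith

theorem abs_sub_le_tsum [IsFiniteMeasure P] [IsFiniteMeasure Q] (A : Set ℕ) :
    |P.real A - Q.real A| ≤ ∑' j, |P.real {j} - Q.real {j}| := by
  have hP := summable_measureReal_singleton P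
  have hQ := summable_measureReal_singleton Q
  rw [← tsum_indicator_measureReal P, ← tsum_indicator_measureReal Q,
    ← (hP.indicator A).tsum_sub (hQ.indicator A), ← Real.norm_eq_abs]
  have hs : Summable fun j => |P.real {j} - Q.real {j}| := (hP.sub hQ).abs
  refine tsum_of_norm_bounded hs.hasSum fun j => ?_
  by_cases hj : j ∈ A <;> simp [hj]

theorem abs_integral_sub_le_distTV [IsFiniteMeasure P] [IsFiniteMeasure Q] {f : ℕ → ℝ} {M : ℝ}
    (hf : ∀ j, |f j| ≤ M) : |∫ j, f j ∂P - ∫ j, f j ∂Q| ≤ 2 * M * distTV P Q := by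
  have hM : 0 ≤ M := (abs_nonneg _).trans (hf 0)
  have hP : Integrable f P := .of_bound .of_discrete M (ae_of_all _ hf)
  have hQ : Integrable f Q := .of_bound .of_discrete M (ae_of_all _ hf)
  have sP := summable_measureReal_singleton P
  have sQ := summable_measureReal_singleton Q
  have s : ∀ R : Measure ℕ, Summable (fun j => R.real {j}) →
      Summable fun j => R.real {j} • f j := fun R hR =>
    Summable.of_norm_bounded (hR.mul_left M) fun j => by
      rw [norm_smul, Real.norm_of_nonneg measureReal_nonneg, mul_comm]
      exact mul_le_mul_of_nonneg_right (hf j) measureReal_nonneg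
  rw [integral_countable hP, integral_countable hQ, ← (s P sP).tsum_sub (s Q sQ),
    ← Real.norm_eq_abs]
  refine (tsum_of_norm_bounded ((sP.sub sQ).abs.mul_left M).hasSum fun j => ?_).trans ?_
  · rw [← sub_smul, norm_smul, mul_comm]
    exact mul_le_mul_of_nonneg_right (hf j) (abs_nonneg _)
  · rw [tsum_mul_left]
    nlinarith [tsum_abs_sub_le_distTV (P := P) (Q := Q)]

end TotalVariation

/-! ### Poisson laws -/

section Poisson

theorem hasSum_poissonMeasure_real (r : ℝ≥0) :
    HasSum (fun j => (poissonMeasure r).real {j}) 1 := by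
  simp only [poissonMeasure_real_singleton]
  exact hasSum_one_poissonMeasure r

theorem poissonMeasure_real_succ (r : ℝ≥0) (j : ℕ) :
    ((j : ℝ) + 1) * (poissonMeasure r).real {j + 1} = r * (poissonMeasure r).real {j} := by
  rw [poissonMeasure_real_singleton, poissonMeasure_real_singleton, Nat.factorial_succ]
  push_cast
  field_simp
  ring

/-- The Hellinger bound for two Poisson laws. -/
theorem distTV_poissonMeasure_le (r s : ℝ≥0) :
    distTV (poissonMeasure r) (poissonMeasure s) ≤ 2 * |√(r : ℝ) - √s| := by
  refine distTV_le fun A => (abs_sub_le_tsum A).trans ?_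
  set δ := |√(r : ℝ) - √s| with hδ
  rcases (abs_nonneg _ : 0 ≤ δ).eq_or_lt with h0 | h0
  · have : r = s := by
      have h1 : √(r : ℝ) = √s := sub_eq_zero.1 (abs_eq_zero.1 h0.symm)
      exact NNReal.coe_injective ((Real.sqrt_inj r.2 s.2).1 h1)
    simp only [this, sub_self, abs_zero, tsum_zero, hδ, mul_zero, le_refl]
  have hδ0 : δ ≠ 0 := ne_of_gt h0
  set p : ℕ → ℝ := fun j => (poissonMeasure r).real {j} with hp
  set q : ℕ → ℝ := fun j => (poissonMeasure s).real {j} with hq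
  have hp0 : ∀ j, 0 ≤ p j := fun _ => measureReal_nonneg
  have hq0 : ∀ j, 0 ≤ q j := fun _ => measureReal_nonneg
  have hps : HasSum p 1 := hasSum_poissonMeasure_real r
  have hqs : HasSum q 1 := hasSum_poissonMeasure_real s
  have hpq : HasSum (fun j => √(p j) * √(q j)) (Real.exp (-(δ ^ 2 / 2))) := by
    have h := (hasSum_one_poissonMeasure (NNReal.sqrt (r * s))).mul_left
      (Real.exp (-(δ ^ 2 / 2)))
    rw [mul_one] at h
    refine (congrArg (HasSum · _) (funext fun j => ?_)).mpr h
    rw [← Real.sqrt_mul (hp0 j), hp, hq]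
    simp only [poissonMeasure_real_singleton]
    refine (Real.sqrt_eq_iff_mul_self_eq (by positivity) (by positivity)).2 ?_
    have hsq : (√(r : ℝ)) ^ 2 = r := Real.sq_sqrt r.2
    have hsq' : (√(s : ℝ)) ^ 2 = s := Real.sq_sqrt s.2
    have e1 : ((NNReal.sqrt (r * s) : ℝ≥0) : ℝ) = √(r : ℝ) * √s := by
      rw [NNReal.sqrt_mul, NNReal.coe_mul, Real.coe_sqrt, Real.coe_sqrt]
    rw [e1, hδ, sq_abs]
    have e2 : Real.exp (-(r : ℝ)) * Real.exp (-(s : ℝ)) =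
        (Real.exp (-((√(r : ℝ) - √s) ^ 2 / 2)) * Real.exp (-(√(r : ℝ) * √s))) *
        (Real.exp (-((√(r : ℝ) - √s) ^ 2 / 2)) * Real.exp (-(√(r : ℝ) * √s))) := by
      simp only [← Real.exp_add]
      congr 1
      linear_combination hsq + hsq'
    have e3 : (r : ℝ) ^ j * (s : ℝ) ^ j = (√(r : ℝ) * √s) ^ j * (√(r : ℝ) * √s) ^ j := by
      rw [← mul_pow, ← mul_pow]
      congr 1
      nlinarith
    have hf : ((j.factorial : ℕ) : ℝ) ≠ 0 := by positivity
    field_simp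
    linear_combination ((r : ℝ) ^ j * s ^ j) * e2 + (Real.exp (-((√(r : ℝ) - √s) ^ 2 / 2)) *
      Real.exp (-(√(r : ℝ) * √s))) ^ 2 * e3
  have hpt : ∀ j, |p j - q j| ≤ δ⁻¹ * (p j + q j - 2 * (√(p j) * √(q j))) + δ / 2 * (p j + q j) := by
    intro j
    have h1 : √(p j) ^ 2 = p j := Real.sq_sqrt (hp0 j)
    have h2 : √(q j) ^ 2 = q j := Real.sq_sqrt (hq0 j)
    set x := √(p j)
    set y := √(q j)
    rw [← h1, ← h2]
    have h3 : |x ^ 2 - y ^ 2| = |x - y| * |x + y| := by rw [← abs_mul]; congr 1; ring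
    rw [h3]
    have h4 : x ^ 2 + y ^ 2 - 2 * (x * y) = |x - y| ^ 2 := by rw [sq_abs]; ring
    have h5 : |x + y| ^ 2 ≤ 2 * (x ^ 2 + y ^ 2) := by rw [sq_abs]; nlinarith [sq_nonneg (x - y)]
    rw [h4]
    have h6 : |x - y| * |x + y| ≤ δ⁻¹ * |x - y| ^ 2 + δ / 4 * |x + y| ^ 2 := by
      have : 0 ≤ δ⁻¹ * (|x - y| - δ / 2 * |x + y|) ^ 2 := by positivity
      have e : δ⁻¹ * (|x - y| - δ / 2 * |x + y|) ^ 2 =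
          δ⁻¹ * |x - y| ^ 2 - |x - y| * |x + y| + δ / 4 * |x + y| ^ 2 := by
        field_simp; ring
      linarith
    nlinarith
  have hsum := (((hps.add hqs).sub (hpq.mul_left 2)).mul_left δ⁻¹).add
    ((hps.add hqs).mul_left (δ / 2))
  have hs : Summable fun j => |p j - q j| := (hps.summable.sub hqs.summable).abs
  refine (hs.hasSum.tsum_eq.le.trans ?_ : ∑' j, |p j - q j| ≤ _)
  refine (hasSum_le hpt hs.hasSum hsum).trans ?_
  have := Real.add_one_le_exp (-(δ ^ 2 / 2))
  have h7 : δ⁻¹ * (1 + 1 - 2 * Real.exp (-(δ ^ 2 / 2))) ≤ δ⁻¹ * δ ^ 2 :=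
    mul_le_mul_of_nonneg_left (by linarith) (by positivity)
  have h8 : δ⁻¹ * δ ^ 2 = δ := by field_simp
  linarith

/-- The solution of the Stein--Chen equation for a set `A`, shifted by one. -/
theorem exists_steinChen_solution {r : ℝ≥0} (hr : 0 < r) (A : Set ℕ) :
    ∃ g : ℕ → ℝ, (∀ j, |g (j + 1) - g j| ≤ 1 / r) ∧
      ∀ j : ℕ, r * g j - j * g (j - 1) = A.indicator 1 j - (poissonMeasure r).real A := by
  set q : ℕ → ℝ := fun j => (poissonMeasure r).real {j} with hq
  have hr' : (0 : ℝ) < r := hr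
  have hq0 : ∀ j, 0 < q j := fun j => poissonMeasure_real_singleton_pos j hr
  have hqs : HasSum q 1 := hasSum_poissonMeasure_real r
  have hrec : ∀ j : ℕ, ((j : ℝ) + 1) * q (j + 1) = r * q j := poissonMeasure_real_succ r
  set F : ℕ → ℝ := fun j => ∑ i ∈ Finset.range (j + 1), q i with hF
  have hFs : ∀ j, F (j + 1) = F j + q (j + 1) := fun j => Finset.sum_range_succ _ _
  have hF0 : ∀ j, 0 ≤ F j := fun j => Finset.sum_nonneg fun i _ => (hq0 i).le
  have hG : ∀ j, HasSum (fun i => q (i + (j + 1))) (1 - F j) := fun j =>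
    (hasSum_nat_add_iff' (j + 1)).2 hqs
  -- log-concavity of the Poisson weights
  have hlc : ∀ i j : ℕ, j ≤ i → q (i + 1) * q j ≤ q i * q (j + 1) := by
    intro i j hij
    have h1 := hrec i
    have h2 := hrec j
    have hi : (0 : ℝ) < (i : ℝ) + 1 := by positivity
    have hj : (0 : ℝ) < (j : ℝ) + 1 := by positivity
    have hij' : (j : ℝ) ≤ i := by exact_mod_cast hij
    have e1 : q (i + 1) = r * q i / (i + 1) := by field_simp; linarith
    have e2 : q (j + 1) = r * q j / (j + 1) := by field_simp; linarith
    rw [e1, e2, div_mul_eq_mul_div, mul_div_assoc', div_le_div_iff₀ hi hj]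
    have : 0 ≤ r * q i * q j := by have := hq0 i; have := hq0 j; positivity
    nlinarith
  have hGmono : ∀ j, (1 - F (j + 1)) * q j ≤ (1 - F j) * q (j + 1) := fun j =>
    hasSum_le (fun i => by
      have := hlc (i + (j + 1)) j (by omega)
      rwa [show i + (j + 1) + 1 = i + (j + 1 + 1) by ring] at this)
      ((hG (j + 1)).mul_right (q j)) ((hG j).mul_right (q (j + 1)))
  have hFmono : ∀ j, F j * q (j + 1) ≤ F (j + 1) * q j := by
    intro j
    have h1 : F (j + 1) = (∑ i ∈ Finset.range (j + 1), q (i + 1)) + q 0 := by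
      rw [hF]; exact Finset.sum_range_succ' _ _
    have h2 : F j * q (j + 1) ≤ (∑ i ∈ Finset.range (j + 1), q (i + 1)) * q j := by
      rw [hF, Finset.sum_mul, Finset.sum_mul]
      refine Finset.sum_le_sum fun i hi => ?_
      have := hlc j i (by simpa [Nat.lt_succ_iff] using hi)
      linarith
    rw [h1]
    nlinarith [mul_pos (hq0 0) (hq0 j)]
  -- partial sums over a set
  set P : Set ℕ → ℕ → ℝ := fun A j => ∑ i ∈ Finset.range (j + 1), A.indicator q i with hP
  have hPs : ∀ A j, P A (j + 1) = P A j + A.indicator q (j + 1) := fun A j =>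
    Finset.sum_range_succ _ _
  set T : Set ℕ → ℝ := fun A => (poissonMeasure r).real A with hT
  have hTsum : ∀ A, HasSum (A.indicator q) (T A) := fun A => by
    have := (hqs.summable.indicator A).hasSum
    rwa [show ∑' b, A.indicator q b = T A from tsum_indicator_measureReal _ A] at this
  have hind0 : ∀ (A : Set ℕ) j, 0 ≤ A.indicator q j := fun A j =>
    Set.indicator_nonneg (fun i _ => (hq0 i).le) j
  have hindle : ∀ (A : Set ℕ) j, A.indicator q j ≤ q j := fun A j =>
    Set.indicator_le_self' (fun i _ => (hq0 i).le) j
  have hPT : ∀ A j, P A j ≤ T A := fun A j => sum_le_hasSum _ (fun i _ => hind0 A i) (hTsum A)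
  have hP0 : ∀ A j, 0 ≤ P A j := fun A j => Finset.sum_nonneg fun i _ => hind0 A i
  set U : Set ℕ → ℕ → ℝ := fun A j => P A j - T A * F j with hU
  have hup : ∀ A j, U A (j + 1) / (r * q (j + 1)) - U A j / (r * q j) ≤ 1 / r := by
    intro A j
    have hqj := hq0 j
    have hqj1 := hq0 (j + 1)
    have hfr : U A (j + 1) / (r * q (j + 1)) - U A j / (r * q j) =
        (U A (j + 1) * q j - U A j * q (j + 1)) / (r * (q j * q (j + 1))) := by
      field_simp
    rw [hfr, div_le_div_iff₀ (by positivity) hr']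
    have ha := hP0 A j
    have hb : 0 ≤ T A - P A (j + 1) := sub_nonneg.2 (hPT A (j + 1))
    have he0 := hind0 A (j + 1)
    have he1 := hindle A (j + 1)
    have hPe := hPs A j
    set e := A.indicator q (j + 1)
    set b := T A - P A (j + 1) with hbdef
    have hTA : T A = P A j + e + b := by rw [hbdef, hPe]; ring
    have key : U A (j + 1) * q j - U A j * q (j + 1) =
        P A j * ((1 - F (j + 1)) * q j - (1 - F j) * q (j + 1)) +
        e * ((1 - F (j + 1)) * q j + F j * q (j + 1)) +
        b * (F j * q (j + 1) - F (j + 1) * q j) := by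
      simp only [hU]
      rw [hPe, hTA]
      ring
    have k1 := mul_nonneg ha (sub_nonneg.2 (hGmono j))
    have k3 := mul_nonneg hb (sub_nonneg.2 (hFmono j))
    have k2 : e * ((1 - F (j + 1)) * q j + F j * q (j + 1)) ≤ q (j + 1) * q j := by
      have h1 : (1 - F (j + 1)) * q j + F j * q (j + 1) ≤ q j := by linarith [hFmono j]
      exact mul_le_mul he1 h1 (add_nonneg (mul_nonneg ((hG (j + 1)).nonneg
        fun i => (hq0 _).le) hqj.le) (mul_nonneg (hF0 j) hqj1.le)) hqj1.le
    have : U A (j + 1) * q j - U A j * q (j + 1) ≤ q (j + 1) * q j := by rw [key]; linarith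
    nlinarith
  have hcompl : ∀ j, U Aᶜ j = -U A j := by
    intro j
    have h1 : P Aᶜ j = F j - P A j := by
      simp only [hP, hF]
      rw [← Finset.sum_sub_distrib]
      refine Finset.sum_congr rfl fun i _ => ?_
      by_cases hi : i ∈ A <;> simp [hi]
    have h2 : T Aᶜ = 1 - T A := probReal_compl_eq_one_sub A.to_countable.measurableSet
    simp only [hU]
    rw [h1, h2]
    ring
  refine ⟨fun j => U A j / (r * q j), fun j => abs_le.2 ⟨?_, hup A j⟩, fun j => ?_⟩
  · have := hup Aᶜ j
    rw [hcompl, hcompl, neg_div, neg_div] at this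
    linarith
  · have e1 : r * (U A j / (r * q j)) = U A j / q j := by
      have := hq0 j
      field_simp
    rw [e1]
    have hqj := hq0 j
    have eA : A.indicator (1 : ℕ → ℝ) j = A.indicator q j / q j := by
      by_cases hj : j ∈ A <;> simp [hj, hqj.ne']
    rcases j with _ | j
    · rw [eA]
      simp only [hU, hP, hF]
      simp only [zero_add, Finset.sum_range_one, Nat.cast_zero, zero_mul, sub_zero]
      field_simp
      simp only [hT]
      ring
    · have e2 : ((j + 1 : ℕ) : ℝ) * (U A (j + 1 - 1) / (r * q (j + 1 - 1))) =
          U A j / q (j + 1) := by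
        have h := hrec j
        have := hq0 j
        rw [Nat.add_sub_cancel]
        rw [← h]
        push_cast
        field_simp
      rw [e2, eA, ← sub_div]
      have : U A (j + 1) - U A j = A.indicator q (j + 1) - T A * q (j + 1) := by
        simp only [hU]
        rw [hPs, hFs]
        ring
      rw [this]
      field_simp
      simp only [hT]
      ring

end Poisson

section PoissonLimits

/-- The standardised Poisson law. -/
noncomputable def standardizedPoisson (r : ℝ≥0) : ProbabilityMeasure ℝ :=
  ⟨(poissonMeasure r).map fun j : ℕ => ((j : ℝ) - r) / √(r : ℝ),
    Measure.isProbabilityMeasure_map .of_discrete⟩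

theorem charFun_standardizedPoisson (r : ℝ≥0) (t : ℝ) :
    charFun (standardizedPoisson r : Measure ℝ) t =
      Complex.exp (r * (Complex.exp ((t / √(r : ℝ) : ℝ) * Complex.I) - 1 -
        (t / √(r : ℝ) : ℝ) * Complex.I)) := by
  have h := charFun_map_cast_poissonMeasure r (t / √(r : ℝ))
  rw [charFun_apply_real, integral_map .of_discrete (by fun_prop)] at h
  have e : charFun (standardizedPoisson r : Measure ℝ) t = ∫ j : ℕ,
      Complex.exp (((t / √(r : ℝ) : ℝ) : ℂ) * (j : ℝ) * Complex.I) *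
      Complex.exp (-(r * (t / √(r : ℝ) : ℝ) * Complex.I)) ∂poissonMeasure r := by
    rw [standardizedPoisson, ProbabilityMeasure.coe_mk, charFun_apply_real,
      integral_map .of_discrete (by fun_prop)]
    refine integral_congr_ae (ae_of_all _ fun j => ?_)
    simp only
    rw [← Complex.exp_add]
    congr 1
    push_cast
    ring
  rw [e, integral_mul_const, h, ← Complex.exp_add]
  congr 1
  ring

theorem norm_exp_mul_I_taylor_le {y : ℝ} (hy : |y| ≤ 1) :
    ‖Complex.exp (y * Complex.I) - 1 - y * Complex.I + y ^ 2 / 2‖ ≤ |y| ^ 3 := by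
  have hn : ‖(y : ℂ) * Complex.I‖ = |y| := by simp
  have h := Complex.exp_bound (x := y * Complex.I) (by rwa [hn]) (n := 3) (by norm_num)
  rw [hn] at h
  have e : Complex.exp (y * Complex.I) - 1 - y * Complex.I + y ^ 2 / 2 =
      Complex.exp (y * Complex.I) - ∑ m ∈ Finset.range 3, (y * Complex.I) ^ m / m.factorial := by
    simp only [Finset.sum_range_succ, Finset.sum_range_zero, Nat.factorial]
    push_cast
    linear_combination (y : ℂ) ^ 2 / 2 * Complex.I_sq
  rw [e]
  refine h.trans ?_
  norm_num [Nat.factorial]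
  nlinarith [pow_nonneg (abs_nonneg y) 3]

theorem tendsto_charFun_standardizedPoisson {r : ℕ → ℝ≥0} (hr : Tendsto r atTop atTop) (t : ℝ) :
    Tendsto (fun n => charFun (standardizedPoisson (r n) : Measure ℝ) t) atTop
      (𝓝 (charFun (gaussianReal 0 1) t)) := by
  have hr' : Tendsto (fun n => (r n : ℝ)) atTop atTop := NNReal.tendsto_coe_atTop.2 hr
  have hs : Tendsto (fun n => √(r n : ℝ)) atTop atTop := Real.tendsto_sqrt_atTop.comp hr'
  simp only [charFun_standardizedPoisson, charFun_gaussianReal]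
  have hlim : Tendsto (fun n => ((r n : ℝ) : ℂ) * (Complex.exp ((t / √(r n : ℝ) : ℝ) * Complex.I) - 1 -
      (t / √(r n : ℝ) : ℝ) * Complex.I) + t ^ 2 / 2) atTop (𝓝 0) := by
    rw [tendsto_zero_iff_norm_tendsto_zero]
    have hb : Tendsto (fun n => |t| ^ 3 / √(r n : ℝ)) atTop (𝓝 0) := hs.const_div_atTop _
    refine squeeze_zero' (Eventually.of_forall fun _ => norm_nonneg _) ?_ hb
    filter_upwards [hs.eventually_ge_atTop (max |t| 1)] with n hn
    have hn1 : |t| ≤ √(r n : ℝ) := (le_max_left _ _).trans hn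
    have hn0 : 0 < √(r n : ℝ) := lt_of_lt_of_le one_pos ((le_max_right _ _).trans hn)
    have hsq : √(r n : ℝ) ^ 2 = r n := Real.sq_sqrt (r n).2
    have hy : |t / √(r n : ℝ)| ≤ 1 := by
      rw [abs_div, abs_of_pos hn0]
      exact (div_le_one hn0).2 hn1
    have h := norm_exp_mul_I_taylor_le hy
    have hsqc : ((√(r n : ℝ) : ℝ) : ℂ) ^ 2 = ((r n : ℝ) : ℂ) := by exact_mod_cast hsq
    have hn0c : ((√(r n : ℝ) : ℝ) : ℂ) ≠ 0 := by exact_mod_cast hn0.ne'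
    have e : ((r n : ℝ) : ℂ) * (Complex.exp ((t / √(r n : ℝ) : ℝ) * Complex.I) - 1 -
        (t / √(r n : ℝ) : ℝ) * Complex.I) + t ^ 2 / 2 = ((r n : ℝ) : ℂ) *
        (Complex.exp ((t / √(r n : ℝ) : ℝ) * Complex.I) - 1 -
        (t / √(r n : ℝ) : ℝ) * Complex.I + ((t / √(r n : ℝ) : ℝ) : ℂ) ^ 2 / 2) := by
      have : ((r n : ℝ) : ℂ) * (((t / √(r n : ℝ) : ℝ) : ℂ) ^ 2 / 2) = t ^ 2 / 2 := by
        rw [← hsqc]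
        push_cast
        field_simp
      linear_combination -this
    rw [e, norm_mul, Complex.norm_real, Real.norm_of_nonneg (NNReal.coe_nonneg _)]
    refine (mul_le_mul_of_nonneg_left h (NNReal.coe_nonneg _)).trans_eq ?_
    rw [abs_div, abs_of_pos hn0]
    generalize √(r n : ℝ) = S at hsq hn0 ⊢
    rw [← hsq]
    field_simp
  have h2 := (Complex.continuous_exp.tendsto _).comp (hlim.sub_const ((t : ℂ) ^ 2 / 2))
  refine (h2.congr fun n => ?_).trans_eq ?_
  · simp
  · congr 1
    simp

/-- Central limit theorem for the Poisson law with parameter tending to infinity. -/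
theorem tendsto_standardizedPoisson {ι : Type*} {l : Filter ι} [l.IsCountablyGenerated]
    {r : ι → ℝ≥0} (hr : Tendsto r l atTop) :
    Tendsto (fun i => standardizedPoisson (r i)) l (𝓝 ⟨gaussianReal 0 1, inferInstance⟩) := by
  refine tendsto_of_seq_tendsto fun u hu => ?_
  exact ProbabilityMeasure.tendsto_iff_tendsto_charFun.2
    (tendsto_charFun_standardizedPoisson (hr.comp hu))

/-- Weak convergence is stable under perturbations which are small in total variation. -/
theorem FiniteMeasure.tendsto_of_distTV {ι : Type*} {l : Filter ι} {E : Type*}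
    [TopologicalSpace E] [MeasurableSpace E] [OpensMeasurableSpace E] {P Q : ι → Measure ℕ}
    [∀ i, IsFiniteMeasure (P i)] [∀ i, IsFiniteMeasure (Q i)] {φ : ι → ℕ → E}
    {P' Q' : ι → FiniteMeasure E} (hP' : ∀ i, (P' i : Measure E) = (P i).map (φ i))
    (hQ' : ∀ i, (Q' i : Measure E) = (Q i).map (φ i))
    {R : FiniteMeasure E} (hd : Tendsto (fun i => distTV (P i) (Q i)) l (𝓝 0))
    (hQ : Tendsto Q' l (𝓝 R)) :
    Tendsto P' l (𝓝 R) := by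
  rw [FiniteMeasure.tendsto_iff_forall_integral_tendsto] at hQ ⊢
  intro f
  have h1 := hQ f
  have h2 : Tendsto (fun i => ∫ x, f x ∂(P' i : Measure E) -
      ∫ x, f x ∂(Q' i : Measure E)) l (𝓝 0) := by
    have h3 : Tendsto (fun i => 2 * ‖f‖ * distTV (P i) (Q i)) l (𝓝 0) := by
      simpa using hd.const_mul (2 * ‖f‖)
    refine squeeze_zero_norm (fun i => ?_) h3
    rw [hP', hQ', integral_map (Measurable.of_discrete).aemeasurable
      f.continuous.measurable.aestronglyMeasurable,
      integral_map (Measurable.of_discrete).aemeasurable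
      f.continuous.measurable.aestronglyMeasurable]
    exact abs_integral_sub_le_distTV fun j => f.norm_coe_le_norm _
  simpa using h2.add h1

end PoissonLimits

/-! ### Counting windows in cyclic words -/

section Windows

/-- The words of length `k` and sum `k - 1`. -/
def bridges (k : ℕ) : Set (List ℕ) := {u | u.length = k ∧ u.sum + 1 = k}

/-- The indicator that the prefix of length `k` of a word belongs to `D`. -/
noncomputable def pre (D : Set (List ℕ)) (k : ℕ) (w : List ℕ) : ℝ := D.indicator 1 (w.take k)

open Classical in
/-- The number of cyclic windows of length `k` of `w` that belong to `D`. -/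
noncomputable def cyclicCount (D : Set (List ℕ)) (k : ℕ) (w : List ℕ) : ℕ :=
  ((Finset.range w.length).filter fun i => (w.rotate i).take k ∈ D).card

open Classical in
/-- The number of windows of length `k` of `v` that belong to `D`. -/
noncomputable def linearCount (D : Set (List ℕ)) (k : ℕ) (v : List ℕ) : ℕ :=
  ((Finset.range (v.length + 1 - k)).filter fun i => (v.drop i).take k ∈ D).card

variable {D : Set (List ℕ)} {k : ℕ}

theorem pre_nonneg (w : List ℕ) : 0 ≤ pre D k w :=
  Set.indicator_nonneg (fun _ _ => zero_le_one) _

theorem pre_of_mem {w : List ℕ} (h : w.take k ∈ D) : pre D k w = 1 := Set.indicator_of_mem h _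

theorem pre_of_notMem {w : List ℕ} (h : w.take k ∉ D) : pre D k w = 0 :=
  Set.indicator_of_notMem h _

theorem cyclicCount_eq_sum (w : List ℕ) :
    (cyclicCount D k w : ℝ) = ∑ i ∈ Finset.range w.length, pre D k (w.rotate i) := by
  classical
  rw [cyclicCount, Finset.card_filter, Nat.cast_sum]
  refine Finset.sum_congr rfl fun i _ => ?_
  by_cases h : (w.rotate i).take k ∈ D <;> simp [pre, h]

theorem linearCount_eq_sum (v : List ℕ) :
    (linearCount D k v : ℝ) = ∑ i ∈ Finset.range (v.length + 1 - k), pre D k (v.drop i) := by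
  classical
  rw [linearCount, Finset.card_filter, Nat.cast_sum]
  refine Finset.sum_congr rfl fun i _ => ?_
  by_cases h : (v.drop i).take k ∈ D <;> simp [pre, h]

theorem cyclicCount_rotate (w : List ℕ) (i : ℕ) :
    cyclicCount D k (w.rotate i) = cyclicCount D k w := by
  induction i with
  | zero => simp
  | succ i ih =>
    rw [← ih, ← List.rotate_rotate]
    generalize w.rotate i = u
    have h : (cyclicCount D k (u.rotate 1) : ℝ) = cyclicCount D k u := by
      rw [cyclicCount_eq_sum, cyclicCount_eq_sum, List.length_rotate]
      simp only [List.rotate_rotate]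
      rcases hu : u.length with _ | n
      · simp
      · rw [Finset.sum_range_succ, Finset.sum_range_succ']
        congr 1
        · exact Finset.sum_congr rfl fun j _ => by rw [add_comm 1 j]
        · rw [add_comm 1 n, ← hu, List.rotate_length, List.rotate_zero]
    exact_mod_cast h

theorem take_rotate_of_add_le {w : List ℕ} {i : ℕ} (h : i + k ≤ w.length) :
    (w.rotate i).take k = (w.drop i).take k := by
  rw [List.rotate_eq_drop_append_take (by omega), List.take_append_of_le_length (by simp; omega)]

theorem pre_rotate_of_add_le {w : List ℕ} {i : ℕ} (h : i + k ≤ w.length) :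
    pre D k (w.rotate i) = pre D k (w.drop i) := by
  rw [pre, pre, take_rotate_of_add_le h]

/-- Splitting a cyclic sum into the windows overlapping the first one and the others. -/
theorem sum_range_split (f : ℕ → ℝ) {n k : ℕ} (hk : 1 ≤ k) (hn : 2 * k ≤ n) :
    ∑ i ∈ Finset.range n, f i = (f 0 + ∑ j ∈ Finset.Ico 1 k, (f j + f (n - j))) +
      ∑ j ∈ Finset.range (n - 2 * k + 1), f (k + j) := by
  have e1 : ∑ i ∈ Finset.range n, f i = ∑ i ∈ Finset.Ico 0 1, f i + ∑ i ∈ Finset.Ico 1 k, f i +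
      ∑ i ∈ Finset.Ico k (n - k + 1), f i + ∑ i ∈ Finset.Ico (n - k + 1) n, f i := by
    rw [Finset.sum_Ico_consecutive _ (by omega) hk, Finset.sum_Ico_consecutive _ (by omega)
      (by omega), Finset.sum_Ico_consecutive _ (by omega) (by omega), Finset.range_eq_Ico]
  have e2 : ∑ i ∈ Finset.Ico (n - k + 1) n, f i = ∑ j ∈ Finset.Ico 1 k, f (n - j) := by
    rw [Finset.sum_Ico_reflect f 1 (by omega)]
    congr 2
    omega
  have e3 : ∑ i ∈ Finset.Ico k (n - k + 1), f i =
      ∑ j ∈ Finset.range (n - 2 * k + 1), f (k + j) := by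
    rw [Finset.sum_Ico_eq_sum_range]
    congr 2
    omega
  rw [e1, e2, e3, Finset.sum_add_distrib]
  simp
  ring

variable (p : ℕ → ℝ)

theorem wsum_cyclicCount_mul {n s : ℕ} (φ : List ℕ → ℝ) (hφ : ∀ w i, φ (w.rotate i) = φ w) :
    wsum p n s (fun w => cyclicCount D k w * φ w) = n * wsum p n s (fun w => pre D k w * φ w) := by
  have h1 : wsum p n s (fun w => cyclicCount D k w * φ w) =
      wsum p n s (fun w => ∑ i ∈ Finset.range n, pre D k (w.rotate i) * φ (w.rotate i)) := by
    refine wsum_congr fun w hw _ => ?_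
    rw [cyclicCount_eq_sum, hw, Finset.sum_mul]
    simp only [hφ]
  rw [h1, wsum_sum]
  simp only [wsum_rotate p n s _ fun w => pre D k w * φ w]
  simp

theorem wsum_pre_mul (hD : D ⊆ bridges k) {n s : ℕ} (hk : 1 ≤ k) (hkn : k ≤ n) (hs : k ≤ s + 1) (F : List ℕ → ℝ) :
    wsum p n s (fun w => pre D k w * F w) = wsum p k (k - 1) (fun u => D.indicator 1 u *
      wsum p (n - k) (s + 1 - k) (fun v => F (u ++ v))) := by
  have := wsum_prefix p (m := k) (n := n - k) (s := s + 1 - k) (t := k - 1) D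
    (fun u hu => by have := (hD hu).2; omega) F
  rwa [Nat.add_sub_cancel' hkn, show k - 1 + (s + 1 - k) = s by omega] at this

theorem wsum_pre_mul_drop (hD : D ⊆ bridges k) {n s : ℕ} (hk : 1 ≤ k) (hkn : k ≤ n) (hs : k ≤ s + 1)
    (F : List ℕ → ℝ) :
    wsum p n s (fun w => pre D k w * F (w.drop k)) =
      wset p k (k - 1) D * wsum p (n - k) (s + 1 - k) F := by
  rw [wsum_pre_mul p hD hk hkn hs, wset, mul_comm, ← wsum_const_mul]
  refine wsum_congr fun u hu _ => ?_
  rw [mul_comm]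
  congr 1
  refine wsum_congr fun v _ _ => ?_
  rw [← hu, List.drop_left]

theorem wsum_pre (hD : D ⊆ bridges k) {n s : ℕ} (hk : 1 ≤ k) (hkn : k ≤ n) (hs : k ≤ s + 1) :
    wsum p n s (pre D k) = wset p k (k - 1) D * wtot p (n - k) (s + 1 - k) := by
  rw [← wsum_one, ← wsum_pre_mul_drop p hD hk hkn hs]
  simp

theorem wsum_cyclicCount (hD : D ⊆ bridges k) {n : ℕ} (hk : 1 ≤ k) (hkn : k ≤ n) :
    wsum p n (n - 1) (fun w => (cyclicCount D k w : ℝ)) =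
      n * (wset p k (k - 1) D * wtot p (n - k) (n - k)) := by
  have h := wsum_cyclicCount_mul p (D := D) (k := k) (n := n) (s := n - 1) (fun _ => 1)
    (fun _ _ => rfl)
  simp only [mul_one] at h
  rw [h, wsum_pre p hD hk hkn (by omega), Nat.sub_add_cancel (by omega)]

/-- Joint weight of two disjoint windows. -/
theorem wsum_pre_mul_pre_rotate_far {n j : ℕ} {D' : Set (List ℕ)} (hD : D ⊆ bridges k)
    (hD' : D' ⊆ bridges k)
    (hk : 1 ≤ k) (h2 : j + 2 * k ≤ n) :
    wsum p n (n - 1) (fun w => pre D k w * pre D' k (w.rotate (k + j))) =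
      wset p k (k - 1) D * (wset p k (k - 1) D' * wtot p (n - 2 * k) (n - 2 * k + 1)) := by
  have h1 : wsum p n (n - 1) (fun w => pre D k w * pre D' k (w.rotate (k + j))) =
      wsum p n (n - 1) (fun w => pre D k w * (fun v => pre D' k (v.rotate j)) (w.drop k)) := by
    refine wsum_congr fun w hw _ => ?_
    simp only
    rw [pre_rotate_of_add_le (by omega), pre_rotate_of_add_le (by simp; omega), List.drop_drop]
  rw [h1, wsum_pre_mul_drop p hD hk (by omega) (by omega) (fun v => pre D' k (v.rotate j)),
    wsum_rotate,
    wsum_pre p hD' hk (by omega) (by omega), show n - k - k = n - 2 * k by omega,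
    show n - 1 + 1 - k + 1 - k = n - 2 * k + 1 by omega]

variable {p} in
theorem wsum_take_sum_le (hp : ∀ j, 0 ≤ p j) {C : ℝ} (hC : 0 ≤ C)
    (hM : ∀ m s : ℕ, 1 ≤ m → wtot p m s ≤ C / √m) {m j : ℕ} (hj : 1 ≤ j) (hjm : j < m)
    (s y : ℕ) :
    wsum p m s (fun v => Set.indicator {u : List ℕ | u.sum = y} 1 (v.take j)) ≤
      C / √j * (C / √(m - j : ℕ)) := by
  rcases le_or_gt y s with h | h
  · have := wsum_prefix p (m := j) (n := m - j) (s := s - y) (t := y) {u : List ℕ | u.sum = y}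
      (fun u hu => hu) (fun _ => 1)
    rw [Nat.add_sub_cancel' hjm.le, Nat.add_sub_cancel' h] at this
    simp only [mul_one, wsum_one] at this
    rw [this]
    have h2 : wsum p j y (fun u => Set.indicator {u : List ℕ | u.sum = y} 1 u *
        wtot p (m - j) (s - y)) = wtot p j y * wtot p (m - j) (s - y) := by
      rw [← wsum_const]
      exact wsum_congr fun u _ hu => by simp [hu]
    rw [h2]
    exact mul_le_mul (hM j y hj) (hM _ _ (by omega)) (wtot_nonneg hp _ _) (by positivity)
  · have : wsum p m s (fun v => Set.indicator {u : List ℕ | u.sum = y} 1 (v.take j)) =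
        wsum p m s (fun _ => 0) := by
      refine wsum_congr fun v _ hv => Set.indicator_of_notMem (fun hy => ?_) _
      have := v.sum_take_add_sum_drop j
      rw [Set.mem_ofPred_eq] at hy
      omega
    rw [this, wsum_const, mul_zero]
    positivity

variable {p} in
theorem wsum_pre_mul_le (hp : ∀ j, 0 ≤ p j) (hD : D ⊆ bridges k) {n s : ℕ} (hk : 1 ≤ k)
    (hkn : k ≤ n) (hs : k ≤ s + 1) {F : List ℕ → ℝ} {B : ℝ}
    (hB : ∀ u : List ℕ, u.length = k → wsum p (n - k) (s + 1 - k) (fun v => F (u ++ v)) ≤ B) :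
    wsum p n s (fun w => pre D k w * F w) ≤ wset p k (k - 1) D * B := by
  rw [wsum_pre_mul p hD hk hkn hs, wset, mul_comm, ← wsum_const_mul]
  refine wsum_mono hp fun u hu _ => ?_
  rw [mul_comm]
  exact mul_le_mul_of_nonneg_right (hB u hu) (Set.indicator_nonneg (fun _ _ => zero_le_one) _)

variable {p} in
theorem wsum_pre_mul_pre_rotate_near (hp : ∀ j, 0 ≤ p j) {C : ℝ} (hC : 0 ≤ C)
    (hM : ∀ m s : ℕ, 1 ≤ m → wtot p m s ≤ C / √m) {D' : Set (List ℕ)}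
    (hD : D ⊆ bridges k) (hD' : D' ⊆ bridges k) {n j : ℕ} (hj : 1 ≤ j) (hjk : j < k)
    (hkn : 2 * k ≤ n) :
    wsum p n (n - 1) (fun w => pre D k w * pre D' k (w.rotate j)) ≤
      wset p k (k - 1) D * (C / √j * (C / √(n - k - j : ℕ))) ∧
    wsum p n (n - 1) (fun w => pre D k w * pre D' k (w.rotate (n - j))) ≤
      wset p k (k - 1) D * (C / √j * (C / √(n - k - j : ℕ))) := by
  have hle : ∀ (x : List ℕ) (y : ℕ) (z : List ℕ), x.sum = y + z.sum →
      D'.indicator 1 x ≤ Set.indicator {u : List ℕ | u.sum = k - 1 - y} (1 : List ℕ → ℝ) z := by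
    intro x y z h
    by_cases hx : x ∈ D'
    · have := (hD' hx).2
      rw [Set.indicator_of_mem hx, Set.indicator_of_mem]
      · rfl
      · rw [Set.mem_ofPred_eq]
        omega
    · rw [Set.indicator_of_notMem hx]
      exact Set.indicator_nonneg (fun _ _ => zero_le_one) _
  constructor
  · refine wsum_pre_mul_le hp hD (by omega) (by omega) (by omega) fun u hu => ?_
    refine le_trans (wsum_mono hp (G := fun v => Set.indicator
      {z : List ℕ | z.sum = k - 1 - (u.drop j).sum} 1 (v.take j)) fun v hv _ => ?_)
      (wsum_take_sum_le hp hC hM hj (by omega) _ _)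
    refine hle _ _ _ ?_
    rw [List.rotate_eq_drop_append_take (by simp; omega),
      List.take_append_of_le_length (by simp; omega), List.drop_append_of_le_length (by omega),
      List.take_append, List.take_of_length_le (by simp; omega), List.sum_append]
    congr 3
    simp
    omega
  · refine wsum_pre_mul_le hp hD (by omega) (by omega) (by omega) fun u hu => ?_
    have h1 := wsum_take_sum_le hp hC hM hj (by omega : j < n - k) (n - 1 + 1 - k)
      (k - 1 - (u.take (k - j)).sum)
    rw [← wsum_rotate p _ _ (n - k - j)] at h1
    refine le_trans (wsum_mono hp fun v hv _ => ?_) h1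
    refine hle _ _ _ ?_
    have e1 : (v.rotate (n - k - j)).take j = v.drop (n - k - j) := by
      rw [List.rotate_eq_drop_append_take (by omega), List.take_append_of_le_length (by simp; omega),
        List.take_of_length_le (by simp; omega)]
    have e2 : (u ++ v).drop (n - j) = v.drop (n - k - j) := by
      rw [List.drop_append, List.drop_of_length_le (by omega), List.nil_append]
      congr 1
      omega
    rw [e1, List.rotate_eq_drop_append_take (by simp; omega), e2, List.take_append,
      List.take_of_length_le (by simp; omega), List.take_take, List.sum_append, add_comm]
    congr 2
    rw [List.take_append_of_le_length (by simp; omega)]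
    congr 1
    simp
    omega

variable {p} in
/-- Total joint weight of all pairs of overlapping windows. -/
theorem sum_overlap_le (hp : ∀ j, 0 ≤ p j) {C : ℝ} (hC : 0 ≤ C)
    (hM : ∀ m s : ℕ, 1 ≤ m → wtot p m s ≤ C / √m) {D' : Set (List ℕ)}
    (hD : D ⊆ bridges k) (hD' : D' ⊆ bridges k) {n : ℕ} (hk : 1 ≤ k) (hkn : 4 * k ≤ n) :
    wsum p n (n - 1) (fun w => pre D k w * pre D' k (w.rotate 0)) +
      ∑ j ∈ Finset.Ico 1 k, (wsum p n (n - 1) (fun w => pre D k w * pre D' k (w.rotate j)) +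
        wsum p n (n - 1) (fun w => pre D k w * pre D' k (w.rotate (n - j)))) ≤
      wset p k (k - 1) D * ((8 * C ^ 2 + 2 * C) * (√k / √n)) := by
  have hn0 : (0 : ℝ) < n := by exact_mod_cast (by omega : 0 < n)
  have hk1 : (1 : ℝ) ≤ √(k : ℝ) := Real.one_le_sqrt.2 (by exact_mod_cast hk)
  have hsn : 0 < √(n : ℝ) := Real.sqrt_pos.2 hn0
  have hPD : 0 ≤ wset p k (k - 1) D := wset_nonneg hp _ _ _
  have hhalf : ∀ m : ℕ, n ≤ 4 * m → C / √(m : ℝ) ≤ 2 * C / √n := by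
    intro m hm
    have : √(n : ℝ) / 2 ≤ √(m : ℝ) := by
      refine Real.le_sqrt_of_sq_le ?_
      rw [div_pow, Real.sq_sqrt hn0.le, div_le_iff₀ (by norm_num)]
      exact_mod_cast (by omega : n ≤ m * 2 ^ 2)
    calc C / √(m : ℝ) ≤ C / (√n / 2) := by gcongr
      _ = 2 * C / √n := by field_simp
  have h0 : wsum p n (n - 1) (fun w => pre D k w * pre D' k (w.rotate 0)) ≤
      wset p k (k - 1) D * (2 * C * (√k / √n)) := by
    have : wsum p n (n - 1) (fun w => pre D k w * pre D' k (w.rotate 0)) ≤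
        wsum p n (n - 1) (pre D k) := wsum_mono hp fun w _ _ =>
      mul_le_of_le_one_right (pre_nonneg w) (Set.indicator_le_self' (fun _ _ => zero_le_one) _)
    refine this.trans ?_
    rw [wsum_pre p hD hk (by omega) (by omega)]
    refine mul_le_mul_of_nonneg_left ((hM _ _ (by omega)).trans ((hhalf _ (by omega)).trans ?_)) hPD
    rw [mul_div_assoc']
    exact div_le_div_of_nonneg_right (le_mul_of_one_le_right (by positivity) hk1) hsn.le
  have hj : ∀ j ∈ Finset.Ico 1 k,
      wsum p n (n - 1) (fun w => pre D k w * pre D' k (w.rotate j)) +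
        wsum p n (n - 1) (fun w => pre D k w * pre D' k (w.rotate (n - j))) ≤
      wset p k (k - 1) D * (4 * C ^ 2 / √n) * (1 / √j) := by
    intro j hj
    obtain ⟨hj1, hj2⟩ := Finset.mem_Ico.1 hj
    obtain ⟨a1, a2⟩ := wsum_pre_mul_pre_rotate_near hp hC hM hD hD' hj1 hj2 (n := n) (by omega)
    have h3 : C / √(j : ℝ) * (C / √(n - k - j : ℕ)) ≤ C / √j * (2 * C / √n) :=
      mul_le_mul_of_nonneg_left (hhalf _ (by omega)) (by positivity)
    have h4 := mul_le_mul_of_nonneg_left h3 hPD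
    have e : wset p k (k - 1) D * (4 * C ^ 2 / √n) * (1 / √j) =
      2 * (wset p k (k - 1) D * (C / √j * (2 * C / √n))) := by ring
    rw [e]
    linarith
  have hsum : ∑ j ∈ Finset.Ico 1 k, 1 / √(j : ℝ) ≤ 2 * √k := by
    have : ∀ m : ℕ, ∑ j ∈ Finset.Ico 1 (m + 1), 1 / √(j : ℝ) ≤ 2 * √m := by
      intro m
      induction m with
      | zero => simp
      | succ m ih =>
        rw [Finset.sum_Ico_succ_top (by omega)]
        have hm1 : (0 : ℝ) < √((m + 1 : ℕ) : ℝ) := Real.sqrt_pos.2 (by positivity)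
        have h1 : √(m : ℝ) ^ 2 = m := Real.sq_sqrt (Nat.cast_nonneg _)
        have h2 : √((m + 1 : ℕ) : ℝ) ^ 2 = m + 1 := by
          rw [Real.sq_sqrt (by positivity)]; push_cast; ring
        have : 1 / √((m + 1 : ℕ) : ℝ) ≤ 2 * √((m + 1 : ℕ) : ℝ) - 2 * √m := by
          rw [div_le_iff₀ hm1]
          nlinarith [sq_nonneg (√((m + 1 : ℕ) : ℝ) - √m)]
        linarith
    obtain ⟨m, rfl⟩ : ∃ m, k = m + 1 := ⟨k - 1, by omega⟩
    refine (this m).trans ?_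
    gcongr
    simp
  have := Finset.sum_le_sum hj
  rw [← Finset.mul_sum] at this
  have h5 : wset p k (k - 1) D * (4 * C ^ 2 / √n) * ∑ j ∈ Finset.Ico 1 k, 1 / √(j : ℝ) ≤
      wset p k (k - 1) D * (4 * C ^ 2 / √n) * (2 * √k) :=
    mul_le_mul_of_nonneg_left hsum (by positivity)
  calc _ ≤ wset p k (k - 1) D * (2 * C * (√k / √n)) +
      wset p k (k - 1) D * (4 * C ^ 2 / √n) * (2 * √k) := add_le_add h0 (this.trans h5)
    _ = _ := by ring

/-- Second moment of the cyclic count. -/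
theorem wsum_cyclicCount_sq (hD : D ⊆ bridges k) {n : ℕ} (hk : 1 ≤ k) (hkn : 2 * k ≤ n) :
    wsum p n (n - 1) (fun w => (cyclicCount D k w : ℝ) * cyclicCount D k w) =
      n * ((wsum p n (n - 1) (fun w => pre D k w * pre D k (w.rotate 0)) +
      ∑ j ∈ Finset.Ico 1 k, (wsum p n (n - 1) (fun w => pre D k w * pre D k (w.rotate j)) +
        wsum p n (n - 1) (fun w => pre D k w * pre D k (w.rotate (n - j))))) +
      ((n - 2 * k + 1 : ℕ) : ℝ) * (wset p k (k - 1) D * (wset p k (k - 1) D *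
        wtot p (n - 2 * k) (n - 2 * k + 1)))) := by
  rw [wsum_cyclicCount_mul p (fun w => (cyclicCount D k w : ℝ))
    (fun w i => by rw [cyclicCount_rotate])]
  congr 1
  have h1 : wsum p n (n - 1) (fun w => pre D k w * (cyclicCount D k w : ℝ)) =
      ∑ i ∈ Finset.range n, wsum p n (n - 1) (fun w => pre D k w * pre D k (w.rotate i)) := by
    rw [← wsum_sum]
    refine wsum_congr fun w hw _ => ?_
    rw [cyclicCount_eq_sum, hw, Finset.mul_sum]
  rw [h1, sum_range_split _ hk hkn]
  congr 1
  rw [Finset.sum_congr rfl fun j hj => wsum_pre_mul_pre_rotate_far p hD hD hk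
    (by have := Finset.mem_range.1 hj; omega)]
  simp

/-- The cyclic count as the linear count of the remaining windows plus the overlapping ones. -/
theorem cyclicCount_eq_linearCount_add {w : List ℕ} (hk : 1 ≤ k) (hkn : 2 * k ≤ w.length) :
    (cyclicCount D k w : ℝ) = linearCount D k (w.drop k) + (pre D k (w.rotate 0) +
      ∑ j ∈ Finset.Ico 1 k, (pre D k (w.rotate j) + pre D k (w.rotate (w.length - j)))) := by
  rw [cyclicCount_eq_sum, sum_range_split _ hk hkn, add_comm, linearCount_eq_sum]
  congr 1
  rw [List.length_drop, show w.length - k + 1 - k = w.length - 2 * k + 1 by omega]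
  refine Finset.sum_congr rfl fun j hj => ?_
  rw [pre_rotate_of_add_le (by have := Finset.mem_range.1 hj; omega), List.drop_drop]

end Windows

/-! ### Poisson approximation for the cyclic count -/

section Comparison

variable {D : Set (List ℕ)} {k : ℕ}

/-- Windows in `D` never overlap. -/
def NonOverlapping (D : Set (List ℕ)) (k : ℕ) : Prop :=
  ∀ w : List ℕ, 2 * k ≤ w.length → w.take k ∈ D → ∀ j, 1 ≤ j → j < k → (w.rotate j).take k ∉ D

theorem NonOverlapping.pre_rotate (hD : NonOverlapping D k) {w : List ℕ} (hw : 2 * k ≤ w.length)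
    (h : w.take k ∈ D) {j : ℕ} (hj : 1 ≤ j) (hjk : j < k) :
    pre D k (w.rotate j) = 0 ∧ pre D k (w.rotate (w.length - j)) = 0 := by
  refine ⟨pre_of_notMem (hD w hw h j hj hjk), pre_of_notMem fun h' => ?_⟩
  refine hD (w.rotate (w.length - j)) (by simpa using hw) h' j hj hjk ?_
  rwa [List.rotate_rotate, Nat.sub_add_cancel (by omega), List.rotate_length]

theorem abs_sub_le_of_abs_succ_sub_le {γ : ℕ → ℝ} {L : ℝ} (hγ : ∀ j, |γ (j + 1) - γ j| ≤ L)
    (i j : ℕ) : |γ i - γ j| ≤ L * |(i : ℝ) - j| := by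
  have h : ∀ i m : ℕ, |γ (i + m) - γ i| ≤ L * m := by
    intro i m
    induction m with
    | zero => simp
    | succ m ih =>
      have := (abs_sub_le (γ (i + (m + 1))) (γ (i + m)) (γ i)).trans (add_le_add (hγ (i + m)) ih)
      push_cast
      linarith
  rcases le_total i j with hij | hij
  · obtain ⟨m, rfl⟩ := Nat.exists_eq_add_of_le hij
    rw [abs_sub_comm, abs_sub_comm (i : ℝ)]
    simpa using h i m
  · obtain ⟨m, rfl⟩ := Nat.exists_eq_add_of_le hij
    simpa using h j m

variable {p : ℕ → ℝ}

/-- Size biasing of the count of non-overlapping windows. -/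
theorem wsum_cyclicCount_mul_pred (hD : D ⊆ bridges k) (hno : NonOverlapping D k) {n : ℕ}
    (hk : 1 ≤ k) (hkn : 2 * k ≤ n) (γ : ℕ → ℝ) :
    wsum p n (n - 1) (fun w => cyclicCount D k w * γ (cyclicCount D k w - 1)) =
      n * (wset p k (k - 1) D * wsum p (n - k) (n - k) (fun v => γ (linearCount D k v))) := by
  rw [wsum_cyclicCount_mul p (fun w => γ (cyclicCount D k w - 1))
    (fun w i => by rw [cyclicCount_rotate])]
  congr 1
  have := wsum_pre_mul_drop p hD hk (by omega : k ≤ n) (by omega : k ≤ n - 1 + 1)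
    (fun v => γ (linearCount D k v))
  rw [show n - 1 + 1 - k = n - k by omega] at this
  rw [← this]
  refine wsum_congr fun w hw _ => ?_
  by_cases h : w.take k ∈ D
  · congr 2
    have h1 := cyclicCount_eq_linearCount_add (D := D) (w := w) hk (by omega)
    rw [Finset.sum_eq_zero fun j hj => by
      obtain ⟨h1, h2⟩ := Finset.mem_Ico.1 hj
      obtain ⟨a, b⟩ := hno.pre_rotate (by omega) h h1 h2
      rw [a, b, add_zero], List.rotate_zero, pre_of_mem h, add_zero] at h1
    have h2 : cyclicCount D k w = linearCount D k (w.drop k) + 1 := by exact_mod_cast h1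
    omega
  · rw [pre_of_notMem h, zero_mul, zero_mul]

/-- Approximate size biasing of the count by another family of windows. -/
theorem abs_wsum_cyclicCount_mul_sub_le (hp : ∀ j, 0 ≤ p j) {C : ℝ} (hC : 0 ≤ C)
    (hM : ∀ m s : ℕ, 1 ≤ m → wtot p m s ≤ C / √m) {B : Set (List ℕ)} (hB : B ⊆ bridges k)
    (hD : D ⊆ bridges k) {n : ℕ}
    (hk : 1 ≤ k) (hkn : 4 * k ≤ n) {γ : ℕ → ℝ} {L : ℝ} (hγ : ∀ j, |γ (j + 1) - γ j| ≤ L) :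
    |wsum p n (n - 1) (fun w => cyclicCount B k w * γ (cyclicCount D k w)) -
      n * (wset p k (k - 1) B * wsum p (n - k) (n - k) (fun v => γ (linearCount D k v)))| ≤
      n * (L * (wset p k (k - 1) D * ((8 * C ^ 2 + 2 * C) * (√k / √n)))) := by
  have hL : 0 ≤ L := (abs_nonneg _).trans (hγ 0)
  rw [wsum_cyclicCount_mul p (fun w => γ (cyclicCount D k w))
    (fun w i => by rw [cyclicCount_rotate])]
  have h1 := wsum_pre_mul_drop p hB hk (by omega : k ≤ n) (by omega : k ≤ n - 1 + 1)
    (fun v => γ (linearCount D k v))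
  rw [show n - 1 + 1 - k = n - k by omega] at h1
  rw [← h1, ← mul_sub, ← wsum_sub, abs_mul, Nat.abs_cast]
  refine mul_le_mul_of_nonneg_left ?_ (Nat.cast_nonneg _)
  refine (abs_wsum_le hp _ _ _).trans ?_
  set R : List ℕ → ℝ := fun w => pre D k (w.rotate 0) +
      ∑ j ∈ Finset.Ico 1 k, (pre D k (w.rotate j) + pre D k (w.rotate (n - j))) with hR
  have h2 : wsum p n (n - 1) (fun w => |pre B k w * γ (cyclicCount D k w) -
      pre B k w * γ (linearCount D k (w.drop k))|) ≤
      wsum p n (n - 1) (fun w => L * (pre B k w * R w)) := by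
    refine wsum_mono hp fun w hw _ => ?_
    rw [← mul_sub, abs_mul, abs_of_nonneg (pre_nonneg w)]
    have h3 := abs_sub_le_of_abs_succ_sub_le hγ (cyclicCount D k w) (linearCount D k (w.drop k))
    have h4 := cyclicCount_eq_linearCount_add (D := D) (w := w) hk (by omega)
    rw [hw] at h4
    have h5 : (cyclicCount D k w : ℝ) - linearCount D k (w.drop k) = R w := by rw [h4]; ring
    have h6 : 0 ≤ R w := add_nonneg (pre_nonneg _)
      (Finset.sum_nonneg fun j _ => add_nonneg (pre_nonneg _) (pre_nonneg _))
    rw [h5, abs_of_nonneg h6] at h3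
    calc pre B k w * _ ≤ pre B k w * (L * R w) := mul_le_mul_of_nonneg_left h3 (pre_nonneg w)
      _ = _ := by ring
  refine h2.trans ?_
  rw [wsum_const_mul]
  refine mul_le_mul_of_nonneg_left ?_ hL
  refine le_trans (le_of_eq ?_) (sum_overlap_le hp hC hM hD hB hk hkn)
  have hflip : ∀ i j, i + j = n → wsum p n (n - 1) (fun w => pre B k w * pre D k (w.rotate i)) =
      wsum p n (n - 1) (fun w => pre D k w * pre B k (w.rotate j)) := by
    intro i j hij
    rw [← wsum_rotate p n (n - 1) j (fun w => pre B k w * pre D k (w.rotate i))]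
    refine wsum_congr fun w hw _ => ?_
    rw [List.rotate_rotate, add_comm j i, hij, ← hw, List.rotate_length, mul_comm]
  simp only [hR, mul_add, Finset.mul_sum]
  rw [wsum_add, wsum_sum]
  congr 1
  · exact wsum_congr fun w _ _ => by rw [List.rotate_zero, mul_comm]
  · refine Finset.sum_congr rfl fun j hj => ?_
    have := (Finset.mem_Ico.1 hj).2
    rw [wsum_add, hflip j (n - j) (by omega), hflip (n - j) j (by omega), add_comm]

/-- Variance bound for cyclic counts. -/
theorem wsum_sub_cyclicCount_sq_le (hp : ∀ j, 0 ≤ p j) (hD : D ⊆ bridges k) {n : ℕ} (hk : 1 ≤ k)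
    (hkn : 2 * k ≤ n) {a b c ε S : ℝ} (ha0 : 0 < a) (ha : a = wtot p n (n - 1))
    (hb : b = wtot p (n - k) (n - k)) (hc : c = wtot p (n - 2 * k) (n - 2 * k + 1))
    (hε : c * a - b ^ 2 ≤ ε)
    (hS : (wsum p n (n - 1) (fun w => pre D k w * pre D k (w.rotate 0)) +
      ∑ j ∈ Finset.Ico 1 k, (wsum p n (n - 1) (fun w => pre D k w * pre D k (w.rotate j)) +
        wsum p n (n - 1) (fun w => pre D k w * pre D k (w.rotate (n - j))))) ≤ S) :
    wsum p n (n - 1) (fun w => (n * (wset p k (k - 1) D * b) / a - cyclicCount D k w) ^ 2) ≤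
      n * S + n ^ 2 * wset p k (k - 1) D ^ 2 * ε / a := by
  set P := wset p k (k - 1) D
  set m := n * (P * b) / a with hm
  have h1 : wsum p n (n - 1) (fun w => (m - cyclicCount D k w) ^ 2) =
      a * m ^ 2 - 2 * m * wsum p n (n - 1) (fun w => (cyclicCount D k w : ℝ)) +
      wsum p n (n - 1) (fun w => (cyclicCount D k w : ℝ) * cyclicCount D k w) := by
    rw [← wsum_const_mul, ha, ← wsum_const, ← wsum_sub, ← wsum_add]
    exact wsum_congr fun w _ _ => by ring
  rw [h1, wsum_cyclicCount_sq p hD hk hkn, wsum_cyclicCount p hD hk (by omega), ← hb, ← hc]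
  have hc0 : 0 ≤ c := hc ▸ wtot_nonneg hp _ _
  have h2 : ((n - 2 * k + 1 : ℕ) : ℝ) * (P * (P * c)) ≤ n * (P * (P * c)) := by
    refine mul_le_mul_of_nonneg_right (by exact_mod_cast (by omega)) ?_
    have : 0 ≤ P * P := mul_self_nonneg P
    nlinarith
  have h3 : (n : ℝ) * (P * b) = a * m := by rw [hm]; field_simp
  have h4 : n * (n * (P * (P * c))) - a * m ^ 2 ≤ n ^ 2 * P ^ 2 * ε / a := by
    have e : n * (n * (P * (P * c))) - a * m ^ 2 = n ^ 2 * P ^ 2 * (c * a - b ^ 2) / a := by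
      rw [hm]; field_simp
    rw [e]
    gcongr
  have hn : (0 : ℝ) ≤ n := Nat.cast_nonneg _
  have h5 := mul_le_mul_of_nonneg_left (add_le_add hS h2) hn
  rw [h3]
  nlinarith

/-- The Stein--Chen estimate in terms of second moments. -/
theorem wset_mul_abs_wsum_indicator_sub_le (hp : ∀ j, 0 ≤ p j) {C : ℝ} (hC : 0 ≤ C)
    (hM : ∀ m s : ℕ, 1 ≤ m → wtot p m s ≤ C / √m)
    (hD : D ⊆ bridges k) (hno : NonOverlapping D k) {n : ℕ} (hk : 1 ≤ k) (hkn : 4 * k ≤ n)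
    {a b VK VN : ℝ} (ha0 : 0 < a) (ha : a = wtot p n (n - 1)) (hb : b = wtot p (n - k) (n - k))
    {r : ℝ≥0} (hr0 : 0 < r) (hr : (r : ℝ) = n * (wset p k (k - 1) D * b) / a)
    (hVK : wsum p n (n - 1) (fun w => (n * (wset p k (k - 1) (bridges k) * b) / a -
      cyclicCount (bridges k) k w) ^ 2) ≤ VK)
    (hVN : wsum p n (n - 1) (fun w => (r - cyclicCount D k w) ^ 2) ≤ VN) (A : Set ℕ) :
    wset p k (k - 1) (bridges k) *
      |wsum p n (n - 1) (fun w => A.indicator 1 (cyclicCount D k w)) -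
        a * (poissonMeasure r).real A| ≤
      wset p k (k - 1) D * ((√(VK * (2 * VN + 2 * a)) +
        n * (wset p k (k - 1) D * ((8 * C ^ 2 + 2 * C) * (√k / √n)))) / r) := by
  obtain ⟨γ, hγ, hst⟩ := exists_steinChen_solution hr0 A
  have hr' : (0 : ℝ) < r := hr0
  set P := wset p k (k - 1) D with hP
  set PB := wset p k (k - 1) (bridges k) with hPB
  have hPB0 : 0 ≤ PB := wset_nonneg hp _ _ _
  have hP0 : 0 ≤ P := wset_nonneg hp _ _ _
  set m := n * (PB * b) / a with hm
  set Y := wsum p (n - k) (n - k) (fun v => γ (linearCount D k v))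
  have e1 : wsum p n (n - 1) (fun w => A.indicator 1 (cyclicCount D k w)) -
      a * (poissonMeasure r).real A =
      r * wsum p n (n - 1) (fun w => γ (cyclicCount D k w)) - n * (P * Y) := by
    rw [← wsum_cyclicCount_mul_pred hD hno hk (by omega), ← wsum_const_mul, ← wsum_sub, ha,
      ← wsum_const, ← wsum_sub]
    exact wsum_congr fun w _ _ => (hst _).symm
  have e2 : PB * (wsum p n (n - 1) (fun w => A.indicator 1 (cyclicCount D k w)) -
      a * (poissonMeasure r).real A) =
      P * (wsum p n (n - 1) (fun w => (m - cyclicCount (bridges k) k w) *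
        (γ (cyclicCount D k w) - γ ⌊(r : ℝ)⌋₊)) +
      (wsum p n (n - 1) (fun w => cyclicCount (bridges k) k w * γ (cyclicCount D k w)) -
        n * (PB * Y))) := by
    have h1 : wsum p n (n - 1) (fun w => (m - cyclicCount (bridges k) k w) *
        (γ (cyclicCount D k w) - γ ⌊(r : ℝ)⌋₊)) =
        m * wsum p n (n - 1) (fun w => γ (cyclicCount D k w)) -
        wsum p n (n - 1) (fun w => cyclicCount (bridges k) k w * γ (cyclicCount D k w)) -
        γ ⌊(r : ℝ)⌋₊ * (a * m - wsum p n (n - 1) (fun w => (cyclicCount (bridges k) k w : ℝ))) := by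
      rw [ha, ← wsum_const, ← wsum_const_mul, ← wsum_sub, ← wsum_sub, ← wsum_const_mul, ← wsum_sub]
      exact wsum_congr fun w _ _ => by ring
    have h2 : a * m - wsum p n (n - 1) (fun w => (cyclicCount (bridges k) k w : ℝ)) = 0 := by
      rw [wsum_cyclicCount p le_rfl hk (by omega), ← hb, ← hPB, hm]
      field_simp
      ring
    rw [h1, h2, e1, mul_zero, sub_zero]
    have h3 : PB * r = P * m := by rw [hr, hm]; ring
    linear_combination wsum p n (n - 1) (fun w => γ (cyclicCount D k w)) * h3
  have e3 := congrArg abs e2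
  rw [abs_mul, abs_of_nonneg hPB0, abs_mul, abs_of_nonneg hP0] at e3
  rw [e3]
  refine mul_le_mul_of_nonneg_left ((abs_add_le _ _).trans ?_) hP0
  rw [add_div]
  refine add_le_add ?_ ?_
  · rw [le_div_iff₀ hr']
    refine Real.le_sqrt_of_sq_le ?_
    rw [mul_pow, sq_abs]
    have hcs := wsum_mul_sq_le hp n (n - 1) (fun w => m - cyclicCount (bridges k) k w)
      (fun w => γ (cyclicCount D k w) - γ ⌊(r : ℝ)⌋₊)
    have hg : wsum p n (n - 1) (fun w => (γ (cyclicCount D k w) - γ ⌊(r : ℝ)⌋₊) ^ 2) * r ^ 2 ≤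
        2 * VN + 2 * a := by
      have h4 : wsum p n (n - 1) (fun w => r ^ 2 * (γ (cyclicCount D k w) - γ ⌊(r : ℝ)⌋₊) ^ 2) ≤
          wsum p n (n - 1) (fun w => 2 * (r - cyclicCount D k w) ^ 2 + 2) := by
        refine wsum_mono hp fun w _ _ => ?_
        have h5 := abs_sub_le_of_abs_succ_sub_le hγ (cyclicCount D k w) ⌊(r : ℝ)⌋₊
        rw [one_div, inv_mul_eq_div, le_div_iff₀ hr'] at h5
        have h6 : (r : ℝ) ^ 2 * (γ (cyclicCount D k w) - γ ⌊(r : ℝ)⌋₊) ^ 2 ≤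
            ((cyclicCount D k w : ℝ) - ⌊(r : ℝ)⌋₊) ^ 2 := by
          rw [← mul_pow, ← sq_abs, ← sq_abs ((cyclicCount D k w : ℝ) - _), abs_mul,
            abs_of_pos hr', mul_comm]
          exact pow_le_pow_left₀ (by positivity) h5 2
        have h7 := Nat.floor_le hr'.le
        have h8 := Nat.lt_floor_add_one (r : ℝ)
        nlinarith [sq_nonneg (((cyclicCount D k w : ℝ) - r) - (r - ⌊(r : ℝ)⌋₊))]
      rw [wsum_const_mul, wsum_add, wsum_const_mul, wsum_const, ← ha] at h4
      linarith
    have hVK0 : 0 ≤ VK := (wsum_nonneg hp fun w => sq_nonneg _).trans hVK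
    calc _ ≤ (wsum p n (n - 1) (fun w => (m - cyclicCount (bridges k) k w) ^ 2) *
          wsum p n (n - 1) (fun w => (γ (cyclicCount D k w) - γ ⌊(r : ℝ)⌋₊) ^ 2)) * r ^ 2 :=
          mul_le_mul_of_nonneg_right hcs (sq_nonneg _)
      _ = wsum p n (n - 1) (fun w => (m - cyclicCount (bridges k) k w) ^ 2) *
          (wsum p n (n - 1) (fun w => (γ (cyclicCount D k w) - γ ⌊(r : ℝ)⌋₊) ^ 2) * r ^ 2) := by
          ring
      _ ≤ VK * (2 * VN + 2 * a) := mul_le_mul hVK hg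
          (mul_nonneg (wsum_nonneg hp fun w => sq_nonneg _) (sq_nonneg _)) hVK0
  · refine (abs_wsum_cyclicCount_mul_sub_le hp hC hM le_rfl hD hk hkn hγ).trans_eq ?_
    ring

end Comparison

section Estimates

variable {p : ℕ → ℝ} {D : Set (List ℕ)} {k : ℕ}

theorem wset_bridges (p : ℕ → ℝ) (hk : 1 ≤ k) : wset p k (k - 1) (bridges k) = wtot p k (k - 1) := by
  rw [wset, ← wsum_one]
  refine wsum_congr fun w h1 h2 => ?_
  rw [Set.indicator_of_mem]
  · rfl
  · exact ⟨h1, by omega⟩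

theorem abs_sqrt_sub_sqrt_sq_mul_le {x y : ℝ} (hx : 0 ≤ x) (hy : 0 ≤ y) :
    (√x - √y) ^ 2 * y ≤ (x - y) ^ 2 := by
  have h1 : √x ^ 2 = x := Real.sq_sqrt hx
  have h2 : √y ^ 2 = y := Real.sq_sqrt hy
  have h3 : (x - y) ^ 2 = (√x - √y) ^ 2 * (√x + √y) ^ 2 := by
    rw [← mul_pow]
    congr 1
    linear_combination h2 - h1
  rw [h3]
  refine mul_le_mul_of_nonneg_left ?_ (sq_nonneg _)
  nlinarith [Real.sqrt_nonneg x, Real.sqrt_nonneg y]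

theorem poissonMeasure_zero_real (A : Set ℕ) : (poissonMeasure 0).real A = A.indicator 1 0 := by
  rw [← tsum_indicator_measureReal, tsum_eq_single 0]
  · by_cases h : 0 ∈ A <;> simp [h, poissonMeasure_real_singleton]
  · intro j hj
    by_cases h : j ∈ A <;> simp [h, poissonMeasure_real_singleton, hj]

theorem wsum_indicator_cyclicCount_of_wset_eq_zero (hp : ∀ j, 0 ≤ p j) (hD : D ⊆ bridges k) {n : ℕ}
    (hk : 1 ≤ k) (hkn : k ≤ n) (h0 : wset p k (k - 1) D = 0) (A : Set ℕ) :
    wsum p n (n - 1) (fun w => A.indicator 1 (cyclicCount D k w)) =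
      wtot p n (n - 1) * A.indicator 1 0 := by
  have h1 := wsum_cyclicCount p hD hk hkn
  rw [h0, zero_mul, mul_zero, wsum, Finset.sum_eq_zero_iff_of_nonneg
    fun w _ => mul_nonneg (wt_nonneg hp w) (Nat.cast_nonneg _)] at h1
  rw [← wsum_const]
  refine Finset.sum_congr rfl fun w hw => ?_
  rcases mul_eq_zero.1 (h1 w hw) with h | h
  · simp [h]
  · have : cyclicCount D k w = 0 := by exact_mod_cast h
    simp only [this]

/-- Second moments in terms of the local limit constants. -/
theorem sqrt_mul_sq_mul {x y z : ℝ} (hx : 0 ≤ x) (hy : 0 ≤ y) :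
    √(x * (y ^ 2 * z)) = √x * (y * √z) := by
  rw [Real.sqrt_mul hx, Real.sqrt_mul (sq_nonneg y), Real.sqrt_sq hy]

theorem second_moment_arith {C c s t a b P PB q : ℝ} (hC : 0 < C) (hc : 0 < c) (hs : 0 < s)
    (ht : 1 ≤ t) (ha1 : c / s ≤ a) (ha2 : a ≤ C / s) (hb0 : 0 ≤ b) (hb : b ≤ 2 * C / s)
    (hP0 : 0 ≤ P) (hPB0 : 0 ≤ PB) (hPB : PB ≤ C / t) (hP : t ^ 2 * P ≤ C / t) (hq : 0 ≤ q) :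
    (s ^ 2 * (PB * (q * (t / s))) + (s ^ 2) ^ 2 * PB ^ 2 * (C * (t ^ 2 / (s ^ 2) ^ 2)) / a) *
      (2 * (s ^ 2 * (P * b) + (s ^ 2) ^ 2 * P ^ 2 * (C * (t ^ 2 / (s ^ 2) ^ 2)) / a) + 2 * a) ≤
    (2 * (C * q + C ^ 3 / c) * C * (2 * C + C ^ 2 / c + 1)) *
      ((s / t) ^ 2 * (1 / t + t ^ 2 / s ^ 2)) := by
  have ht0 : 0 < t := lt_of_lt_of_le one_pos ht
  have ha0 : 0 < a := lt_of_lt_of_le (by positivity) ha1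
  have hainv : 1 / a ≤ s / c := by
    rw [div_le_div_iff₀ ha0 hc, one_mul]
    rwa [div_le_iff₀ hs, mul_comm] at ha1
  have hVK : s ^ 2 * (PB * (q * (t / s))) +
      (s ^ 2) ^ 2 * PB ^ 2 * (C * (t ^ 2 / (s ^ 2) ^ 2)) / a ≤ s * (C * q + C ^ 3 / c) := by
    have e1 : s ^ 2 * (PB * (q * (t / s))) = s * q * (PB * t) := by field_simp
    have e2 : (s ^ 2) ^ 2 * PB ^ 2 * (C * (t ^ 2 / (s ^ 2) ^ 2)) / a =
        C * (PB * t) ^ 2 * (1 / a) := by field_simp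
    have h1 : PB * t ≤ C := by rwa [le_div_iff₀ ht0] at hPB
    have h0 : 0 ≤ PB * t := by positivity
    rw [e1, e2]
    calc s * q * (PB * t) + C * (PB * t) ^ 2 * (1 / a) ≤ s * q * C + C * C ^ 2 * (s / c) := by
          gcongr
      _ = s * (C * q + C ^ 3 / c) := by ring
  have hVN : s ^ 2 * (P * b) + (s ^ 2) ^ 2 * P ^ 2 * (C * (t ^ 2 / (s ^ 2) ^ 2)) / a ≤
      s * P * (2 * C + C ^ 2 / c) := by
    have e2 : (s ^ 2) ^ 2 * P ^ 2 * (C * (t ^ 2 / (s ^ 2) ^ 2)) / a =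
        C * P * (t ^ 2 * P) * (1 / a) := by field_simp
    have h1 : t ^ 2 * P ≤ C := hP.trans (div_le_self hC.le ht)
    rw [e2]
    calc s ^ 2 * (P * b) + C * P * (t ^ 2 * P) * (1 / a) ≤
          s ^ 2 * (P * (2 * C / s)) + C * P * C * (s / c) := by gcongr
      _ = s * P * (2 * C + C ^ 2 / c) := by field_simp
  have hP' : P ≤ C / t ^ 3 := by
    rw [le_div_iff₀ (by positivity)]
    rw [le_div_iff₀ ht0] at hP
    linarith
  set κ := 2 * C + C ^ 2 / c with hκ
  have hκ0 : 0 < κ := by positivity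
  calc _ ≤ s * (C * q + C ^ 3 / c) * (2 * (s * P * κ) + 2 * (C / s)) := by
        refine mul_le_mul hVK (by gcongr) ?_ (by positivity)
        positivity
    _ ≤ s * (C * q + C ^ 3 / c) * (2 * (s * (C / t ^ 3) * κ) + 2 * (C / s)) := by gcongr
    _ = 2 * (C * q + C ^ 3 / c) * C * ((s / t) ^ 2 * (κ * (1 / t) + 1 * (t ^ 2 / s ^ 2))) := by
        field_simp
    _ ≤ 2 * (C * q + C ^ 3 / c) * C * ((s / t) ^ 2 * ((κ + 1) * (1 / t) +
          (κ + 1) * (t ^ 2 / s ^ 2))) := by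
        gcongr <;> linarith
    _ = _ := by ring

/-- Comparison of the Poisson parameters. -/
theorem sqrt_parameter_arith {C c s t a b P : ℝ} (hC : 0 < C) (hc : 0 < c) (hs : 0 < s)
    (ht : 1 ≤ t) (ha1 : c / s ≤ a) (hb0 : 0 ≤ b) (hP0 : 0 < P) (hP : t ^ 2 * P ≤ C / t)
    (hab : |a - b| ≤ C * (1 / s ^ 2 + t ^ 2 / (s ^ 2 * s))) :
    (√(s ^ 2 * (P * b) / a) - √(s ^ 2 * P)) ^ 2 ≤
      2 * C ^ 3 / c ^ 2 * (1 / t + t ^ 2 / s ^ 2) := by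
  have ht0 : 0 < t := lt_of_lt_of_le one_pos ht
  have ha0 : 0 < a := lt_of_lt_of_le (by positivity) ha1
  have hainv : 1 / a ≤ s / c := by
    rw [div_le_div_iff₀ ha0 hc, one_mul]
    rwa [div_le_iff₀ hs, mul_comm] at ha1
  have hP' : P ≤ C / t ^ 3 := by
    rw [le_div_iff₀ (by positivity)]
    rw [le_div_iff₀ ht0] at hP
    linarith
  have h1 := abs_sqrt_sub_sqrt_sq_mul_le (x := s ^ 2 * (P * b) / a) (y := s ^ 2 * P)
    (by positivity) (by positivity)
  have h2 : (s ^ 2 * (P * b) / a - s ^ 2 * P) ^ 2 =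
      (s ^ 2 * P * (|a - b| * (1 / a)) ^ 2) * (s ^ 2 * P) := by
    rw [mul_pow, sq_abs]
    field_simp
    ring
  rw [h2] at h1
  have h3 := le_of_mul_le_mul_right h1 (by positivity)
  refine h3.trans ?_
  calc s ^ 2 * P * (|a - b| * (1 / a)) ^ 2 ≤
        s ^ 2 * (C / t ^ 3) * (C * (1 / s ^ 2 + t ^ 2 / (s ^ 2 * s)) * (s / c)) ^ 2 := by gcongr
    _ = C ^ 3 / c ^ 2 * (1 / t ^ 3 * (1 + t ^ 2 / s) ^ 2) := by field_simp
    _ ≤ C ^ 3 / c ^ 2 * (1 / t ^ 3 * (2 * (1 + t ^ 4 / s ^ 2))) := by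
        have : (1 + t ^ 2 / s) ^ 2 ≤ 2 * (1 + t ^ 4 / s ^ 2) := by
          have e : t ^ 4 / s ^ 2 = (t ^ 2 / s) ^ 2 := by rw [div_pow]; ring
          rw [e]
          nlinarith [sq_nonneg (1 - t ^ 2 / s)]
        gcongr
    _ = 2 * C ^ 3 / c ^ 2 * (1 / t ^ 3 + t / s ^ 2) := by field_simp
    _ ≤ 2 * C ^ 3 / c ^ 2 * (1 / t + t ^ 2 / s ^ 2) := by
        gcongr
        · exact le_self_pow₀ ht (by norm_num)
        · exact le_self_pow₀ ht (by norm_num)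

set_option maxHeartbeats 800000 in
/-- Poisson approximation of the cyclic count, uniformly in the family of windows. -/
theorem exists_abs_sub_poisson_le {h n₀ : ℕ} {C c : ℝ} (H : LocalLimitBounds p h C c n₀) :
    ∃ M : ℝ, ∀ (n k : ℕ) (D : Set (List ℕ)) (r : ℝ≥0), n₀ ≤ n → n₀ ≤ k → 1 ≤ k → 4 * k ≤ n →
      C * (1 / √n + k / n) ≤ c / 2 → n ≡ 1 [MOD h] → k ≡ 1 [MOD h] →
      D ⊆ bridges k → NonOverlapping D k →
      k * wset p k (k - 1) D ≤ wtot p k (k - 1) → (r : ℝ) = n * wset p k (k - 1) D →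
      ∀ A : Set ℕ,
      |wsum p n (n - 1) (fun w => A.indicator 1 (cyclicCount D k w)) / wtot p n (n - 1) -
        (poissonMeasure r).real A| ≤ M * (√(1 / √k + k / n) + (1 / √k + k / n)) := by
  have hp := H.nonneg
  have hC := H.C_pos
  have hc := H.c_pos
  set q := 8 * C ^ 2 + 2 * C with hq
  set κ := 2 * (C * q + C ^ 3 / c) * C * (2 * C + C ^ 2 / c + 1) with hκ
  set M₁ := 2 / c ^ 2 * √κ with hM₁
  set M₂ := 2 / c ^ 2 * (q * C) with hM₂
  set M₃ := 2 * √(2 * C ^ 3 / c ^ 2) with hM₃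
  refine ⟨M₁ + M₂ + M₃, fun n k D r hn hnk hk hkn hreg hmod hkmod hD hno hPD hr A => ?_⟩
  have hM₁0 : 0 ≤ M₁ := by positivity
  have hM₂0 : 0 ≤ M₂ := by positivity
  have hM₃0 : 0 ≤ M₃ := by positivity
  have hn0 : (0 : ℝ) < n := by exact_mod_cast (by omega : 0 < n)
  set s := √(n : ℝ) with hs
  set t := √(k : ℝ) with ht
  have hs0 : 0 < s := Real.sqrt_pos.2 hn0
  have hs2 : s ^ 2 = n := Real.sq_sqrt hn0.le
  have ht1 : 1 ≤ t := Real.one_le_sqrt.2 (by exact_mod_cast hk)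
  have ht0 : 0 < t := lt_of_lt_of_le one_pos ht1
  have ht2 : t ^ 2 = k := Real.sq_sqrt (Nat.cast_nonneg _)
  rw [← hs2, ← ht2]
  set ρ := 1 / t + t ^ 2 / s ^ 2 with hρ
  have hρ0 : 0 < ρ := by positivity
  set a := wtot p n (n - 1) with ha
  set b := wtot p (n - k) (n - k) with hb
  set P := wset p k (k - 1) D with hP
  have ha1 : c / s ≤ a := H.lower n hn hmod
  have ha2 : a ≤ C / s := H.upper n _ (by omega)
  have ha0 : 0 < a := lt_of_lt_of_le (by positivity) ha1
  have hP0 : 0 ≤ P := wset_nonneg hp _ _ _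
  have hPB := wset_bridges p hk
  set PB := wtot p k (k - 1) with hPBdef
  have hPB1 : c / t ≤ PB := H.lower k hnk hkmod
  have hPB2 : PB ≤ C / t := H.upper k _ hk
  have hPB0 : 0 < PB := lt_of_lt_of_le (by positivity) hPB1
  have htP : t ^ 2 * P ≤ C / t := by rw [ht2]; exact hPD.trans hPB2
  have hab : |a - b| ≤ C * (1 / s ^ 2 + t ^ 2 / (s ^ 2 * s)) := by
    rw [hs2, ht2]; exact H.first n k hk hkn hmod hkmod
  have hb1 : c / (2 * s) ≤ b := by
    have h1 := (abs_le.1 hab).2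
    rw [← hs2, ← ht2] at hreg
    have h2 : C * (1 / s ^ 2 + t ^ 2 / (s ^ 2 * s)) = C * (1 / s + t ^ 2 / s ^ 2) / s := by
      field_simp
    have h3 : C * (1 / s + t ^ 2 / s ^ 2) / s ≤ c / 2 / s := by gcongr
    have h4 : c / s = c / (2 * s) + c / 2 / s := by field_simp; norm_num
    linarith
  have hb0 : 0 < b := lt_of_lt_of_le (by positivity) hb1
  have hb2 : b ≤ 2 * C / s := by
    refine (H.upper _ _ (by omega)).trans ?_
    have : s / 2 ≤ √((n - k : ℕ) : ℝ) := by
      refine Real.le_sqrt_of_sq_le ?_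
      rw [div_pow, hs2, div_le_iff₀ (by norm_num)]
      exact_mod_cast (by omega : n ≤ (n - k) * 2 ^ 2)
    calc C / √((n - k : ℕ) : ℝ) ≤ C / (s / 2) := by gcongr
      _ = 2 * C / s := by field_simp
  have hρle : 1 / t ≤ ρ := by
    rw [hρ]; exact le_add_of_nonneg_right (by positivity)
  rcases hP0.eq_or_lt with hP0' | hPpos
  · have hr0 : r = 0 := by
      rw [← hP0', mul_zero] at hr
      exact_mod_cast hr
    rw [hr0, poissonMeasure_zero_real, wsum_indicator_cyclicCount_of_wset_eq_zero hp hD hk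
      (by omega) hP0'.symm, ← ha, mul_div_cancel_left₀ _ ha0.ne', sub_self, abs_zero]
    positivity
  set r' : ℝ≥0 := ⟨n * (P * b) / a, by positivity⟩ with hr'
  have hr'c : (r' : ℝ) = n * (P * b) / a := rfl
  have hr'0 : 0 < r' := by
    rw [← NNReal.coe_pos, hr'c]; positivity
  -- Stein--Chen with the exact mean
  have hε := H.second n k hk hkn hmod hkmod
  have hSN : (wsum p n (n - 1) (fun w => pre D k w * pre D k (w.rotate 0)) +
      ∑ j ∈ Finset.Ico 1 k, (wsum p n (n - 1) (fun w => pre D k w * pre D k (w.rotate j)) +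
        wsum p n (n - 1) (fun w => pre D k w * pre D k (w.rotate (n - j))))) ≤ P * b := by
    rw [Finset.sum_eq_zero fun j hj => ?_, add_zero]
    · have := wsum_pre p hD hk (by omega : k ≤ n) (by omega : k ≤ n - 1 + 1)
      rw [show n - 1 + 1 - k = n - k by omega] at this
      rw [hP, hb, ← this]
      exact wsum_mono hp fun w _ _ =>
        mul_le_of_le_one_right (pre_nonneg w) (Set.indicator_le_self' (fun _ _ => zero_le_one) _)
    · obtain ⟨h1, h2⟩ := Finset.mem_Ico.1 hj
      have hz : ∀ w : List ℕ, w.length = n → pre D k w * pre D k (w.rotate j) = 0 ∧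
          pre D k w * pre D k (w.rotate (n - j)) = 0 := by
        intro w hw
        by_cases hwD : w.take k ∈ D
        · have := hno.pre_rotate (by omega) hwD h1 h2
          rw [hw] at this
          rw [this.1, this.2, mul_zero, and_self]
        · rw [pre_of_notMem hwD, zero_mul, zero_mul, and_self]
      rw [wsum_congr fun w hw _ => (hz w hw).1, wsum_congr (F := fun w => pre D k w * pre D k
        (w.rotate (n - j))) fun w hw _ => (hz w hw).2, wsum_const, mul_zero, add_zero]
  have hVN := wsum_sub_cyclicCount_sq_le hp hD hk (by omega) ha0 ha hb rfl hε hSN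
  have hVK := wsum_sub_cyclicCount_sq_le hp (le_refl (bridges k)) hk (by omega) ha0 ha hb rfl hε
    (sum_overlap_le hp hC.le H.upper le_rfl le_rfl hk hkn)
  have hmain := wset_mul_abs_wsum_indicator_sub_le hp hC.le H.upper hD hno hk hkn ha0 ha hb hr'0
    hr'c hVK hVN A
  rw [hPB, ← hP, ← hq, ← hs, ← ht, hr'c, ← hs2, ← ht2] at hmain
  have harith := second_moment_arith hC hc hs0 ht1 ha1 ha2 hb0.le hb2 hP0 hPB0.le hPB2 htP
    (by positivity : 0 ≤ q)
  rw [← hκ, ← hρ] at harith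
  have hsqrt := Real.sqrt_le_sqrt harith
  have hq0 : 0 ≤ q := by positivity
  rw [sqrt_mul_sq_mul (hκ ▸ by positivity) (by positivity)] at hsqrt
  clear_value M₁ M₂ M₃ κ q ρ a b P PB s t r'
  have h1 : |wsum p n (n - 1) (fun w => A.indicator 1 (cyclicCount D k w)) / a -
      (poissonMeasure r').real A| ≤ M₁ * √ρ + M₂ * ρ := by
    set X := wsum p n (n - 1) (fun w => A.indicator 1 (cyclicCount D k w))
    have e1 : |X / a - (poissonMeasure r').real A| = |X - a * (poissonMeasure r').real A| / a := by
      rw [← abs_of_pos ha0, ← abs_div, abs_of_pos ha0]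
      congr 1
      field_simp
    have h2 : PB * |X - a * (poissonMeasure r').real A| ≤
        P * ((√κ * (s / t * √ρ) + s ^ 2 * (P * (q * (t / s)))) / (s ^ 2 * (P * b) / a)) := by
      refine hmain.trans ?_
      gcongr
    have h3 : P * ((√κ * (s / t * √ρ) + s ^ 2 * (P * (q * (t / s)))) / (s ^ 2 * (P * b) / a)) =
        a * ((1 / b) * ((√κ * √ρ + q * (t ^ 2 * P)) / (s * t))) := by
      field_simp
    have h4 : (1 / b) * ((√κ * √ρ + q * (t ^ 2 * P)) / (s * t)) ≤
        (2 * s / c) * ((√κ * √ρ + q * (C / t)) / (s * t)) := by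
      have : 1 / b ≤ 2 * s / c := by
        rw [div_le_div_iff₀ hb0 hc, one_mul]
        rwa [div_le_iff₀ (by positivity), mul_comm] at hb1
      gcongr
    have h5 : |X - a * (poissonMeasure r').real A| / a ≤ (t / c) *
        ((2 * s / c) * ((√κ * √ρ + q * (C / t)) / (s * t))) := by
      rw [div_le_iff₀ ha0]
      have h6 : (c / t) * |X - a * (poissonMeasure r').real A| ≤
          a * ((2 * s / c) * ((√κ * √ρ + q * (C / t)) / (s * t))) := by
        calc _ ≤ PB * |X - a * (poissonMeasure r').real A| := by gcongr
          _ ≤ _ := h2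
          _ = _ := h3
          _ ≤ _ := mul_le_mul_of_nonneg_left h4 ha0.le
      calc |X - a * (poissonMeasure r').real A| =
            (t / c) * ((c / t) * |X - a * (poissonMeasure r').real A|) := by field_simp
        _ ≤ (t / c) * (a * ((2 * s / c) * ((√κ * √ρ + q * (C / t)) / (s * t)))) := by gcongr
        _ = _ := by ring
    rw [e1]
    refine h5.trans ?_
    have e2 : (t / c) * ((2 * s / c) * ((√κ * √ρ + q * (C / t)) / (s * t))) =
        M₁ * √ρ + M₂ * (1 / t) := by
      rw [hM₁, hM₂]
      field_simp
    rw [e2]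
    gcongr
  have h2 : |(poissonMeasure r').real A - (poissonMeasure r).real A| ≤ M₃ * √ρ := by
    refine (abs_sub_le_distTV A).trans ((distTV_poissonMeasure_le r' r).trans ?_)
    rw [hM₃, mul_assoc, ← Real.sqrt_mul (by positivity)]
    refine mul_le_mul_of_nonneg_left (Real.le_sqrt_of_sq_le ?_) two_pos.le
    rw [sq_abs, hr'c, hr, ← hs2]
    rw [hρ]
    exact sqrt_parameter_arith hC hc hs0 ht1 ha1 hb0.le hPpos htP hab
  calc _ ≤ (M₁ * √ρ + M₂ * ρ) + M₃ * √ρ := (abs_sub_le _ _ _).trans (add_le_add h1 h2)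
    _ ≤ (M₁ + M₂ + M₃) * (√ρ + ρ) := by
      have h3 := Real.sqrt_nonneg ρ
      nlinarith [mul_nonneg hM₁0 hρ0.le, mul_nonneg hM₂0 h3, mul_nonneg hM₃0 hρ0.le]

end Estimates

/-- `w` is the depth-first list of degrees of a plane forest consisting of `d` trees. -/
def IsForestWord (d : ℕ) (w : List ℕ) : Prop :=
  w.sum + d = w.length ∧ ∀ m < w.length, m < (w.take m).sum + d

namespace IsForestWord

theorem nil : IsForestWord 0 [] := by simp [IsForestWord]

theorem append {a b : ℕ} {u v : List ℕ} (hu : IsForestWord a u) (hv : IsForestWord b v) :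
    IsForestWord (a + b) (u ++ v) := by
  obtain ⟨hu1, hu2⟩ := hu
  obtain ⟨hv1, hv2⟩ := hv
  refine ⟨by simp; omega, fun m hm => ?_⟩
  rw [List.take_append, List.sum_append]
  rw [List.length_append] at hm
  by_cases h : m < u.length
  · have := hu2 m h
    omega
  · have := hv2 (m - u.length) (by omega)
    rw [List.take_of_length_le (by omega)]
    omega

theorem cons {d : ℕ} {w : List ℕ} (hw : IsForestWord d w) : IsForestWord 1 (d :: w) := by
  obtain ⟨h1, h2⟩ := hw
  refine ⟨by simp; omega, fun m hm => ?_⟩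
  cases m with
  | zero => simp
  | succ m =>
    have := h2 m (by simpa using hm)
    simp
    omega

theorem of_cons {d e : ℕ} {w : List ℕ} (hw : IsForestWord (d + 1) (e :: w)) :
    IsForestWord (e + d) w := by
  obtain ⟨h1, h2⟩ := hw
  simp only [List.sum_cons, List.length_cons] at h1
  refine ⟨by omega, fun m hm => ?_⟩
  have := h2 (m + 1) (by simpa using hm)
  simp only [List.take_succ_cons, List.sum_cons] at this
  omega

theorem flatten {L : List (List ℕ)} (h : ∀ u ∈ L, IsForestWord 1 u) :
    IsForestWord L.length L.flatten := by
  induction L with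
  | nil => exact nil
  | cons u L ih =>
    rw [List.flatten_cons, List.length_cons, add_comm]
    exact (h u List.mem_cons_self).append (ih fun v hv => h v (List.mem_cons_of_mem u hv))

theorem eq_of_prefix {d : ℕ} {u v : List ℕ} (hu : IsForestWord d u) (hv : IsForestWord d v)
    (h : u <+: v) : u = v := by
  refine h.eq_of_length (le_antisymm h.length_le ?_)
  by_contra! hlt
  have := hv.2 u.length hlt
  rw [← List.prefix_iff_eq_take.1 h, hu.1] at this
  exact lt_irrefl _ this

theorem eq_of_prefix_of_prefix {d : ℕ} {u v w : List ℕ} (hu : IsForestWord d u)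
    (hv : IsForestWord d v) (hu' : u <+: w) (hv' : v <+: w) : u = v :=
  (List.prefix_or_prefix_of_prefix hu' hv').elim (hu.eq_of_prefix hv)
    fun h => (hv.eq_of_prefix hu h).symm

theorem eq_of_flatten_eq {L L' : List (List ℕ)} (h : ∀ u ∈ L, IsForestWord 1 u)
    (h' : ∀ u ∈ L', IsForestWord 1 u) (hlen : L.length = L'.length)
    (heq : L.flatten = L'.flatten) : L = L' := by
  induction L generalizing L' with
  | nil => exact (List.length_eq_zero_iff.1 hlen.symm).symm
  | cons u L ih =>
    cases L' with
    | nil => simp at hlen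
    | cons v L' =>
      rw [List.flatten_cons, List.flatten_cons] at heq
      obtain rfl : u = v := (h u List.mem_cons_self).eq_of_prefix_of_prefix
        (h' v List.mem_cons_self) (List.prefix_append u _) (heq ▸ List.prefix_append v _)
      rw [ih (fun x hx => h x (List.mem_cons_of_mem _ hx))
        (fun x hx => h' x (List.mem_cons_of_mem _ hx)) (by simpa using hlen)
        (List.append_cancel_left heq)]

theorem not_rotate {u : List ℕ} {j : ℕ} (hu : IsForestWord 1 u) (hj : j < u.length)
    {v : List ℕ} (hv : IsForestWord 1 v) (hlen : u.length - j < v.length) :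
    ¬ u.drop j <+: v := by
  intro h
  have h1 := hv.2 _ hlen
  have h2 := List.prefix_iff_eq_take.1 h
  rw [List.length_drop] at h2
  rw [← h2] at h1
  have h3 := hu.2 j hj
  have h4 := List.sum_take_add_sum_drop u j
  have h5 := hu.1
  omega

end IsForestWord

theorem nonOverlapping_of_isForestWord {D : Set (List ℕ)} {k : ℕ}
    (hD : ∀ u ∈ D, IsForestWord 1 u ∧ u.length = k) : NonOverlapping D k := by
  intro w hw hu j hj hjk hv
  rw [take_rotate_of_add_le (by omega)] at hv
  obtain ⟨hu1, hu2⟩ := hD _ hu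
  obtain ⟨hv1, hv2⟩ := hD _ hv
  refine hu1.not_rotate (j := j) (by omega) hv1 (by omega) ?_
  rw [List.drop_take]
  exact List.take_prefix_take_left (by omega)

/-! ### The cycle lemma -/

theorem exists_isForestWord_rotate {w : List ℕ} (hw : w.sum + 1 = w.length) :
    ∃ r < w.length, IsForestWord 1 (w.rotate r) := by
  set n := w.length with hn
  have hex : ∃ r, r < n ∧ ∀ j < n, ((w.take r).sum : ℤ) - r ≤ (w.take j).sum - j := by
    obtain ⟨r, hr, hr'⟩ := Finset.exists_min_image (Finset.range n)
      (fun j => ((w.take j).sum : ℤ) - j) ⟨0, Finset.mem_range.2 (by omega)⟩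
    exact ⟨r, Finset.mem_range.1 hr, fun j hj => hr' j (Finset.mem_range.2 hj)⟩
  classical
  obtain ⟨hr, hmin⟩ := Nat.find_spec hex
  have hfirst : ∀ j < Nat.find hex, ((w.take (Nat.find hex)).sum : ℤ) - Nat.find hex <
      (w.take j).sum - j := by
    intro j hj
    have h := Nat.find_min hex hj
    push Not at h
    obtain ⟨j', h1, h2⟩ := h (hj.trans hr)
    exact (hmin j' h1).trans_lt h2
  set r := Nat.find hex
  refine ⟨r, hr, by simpa [(List.rotate_perm w r).sum_eq] using hw, fun m hm => ?_⟩
  rw [List.length_rotate] at hm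
  rw [List.rotate_eq_drop_append_take hr.le, List.take_append, List.length_drop, List.sum_append]
  have hsplit := List.sum_take_add_sum_drop w r
  by_cases h : m ≤ n - r
  · have h0 : m - (n - r) = 0 := by omega
    rw [← hn, h0, List.take_zero, List.sum_nil]
    have hs : (w.take (r + m)).sum = (w.take r).sum + ((w.drop r).take m).sum := by
      rw [List.take_add, List.sum_append]
    by_cases h' : r + m < n
    · have := hmin (r + m) h'
      omega
    · have h1 : r + m = n := by omega
      rw [h1, hn, List.take_length] at hs
      have := hfirst 0 (by omega)
      rw [List.take_zero, List.sum_nil, Nat.cast_zero, sub_zero] at this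
      omega
  · rw [List.take_of_length_le (by simp; omega), List.take_take, ← hn]
    have := hfirst (m - (n - r)) (by omega)
    rw [min_eq_left (by omega)]
    omega

theorem IsForestWord.eq_of_rotate {w : List ℕ} {r r' : ℕ} (hr : IsForestWord 1 (w.rotate r))
    (hr' : IsForestWord 1 (w.rotate r')) (hlt : r < r') (hn : r' < w.length) : False := by
  have h : w.rotate r' = (w.rotate r).rotate (r' - r) := by
    rw [List.rotate_rotate]; congr 1; omega
  rw [h] at hr'
  refine hr.not_rotate (j := r' - r) (by simp; omega) hr' (by simp; omega) ?_
  rw [List.rotate_eq_drop_append_take (l := w.rotate r) (by simp; omega)]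
  exact List.prefix_append _ _

theorem cyclicCount_isForestWord {w : List ℕ} (hw : w.sum + 1 = w.length) :
    cyclicCount {u | IsForestWord 1 u} w.length w = 1 := by
  classical
  obtain ⟨r, hr, hr'⟩ := exists_isForestWord_rotate hw
  rw [cyclicCount, Finset.card_eq_one]
  refine ⟨r, Finset.eq_singleton_iff_unique_mem.2 ⟨?_, fun i hi => ?_⟩⟩
  · rw [Finset.mem_filter, Finset.mem_range, List.take_of_length_le (by simp)]
    exact ⟨hr, hr'⟩
  · rw [Finset.mem_filter, Finset.mem_range, List.take_of_length_le (by simp)] at hi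
    rcases lt_trichotomy i r with h | h | h
    · exact (hi.2.eq_of_rotate hr' h hr).elim
    · exact h
    · exact (hr'.eq_of_rotate hi.2 h hi.1).elim

theorem wsum_eq_mul_wsum_isForestWord (p : ℕ → ℝ) {n : ℕ} (hn : 1 ≤ n) (φ : List ℕ → ℝ)
    (hφ : ∀ w i, φ (w.rotate i) = φ w) :
    wsum p n (n - 1) φ =
      n * wsum p n (n - 1) (fun w => Set.indicator {u | IsForestWord 1 u} 1 w * φ w) := by
  have h := wsum_cyclicCount_mul p (D := {u | IsForestWord 1 u}) (k := n) (n := n) (s := n - 1) φ hφ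
  rw [wsum_congr (G := φ) fun w h1 h2 => ?_] at h
  · rw [h]
    congr 1
    refine wsum_congr fun w h1 _ => ?_
    rw [pre, ← h1, List.take_length]
  · rw [← h1, cyclicCount_isForestWord (by omega), Nat.cast_one, one_mul]

namespace PlaneTree

/-- The degrees of the nodes of a plane tree, in depth-first order. -/
def word : PlaneTree → List ℕ
  | node d child => d :: (List.ofFn fun i => (child i).word).flatten

theorem length_word (T : PlaneTree) : T.word.length = T.size := by
  induction T with
  | node d c ih =>
    rw [word, size, List.length_cons, List.length_flatten, List.map_ofFn, List.sum_ofFn, add_comm]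
    exact congrArg _ (Finset.sum_congr rfl fun i _ => ih i)

theorem isForestWord_word (T : PlaneTree) : IsForestWord 1 T.word := by
  induction T with
  | node d c ih =>
    have h : IsForestWord (List.ofFn fun i => (c i).word).length
        (List.ofFn fun i => (c i).word).flatten := .flatten fun u hu => by
      obtain ⟨i, rfl⟩ := (List.mem_ofFn' _ _).1 hu
      exact ih i
    rw [List.length_ofFn] at h
    exact h.cons

theorem word_injective : Function.Injective word := by
  intro T
  induction T with
  | node d c ih =>
    rintro ⟨d', c'⟩ h
    rw [word, word, List.cons.injEq] at h
    obtain ⟨rfl, h⟩ := h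
    have h' := IsForestWord.eq_of_flatten_eq
      (fun u hu => by
        obtain ⟨i, rfl⟩ := (List.mem_ofFn' _ _).1 hu
        exact (c i).isForestWord_word)
      (fun u hu => by
        obtain ⟨i, rfl⟩ := (List.mem_ofFn' _ _).1 hu
        exact (c' i).isForestWord_word) (by simp) h
    have h2 := List.ofFn_injective h'
    congr 1
    exact funext fun i => ih i (congrFun h2 i)

theorem exists_forest {d : ℕ} {w : List ℕ} (hw : IsForestWord d w) :
    ∃ L : List PlaneTree, L.length = d ∧ (L.map word).flatten = w := by
  induction w generalizing d with
  | nil => exact ⟨[], by simpa using hw.1.symm, rfl⟩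
  | cons e w ih =>
    cases d with
    | zero => exact absurd (hw.2 0 (by simp)) (by simp)
    | succ d =>
      obtain ⟨L, hL, hLw⟩ := ih hw.of_cons
      have he : (L.take e).length = e := by simp; omega
      refine ⟨node (L.take e).length (L.take e).get :: L.drop e, by simp; omega, ?_⟩
      have h1 : (List.ofFn fun i => ((L.take e).get i).word) = (L.take e).map word := by
        rw [← Function.comp_def, ← List.map_ofFn, List.ofFn_get]
      rw [List.map_cons, List.flatten_cons, word, h1, he, List.cons_append, ← List.flatten_append,
        ← List.map_append, List.take_append_drop, hLw]

theorem exists_word_eq {w : List ℕ} (hw : IsForestWord 1 w) : ∃ T : PlaneTree, T.word = w := by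
  obtain ⟨L, hL, hLw⟩ := exists_forest hw
  obtain ⟨T, rfl⟩ := List.length_eq_one_iff.1 hL
  exact ⟨T, by simpa using hLw⟩

theorem mem_image_word {S : Set PlaneTree} {k : ℕ} (hS : S ⊆ ofSize k) {u : List ℕ}
    (hu : u ∈ word '' S) : IsForestWord 1 u ∧ u.length = k := by
  obtain ⟨T, hT, rfl⟩ := hu
  exact ⟨T.isForestWord_word, T.length_word.trans (hS hT)⟩

theorem image_word_subset_bridges {S : Set PlaneTree} {k : ℕ} (hS : S ⊆ ofSize k) :
    word '' S ⊆ bridges k := fun u hu => by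
  obtain ⟨h1, h2⟩ := mem_image_word hS hu
  exact ⟨h2, h2 ▸ h1.1⟩

/-! ### Fringe subtrees as windows of the word -/

/-- `F` lists plane trees whose words start at the successive positions of `W`. -/
def StartIn (F : List PlaneTree) (W : List ℕ) : Prop :=
  F.length = W.length ∧ ∀ i T, F[i]? = some T → T.word <+: W.drop i

theorem StartIn.append {F F' : List PlaneTree} {W W' : List ℕ} (h : StartIn F W)
    (h' : StartIn F' W') : StartIn (F ++ F') (W ++ W') := by
  refine ⟨by rw [List.length_append, List.length_append, h.1, h'.1], fun i T hT => ?_⟩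
  rw [List.drop_append]
  by_cases hi : i < F.length
  · rw [List.getElem?_append_left hi] at hT
    exact (h.2 i T hT).trans (List.prefix_append _ _)
  · rw [List.getElem?_append_right (by omega)] at hT
    rw [List.drop_of_length_le (by rw [← h.1]; omega), List.nil_append, ← h.1]
    exact h'.2 _ T hT

theorem startIn_flatten {L : List PlaneTree} (h : ∀ T ∈ L, StartIn T.fringe T.word) :
    StartIn (L.map fringe).flatten (L.map word).flatten := by
  induction L with
  | nil => exact ⟨rfl, fun i T hT => by simp at hT⟩
  | cons T L ih =>
    exact (h T List.mem_cons_self).append (ih fun T' hT' => h T' (List.mem_cons_of_mem _ hT'))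

theorem startIn_fringe (T : PlaneTree) : StartIn T.fringe T.word := by
  induction T with
  | node d c ih =>
    have h := startIn_flatten (L := List.ofFn c) fun T hT => by
      obtain ⟨i, rfl⟩ := (List.mem_ofFn' _ _).1 hT
      exact ih i
    rw [List.map_ofFn, List.map_ofFn] at h
    refine ⟨congrArg (· + 1) h.1, fun i T hT => ?_⟩
    rw [fringe] at hT
    cases i with
    | zero =>
      obtain rfl : node d c = T := by simpa using hT
      exact List.prefix_rfl
    | succ i => exact h.2 i T (by simpa [Function.comp_def] using hT)

end PlaneTree

theorem List.countP_eq_card_filter_range {α : Type*} (q : α → Bool) (l : List α) :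
    l.countP q = ((Finset.range l.length).filter fun i => l[i]?.any q).card := by
  induction l using List.reverseRecOn with
  | nil => simp
  | append_singleton l a ih =>
    rw [List.countP_append, List.length_append, List.length_singleton, Finset.range_add_one,
      Finset.filter_insert, List.countP_singleton]
    have h : (Finset.range l.length).filter (fun i => (l ++ [a])[i]?.any q) =
        (Finset.range l.length).filter (fun i => l[i]?.any q) :=
      Finset.filter_congr fun i hi => by
        rw [List.getElem?_append_left (Finset.mem_range.1 hi)]
    rw [h, ← ih.symm]
    by_cases ha : q a
    · simp [ha]
    · simp [ha]

namespace PlaneTree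

theorem fringeCount_eq_cyclicCount {S : Set PlaneTree} {k : ℕ} (hS : S ⊆ ofSize k)
    (T : PlaneTree) : fringeCount S T = cyclicCount (word '' S) k T.word := by
  classical
  rw [fringeCount, List.countP_eq_card_filter_range, cyclicCount, (startIn_fringe T).1]
  refine congrArg _ (Finset.filter_congr fun i hi => ?_)
  rw [Finset.mem_range] at hi
  have hi' : i < T.fringe.length := by rwa [(startIn_fringe T).1]
  set t := T.fringe[i] with ht
  have hti : T.fringe[i]? = some t := List.getElem?_eq_getElem hi'
  have hpre : t.word <+: T.word.rotate i := by
    rw [List.rotate_eq_drop_append_take hi.le]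
    exact ((startIn_fringe T).2 i t hti).trans (List.prefix_append _ _)
  rw [hti, Option.any_some, decide_eq_true_eq]
  constructor
  · intro htS
    refine ⟨t, htS, ?_⟩
    rw [List.prefix_iff_eq_take.1 hpre, length_word, show t.size = k from hS htS]
  · rintro ⟨s, hs, hsw⟩
    have hs' : s.word <+: T.word.rotate i := hsw ▸ List.take_prefix _ _
    rwa [word_injective (t.isForestWord_word.eq_of_prefix_of_prefix s.isForestWord_word hpre hs')]

/-! ### The law of the Galton--Watson tree -/

theorem exists_setOf_isGrownFrom (T : PlaneTree) (p : ℕ → ℝ) :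
    ∃ (s : Finset (List ℕ)) (f : List ℕ → ℕ),
      {c | T.IsGrownFrom c} = Set.pi s (fun u => {f u}) ∧ ∏ u ∈ s, p (f u) = wt p T.word := by
  classical
  induction T with
  | node d c ih =>
    choose s f h1 h2 using ih
    let f' : List ℕ → ℕ
      | [] => d
      | i :: u => if h : i < d then f ⟨i, h⟩ u else 0
    have hf' : ∀ (i : Fin d) u, f' (i.val :: u) = f i u := fun i u => by simp [f']
    let e : Fin d → List ℕ ↪ List ℕ := fun i => ⟨List.cons i.val, List.cons_injective⟩
    refine ⟨insert [] (Finset.univ.biUnion fun i : Fin d => (s i).map (e i)), f', ?_, ?_⟩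
    · ext x
      have h3 : ∀ i y, (c i).IsGrownFrom y ↔ ∀ u ∈ s i, y u = f i u := fun i y => by
        have := Set.ext_iff.1 (h1 i) y
        simpa using this
      simp only [Set.mem_ofPred_eq, IsGrownFrom, h3, Set.mem_pi, Finset.mem_coe,
        Finset.mem_insert, Finset.mem_biUnion, Finset.mem_univ, true_and, Finset.mem_map,
        Set.mem_singleton_iff, forall_eq_or_imp]
      refine and_congr Iff.rfl ⟨?_, fun h i u hu => ?_⟩
      · rintro h _ ⟨i, u, hu, rfl⟩
        exact (h i u hu).trans (hf' i u).symm
      · exact (h _ ⟨i, u, hu, rfl⟩).trans (hf' i u)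
    · rw [Finset.prod_insert (by simp [e]), Finset.prod_biUnion, word, wt_cons, wt, List.map_flatten,
        List.prod_flatten, List.map_ofFn, List.map_ofFn, List.prod_ofFn]
      · refine congrArg (p d * ·) (Finset.prod_congr rfl fun i _ => ?_)
        rw [Finset.prod_map]
        exact (Finset.prod_congr rfl fun u _ => congrArg p (hf' i u)).trans (h2 i)
      · intro i _ j _ hij
        rw [Function.onFun, Finset.disjoint_left]
        intro a ha hb
        obtain ⟨u, _, rfl⟩ := Finset.mem_map.1 ha
        obtain ⟨v, _, hv⟩ := Finset.mem_map.1 hb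
        exact hij (Fin.ext (List.cons.inj hv).1.symm)

instance : DiscreteMeasurableSpace PlaneTree := ⟨fun _ => MeasurableSpace.measurableSet_top⟩

variable (ν : Measure ℕ) [IsProbabilityMeasure ν]

theorem infinitePi_isGrownFrom (T : PlaneTree) :
    Measure.infinitePi (fun _ : List ℕ => ν) {c | T.IsGrownFrom c} =
      ENNReal.ofReal (wt (fun j => ν.real {j}) T.word) := by
  obtain ⟨s, f, h1, h2⟩ := T.exists_setOf_isGrownFrom fun j => ν.real {j}
  rw [h1, Measure.infinitePi_pi _ fun _ _ => measurableSet_singleton _, ← h2,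
    ENNReal.ofReal_prod_of_nonneg fun _ _ => measureReal_nonneg]
  exact Finset.prod_congr rfl fun u _ => (ofReal_measureReal).symm

theorem gwLaw_apply {S : Set PlaneTree} {k : ℕ} (hS : S ⊆ ofSize k) :
    gwLaw ν S = ENNReal.ofReal (wset (fun j => ν.real {j}) k (k - 1) (word '' S)) := by
  have hp : ∀ j, 0 ≤ ν.real {j} := fun _ => measureReal_nonneg
  set p : ℕ → ℝ := fun j => ν.real {j}
  set G : List ℕ → ℝ≥0∞ := fun w => ENNReal.ofReal (wt p w * (word '' S).indicator 1 w) with hG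
  have hG0 : ∀ w, w ∉ word '' S → G w = 0 := fun w hw => by
    rw [hG]; simp [Set.indicator_of_notMem hw]
  have h1 : gwLaw ν S = ∑' T : PlaneTree, G T.word := by
    rw [gwLaw, Measure.sum_apply _ (.of_discrete)]
    refine tsum_congr fun T => ?_
    rw [Measure.smul_apply, infinitePi_isGrownFrom, Measure.dirac_apply' _ (.of_discrete), smul_eq_mul]
    by_cases hT : T ∈ S
    · simp [hG, hT, Set.indicator_of_mem (Set.mem_image_of_mem word hT), p]
    · rw [hG0 _ fun h => hT ((word_injective.mem_set_image).1 h)]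
      simp [hT]
  rw [h1, word_injective.tsum_eq, tsum_eq_sum (s := words k (k - 1)), wset, wsum]
  · exact (ENNReal.ofReal_sum_of_nonneg fun w _ =>
      mul_nonneg (wt_nonneg hp w) (Set.indicator_nonneg (fun _ _ => zero_le_one) w)).symm
  · intro w hw
    refine hG0 w fun h => hw (mem_words.2 ?_)
    have := image_word_subset_bridges hS h
    exact ⟨this.1, by have := this.2; omega⟩
  · intro w hw
    by_contra h
    exact hw (hG0 w fun h' => h (Set.image_subset_range _ _ h'))

end PlaneTree

section

open PlaneTree

variable (ν : Measure ℕ)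

theorem coe_gwProb (S : Set PlaneTree) : (gwProb ν S : ℝ) = (gwLaw ν).real S := rfl

theorem fringeCountLaw_real (n : ℕ) (S : Set PlaneTree) (A : Set ℕ) :
    (fringeCountLaw ν n S : Measure ℕ).real A = (condGWLaw ν n).real (fringeCount S ⁻¹' A) :=
  map_measureReal_apply .of_discrete .of_discrete

variable [IsProbabilityMeasure ν]

theorem gwLaw_real {S : Set PlaneTree} {k : ℕ} (hS : S ⊆ ofSize k) :
    (gwLaw ν).real S = wset (fun j => ν.real {j}) k (k - 1) (word '' S) := by
  rw [measureReal_def, gwLaw_apply ν hS,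
    ENNReal.toReal_ofReal (wset_nonneg (fun _ => measureReal_nonneg) _ _ _)]

theorem mul_gwLaw_real_le {S : Set PlaneTree} {k : ℕ} (hS : S ⊆ ofSize k) (hk : 1 ≤ k) :
    k * (gwLaw ν).real S ≤ wtot (fun j => ν.real {j}) k (k - 1) := by
  rw [gwLaw_real ν hS, ← wsum_one,
    wsum_eq_mul_wsum_isForestWord _ hk (fun _ => 1) (fun _ _ => rfl)]
  refine mul_le_mul_of_nonneg_left (wsum_mono (fun _ => measureReal_nonneg) fun w _ _ => ?_)
    (Nat.cast_nonneg _)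
  rw [mul_one]
  exact Set.indicator_le_indicator_of_subset (fun u hu => (mem_image_word hS hu).1)
    (fun _ => zero_le_one) w

theorem gwLaw_real_ofSize_inter {S : Set PlaneTree} {n k : ℕ} (hS : S ⊆ ofSize k) (hn : 1 ≤ n)
    (A : Set ℕ) :
    (gwLaw ν).real (ofSize n ∩ fringeCount S ⁻¹' A) =
      wsum (fun j => ν.real {j}) n (n - 1)
        (fun w => A.indicator 1 (cyclicCount (word '' S) k w)) / n := by
  have hn0 : (n : ℝ) ≠ 0 := by exact_mod_cast (by omega : n ≠ 0)
  rw [gwLaw_real ν Set.inter_subset_left, wsum_eq_mul_wsum_isForestWord _ hn _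
    fun w i => by rw [cyclicCount_rotate], mul_div_cancel_left₀ _ hn0, wset]
  refine wsum_congr fun w hw _ => ?_
  by_cases h : IsForestWord 1 w
  · obtain ⟨T, rfl⟩ := exists_word_eq h
    rw [Set.indicator_of_mem (s := {u | IsForestWord 1 u}) h, Pi.one_apply, one_mul,
      ← fringeCount_eq_cyclicCount hS]
    have hT : T ∈ ofSize n := T.length_word.symm.trans hw
    by_cases hA : fringeCount S T ∈ A
    · have hm : T.word ∈ word '' (ofSize n ∩ fringeCount S ⁻¹' A) := ⟨T, ⟨hT, hA⟩, rfl⟩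
      rw [Set.indicator_of_mem hA, Set.indicator_of_mem hm]
      rfl
    · rw [Set.indicator_of_notMem hA, Set.indicator_of_notMem]
      exact fun h' => hA (word_injective.mem_set_image.1 h').2
  · rw [Set.indicator_of_notMem (s := {u | IsForestWord 1 u}) h, zero_mul,
      Set.indicator_of_notMem]
    exact fun h' => h (mem_image_word Set.inter_subset_left h').1

theorem condGWLaw_real_preimage {S : Set PlaneTree} {n k : ℕ} (hS : S ⊆ ofSize k) (hn : 1 ≤ n)
    (A : Set ℕ) :
    (condGWLaw ν n).real (fringeCount S ⁻¹' A) =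
      wsum (fun j => ν.real {j}) n (n - 1)
        (fun w => A.indicator 1 (cyclicCount (word '' S) k w)) /
      wtot (fun j => ν.real {j}) n (n - 1) := by
  have hn0 : (n : ℝ) ≠ 0 := by exact_mod_cast (by omega : n ≠ 0)
  have h1 := gwLaw_real_ofSize_inter ν hS hn A
  have h2 := gwLaw_real_ofSize_inter ν hS hn Set.univ
  simp only [Set.preimage_univ, Set.inter_univ, Set.indicator_univ, Pi.one_apply, wsum_one] at h2
  rw [condGWLaw, measureReal_def, cond_apply .of_discrete, ENNReal.toReal_mul, ENNReal.toReal_inv,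
    ← measureReal_def, ← measureReal_def, h1, h2]
  field_simp

variable {ν} in
theorem LocalLimitBounds.exists_distTV_fringeCountLaw_le {h n₀ : ℕ} {C c : ℝ}
    (H : LocalLimitBounds (fun j => ν.real {j}) h C c n₀) :
    ∃ M : ℝ, ∀ (n k : ℕ) (S : Set PlaneTree), S ⊆ ofSize k → n₀ ≤ n → n₀ ≤ k → 1 ≤ k →
      4 * k ≤ n → C * (1 / √n + k / n) ≤ c / 2 → n ≡ 1 [MOD h] →
      distTV (fringeCountLaw ν n S) (poissonMeasure (n * gwProb ν S)) ≤
        M * (√(1 / √k + k / n) + (1 / √k + k / n)) := by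
  obtain ⟨M, hM⟩ := exists_abs_sub_poisson_le H
  refine ⟨|M|, fun n k S hS hn hnk hk hkn hreg hmod => distTV_le fun A => ?_⟩
  have hD := image_word_subset_bridges hS
  have hr : ((n * gwProb ν S : ℝ≥0) : ℝ) =
      n * wset (fun j => ν.real {j}) k (k - 1) (word '' S) := by
    rw [NNReal.coe_mul, NNReal.coe_natCast, coe_gwProb, gwLaw_real ν hS]
  rw [fringeCountLaw_real, condGWLaw_real_preimage ν hS (by omega)]
  by_cases hkmod : k ≡ 1 [MOD h]
  · refine (hM n k _ _ hn hnk hk hkn hreg hmod hkmod hD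
      (nonOverlapping_of_isForestWord fun u hu => mem_image_word hS hu)
      (gwLaw_real ν hS ▸ mul_gwLaw_real_le ν hS hk) hr A).trans ?_
    exact mul_le_mul_of_nonneg_right (le_abs_self M) (by positivity)
  · have h0 : wset (fun j => ν.real {j}) k (k - 1) (word '' S) = 0 :=
      le_antisymm ((wset_le_wtot H.nonneg _ _ _).trans_eq (H.vanish k hk hkmod))
        (wset_nonneg H.nonneg _ _ _)
    have hr0 : (n : ℝ≥0) * gwProb ν S = 0 := by
      rw [h0, mul_zero] at hr
      exact_mod_cast hr
    have ha0 : wtot (fun j => ν.real {j}) n (n - 1) ≠ 0 := by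
      have hn0 : (0 : ℝ) < n := by exact_mod_cast (by omega : 0 < n)
      have := H.c_pos
      exact (lt_of_lt_of_le (by positivity) (H.lower n hn hmod)).ne'
    rw [hr0, poissonMeasure_zero_real, wsum_indicator_cyclicCount_of_wset_eq_zero H.nonneg hD hk
      (by omega) h0, mul_div_cancel_left₀ _ ha0, sub_self, abs_zero]
    positivity

end

theorem mainTheorem2
    -- `ν` is the law of the offspring variable `ξ`, with `E ξ = 1` and `0 < Var ξ < ∞`
    (ν : Measure ℕ) [IsProbabilityMeasure ν]
    (hL2 : MemLp (fun i : ℕ => (i : ℝ)) 2 ν)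
    (hmean : ∫ i : ℕ, (i : ℝ) ∂ν = 1)
    (hvar : 0 < Var[fun i : ℕ => (i : ℝ); ν])
    (k : ℕ → ℕ)
    (hk : Tendsto k (admissibleAtTop ν) atTop)
    (hkn : (fun n : ℕ => (k n : ℝ)) =o[admissibleAtTop ν] (fun n : ℕ => (n : ℝ))) :
    Tendsto
        (fun n : ℕ => ⨆ S : {S : Set PlaneTree // S ⊆ PlaneTree.ofSize (k n)},
          distTV (fringeCountLaw ν n S.1) (poissonMeasure (n * gwProb ν S.1)))
        (admissibleAtTop ν) (𝓝 0) ∧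
      ∀ A : ℕ → Set PlaneTree, (∀ᶠ n in admissibleAtTop ν, A n ⊆ PlaneTree.ofSize (k n)) →
        (Tendsto (fun n : ℕ => (n : ℝ≥0) * gwProb ν (A n)) (admissibleAtTop ν) (𝓝 0) →
          Tendsto (fun n : ℕ => (condGWLaw ν n).real {T | T.fringeCount (A n) = 0})
            (admissibleAtTop ν) (𝓝 1)) ∧
        (∀ μ : ℝ≥0, 0 < μ →
          Tendsto (fun n : ℕ => (n : ℝ≥0) * gwProb ν (A n)) (admissibleAtTop ν) (𝓝 μ) →
          Tendsto (fun n : ℕ => fringeCountLaw ν n (A n)) (admissibleAtTop ν)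
            (𝓝 ⟨poissonMeasure μ, inferInstance⟩)) ∧
        (Tendsto (fun n : ℕ => (n : ℝ≥0) * gwProb ν (A n)) (admissibleAtTop ν) atTop →
          Tendsto (fun n : ℕ => normalizedFringeCountLaw ν n (A n)) (admissibleAtTop ν)
            (𝓝 ⟨gaussianReal 0 1, inferInstance⟩)) := by
  obtain ⟨C, c, n₀, H⟩ := exists_localLimitBounds hL2 hmean hvar
  obtain ⟨M, hM⟩ := H.exists_distTV_fringeCountLaw_le
  set l := admissibleAtTop ν with hl
  have hid : Tendsto (fun n : ℕ => n) l atTop := tendsto_id.mono_left inf_le_left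
  have hmod : ∀ᶠ n in l, n ≡ 1 [MOD offspringSpan ν] :=
    mem_inf_of_right (mem_principal_self _)
  have hratio : Tendsto (fun n => (k n : ℝ) / n) l (𝓝 0) := hkn.tendsto_div_nhds_zero
  have hinv : ∀ {f : ℕ → ℕ}, Tendsto f l atTop → Tendsto (fun n => 1 / √(f n : ℝ)) l (𝓝 0) :=
    fun hf => by
      simp only [one_div]
      exact tendsto_inv_atTop_zero.comp
        (Real.tendsto_sqrt_atTop.comp (tendsto_natCast_atTop_atTop.comp hf))
  have hreg : ∀ᶠ n : ℕ in l, C * (1 / √(n : ℝ) + k n / n) ≤ c / 2 := by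
    have h : Tendsto (fun n : ℕ => C * (1 / √(n : ℝ) + k n / n)) l (𝓝 0) := by
      simpa using ((hinv hid).add hratio).const_mul C
    exact h.eventually_le_const (half_pos H.c_pos)
  have hkn4 : ∀ᶠ n in l, 4 * k n ≤ n := by
    filter_upwards [hratio.eventually_le_const (by norm_num : (0 : ℝ) < 1 / 4),
      hid.eventually_ge_atTop 1] with n h1 h2
    rw [div_le_div_iff₀ (by exact_mod_cast h2) (by norm_num)] at h1
    have : k n * 4 ≤ 1 * n := by exact_mod_cast h1
    omega
  have hbound : ∀ᶠ n in l, ∀ S : Set PlaneTree, S ⊆ PlaneTree.ofSize (k n) →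
      distTV (fringeCountLaw ν n S) (poissonMeasure (n * gwProb ν S)) ≤
        M * (√(1 / √(k n) + k n / n) + (1 / √(k n) + k n / n)) := by
    filter_upwards [hmod, hreg, hkn4, hid.eventually_ge_atTop n₀, hk.eventually_ge_atTop n₀,
      hk.eventually_ge_atTop 1] with n h1 h2 h3 h4 h5 h6 S hS
    exact hM n (k n) S hS h4 h5 h6 h3 h2 h1
  have hlim : Tendsto (fun n : ℕ => M * (√(1 / √(k n) + k n / n) + (1 / √(k n) + k n / n)))
      l (𝓝 0) := by
    have h1 : Tendsto (fun n : ℕ => 1 / √(k n : ℝ) + k n / n) l (𝓝 0) := by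
      simpa using (hinv hk).add hratio
    have h2 := (Real.continuous_sqrt.tendsto 0).comp h1
    rw [Real.sqrt_zero] at h2
    simpa using (h2.add h1).const_mul M
  refine ⟨squeeze_zero' (.of_forall fun n => Real.iSup_nonneg fun S => distTV_nonneg _ _)
    (hbound.mono fun n hn => ?_) hlim, fun A hA => ?_⟩
  · have : Nonempty {S : Set PlaneTree // S ⊆ PlaneTree.ofSize (k n)} := ⟨⟨∅, Set.empty_subset _⟩⟩
    exact ciSup_le fun S => hn S.1 S.2
  have hTV : Tendsto (fun n => distTV (fringeCountLaw ν n (A n))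
      (poissonMeasure (n * gwProb ν (A n)))) l (𝓝 0) :=
    squeeze_zero' (.of_forall fun n => distTV_nonneg _ _)
      (hbound.mp (hA.mono fun n h1 h2 => h2 _ h1)) hlim
  refine ⟨fun hA0 => ?_, fun μ _ hAμ => ?_, fun hAtop => ?_⟩
  · have h1 : Tendsto (fun n : ℕ => (poissonMeasure (n * gwProb ν (A n))).real {0}) l (𝓝 1) := by
      have h2 := (Real.continuous_exp.tendsto _).comp (NNReal.tendsto_coe.2 hA0).neg
      simpa [poissonMeasure_real_singleton, Function.comp_def] using h2
    have h2 : Tendsto (fun n : ℕ => (condGWLaw ν n).real {T | T.fringeCount (A n) = 0} -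
        (poissonMeasure (n * gwProb ν (A n))).real {0}) l (𝓝 0) := by
      refine squeeze_zero_norm (fun n => ?_) hTV
      have := abs_sub_le_distTV (P := fringeCountLaw ν n (A n))
        (Q := poissonMeasure (n * gwProb ν (A n))) {0}
      rwa [fringeCountLaw_real] at this
    simpa using h2.add h1
  · have h1 : Tendsto (fun n : ℕ => 2 * |√((n * gwProb ν (A n) : ℝ≥0) : ℝ) - √(μ : ℝ)|) l
        (𝓝 0) := by
      have h2 := (Real.continuous_sqrt.tendsto _).comp (NNReal.tendsto_coe.2 hAμ)
      simpa using ((h2.sub_const √(μ : ℝ)).abs).const_mul 2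
    refine FiniteMeasure.tendsto_of_distTV (P := fun n => fringeCountLaw ν n (A n))
      (Q := fun _ => poissonMeasure μ) (φ := fun _ => id) (fun n => Measure.map_id.symm)
      (Q' := fun _ => ⟨poissonMeasure μ, inferInstance⟩) (fun _ => Measure.map_id.symm) ?_
      tendsto_const_nhds
    refine squeeze_zero (fun n => distTV_nonneg _ _) (fun n => distTV_triangle.trans
      (add_le_add_right (distTV_poissonMeasure_le (n * gwProb ν (A n)) μ) _)) ?_
    simpa using hTV.add h1
  · have : l.IsCountablyGenerated := by
      rw [hl, admissibleAtTop]
      infer_instance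
    refine FiniteMeasure.tendsto_of_distTV (P := fun n => fringeCountLaw ν n (A n))
      (Q := fun n => poissonMeasure (n * gwProb ν (A n)))
      (φ := fun n j => ((j : ℝ) - (n : ℝ) * gwProb ν (A n)) / √((n : ℝ) * gwProb ν (A n)))
      (Q' := fun n => (standardizedPoisson (n * gwProb ν (A n))).toFiniteMeasure)
      (fun n => ?_) (fun n => ?_) hTV
      ((ProbabilityMeasure.tendsto_nhds_iff_toFiniteMeasure_tendsto_nhds _).1
        (tendsto_standardizedPoisson hAtop))
    · change Measure.map _ _ = Measure.map _ (Measure.map (PlaneTree.fringeCount (A n)) _)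
      rw [Measure.map_map .of_discrete .of_discrete]
      rfl
    · rfl
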